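/- Let $n\ge 2$, let $O_n$ be the Cuntz algebra, the universal $C^*$-algebra generated by isometries $S_1,\dots,S_n$ with $\sum_i S_iS_i^*=1$, and put $S_\mu=S_{\mu_1}\cdots S_{\mu_k}$, $|\mu|=k$ for a word $\mu$, and $O_{nc}=\mathrm{span}\{S_\mu S_\nu^*\}$. Let $\sigma_z(S_i)=zS_i$ $(|z|=1)$ be the gauge action, $F$ its fixed-point algebra, $\Phi(a)=\frac1{2\pi}\int_0^{2\pi}\sigma_{e^{i\theta}}(a)\,d\theta$ the expectation of $O_n$ onto $F$, $\tau$ the (unique) faithful normalised trace on $F$, $\psi=\tau\circ\Phi$, and let $\pi$ be the representation of $O_n$ by left multiplication on the GNS space $\mathcal H=L^2(O_n,\psi)$ with $\langle a,b\rangle=\psi(a^*b)$. Let $\mathcal D$ be the self-adjoint generator of the gauge action on $\mathcal H$, i.e. the closure of $S_\mu S_\nu^*\mapsto(|\mu|-|\nu|)S_\mu S_\nu^*$ on $O_{nc}$, and let $\Phi_k$ $(k\in\mathbf Z)$ be its spectral projections, so $\mathcal D=\sum_k k\Phi_k$. Let $\mathcal N$ be the von Neumann algebra on $\mathcal H$ generated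 by the operators $\Theta_{x,y}z=x\,\Phi(y^*z)$, $x,y\in O_{nc}$, let $\mathcal M$ be the relative commutant of $\{\Phi_k\}$ in $\mathcal N$, and for $T\in\mathcal N$, $T\ge0$, let $$\tilde\tau(T)=\langle 1,T1\rangle+\sum_{\mu\ne\emptyset}\Big(\langle S_\mu,TS_\mu\rangle+n^{-|\mu|}\langle S_\mu^*,TS_\mu^*\rangle\Big),\qquad \tau_\Delta(T)=\sup_N\tilde\tau\big(\Delta_N^{1/2}T\Delta_N^{1/2}\big),\quad \Delta_N=\sum_{|k|\le N}n^{-k}\Phi_k .$$ The restriction of $\tau_\Delta$ to $\mathcal M$ is a trace, extended linearly to $\mathcal L^1(\mathcal M,\tau_\Delta)=\{T\in\mathcal M:\tau_\Delta(|T|)<\infty\}$. Put $\mu_s(T)=\inf\{\|TE\|: E\in\mathcal M \text{ a projection},\ \tau_\Delta(1-E)\le s\}$ and $F_T(t)=\frac1{\log(1+t)}\int_0^t\mu_s(T)\,ds$ for $t>0$, and let $\mathcal L^{(1,\infty)}(\mathcal M,\tau_\Delta)$ be the set of $T\in\mathcal M$ with $\sup_{t>0}F_T(t)<\infty$. For each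 state $\omega$ of $L^\infty(0,\infty)$ that is invariant under dilations and satisfies $\omega(g)\le\limsup_{t\to\infty}g(t)$ (essential limit superior) for real $g$, the Dixmier trace on $\mathcal L^{(1,\infty)}(\mathcal M,\tau_\Delta)$ is the linear extension of $T\mapsto\omega(F_T)$, $T\ge0$. An operator in $\mathcal L^{(1,\infty)}(\mathcal M,\tau_\Delta)$ is measurable if all these Dixmier traces take the same value on it. Then: 1. $(1+\mathcal D^2)^{-1/2}\in\mathcal L^{(1,\infty)}(\mathcal M,\tau_\Delta)$. 2. For every real $s>1$, $(1+\mathcal D^2)^{-s/2}$ is a positive element of $\mathcal M$ and $\tau_\Delta\big((1+\mathcal D^2)^{-s/2}\big)<\infty$. 3. For every $f\in F$: $\pi(f)(1+\mathcal D^2)^{-s/2}\in\mathcal L^1(\mathcal M,\tau_\Delta)$ for all real $s>1$, and $$\lim_{s\to1^+}(s-1)\,\tau_\Delta\big(\pi(f)(1+\mathcal D^2)^{-s/2}\big)=2\tau(f).$$ 4. For every $f\in F$, the operator $\pi(f)(1+\mathcal D^2)^{-1/2}$ is measurable. -/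

import Mathlib

open scoped ENNReal ComplexOrder

noncomputable section

namespace ModularCuntz

/-! ### Von Neumann algebras, weights and Dixmier traces on a Hilbert space -/

section HilbertSpace

variable {H : Type*} [NormedAddCommGroup H] [InnerProductSpace ℂ H] [CompleteSpace H]

/-- The commutant of a set of operators (and of their adjoints), as a von Neumann algebra. -/
def commutantOf (E : Set (H →L[ℂ] H)) : VonNeumannAlgebra H where
  toStarSubalgebra := StarSubalgebra.centralizer ℂ E
  centralizer_centralizer' := Set.centralizer_centralizer_centralizer _

/-- The eigenspace `ker (D - x)` of an unbounded operator `D`, for a real number `x`. -/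
def eigenspace (D : H →ₗ.[ℂ] H) (x : ℝ) : Submodule ℂ H :=
  D.graph.comap (LinearMap.prod LinearMap.id ((x : ℂ) • LinearMap.id))

/-- The spectral projection of a self-adjoint operator `D` for the one-point set `{x}`: the
orthogonal projection onto `ker (D - x)`. -/
def spectralProjection (D : H →ₗ.[ℂ] H) (x : ℝ) : H →L[ℂ] H :=
  (eigenspace D x).topologicalClosure.starProjection

/-- The functional calculus `g(D) = ∑ g(x) 1_{x}(D)` of a self-adjoint operator `D` with pure
point spectrum (one whose eigenvectors span a dense subspace), for `g` bounded on the eigenvalues.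
The sum converges in the strong operator topology. -/
def functionalCalculus (D : H →ₗ.[ℂ] H) (g : ℝ → ℝ) : H →L[ℂ] H :=
  (UniformConvergenceCLM.ofFun (RingHom.id ℂ) H _).symm
    (∑' x : ℝ, ContinuousLinearMap.toPointwiseConvergenceCLM ℂ (RingHom.id ℂ) H H
      ((g x : ℂ) • spectralProjection D x))

/-- The `s`-th generalised singular value of `T` relative to a von Neumann algebra `M` with
trace `φ` (given on the positive elements of `M`):
`μ_s(T) = inf {‖T E‖ : E a projection in M with φ(1 - E) ≤ s}`. -/
def singularValue (M : VonNeumannAlgebra H) (φ : (H →L[ℂ] H) → ℝ≥0∞) (T : H →L[ℂ] H) (s : ℝ) : ℝ :=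
  sInf {r | ∃ E ∈ M, IsStarProjection E ∧ φ (1 - E) ≤ ENNReal.ofReal s ∧ r = ‖T * E‖}

/-- `F_T(t) = (1 / log(1 + t)) ∫₀ᵗ μ_s(T) ds`. -/
def logMean (M : VonNeumannAlgebra H) (φ : (H →L[ℂ] H) → ℝ≥0∞) (T : H →L[ℂ] H) (t : ℝ) : ℝ :=
  1 / Real.log (1 + t) * ∫ s in (0 : ℝ)..t, singularValue M φ T s

/-- The ideal `𝓛^{(1,∞)}(M, φ)`: the `T ∈ M` with `sup_{t > 0} F_T(t) < ∞`. -/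
def weakTraceIdeal (M : VonNeumannAlgebra H) (φ : (H →L[ℂ] H) → ℝ≥0∞) : Set (H →L[ℂ] H) :=
  {T | T ∈ M ∧ BddAbove (logMean M φ T '' Set.Ioi 0)}

/-- The ideal `𝓛¹(M, φ)`: the `T ∈ M` with `φ(|T|) < ∞`. -/
def traceIdeal (M : VonNeumannAlgebra H) (φ : (H →L[ℂ] H) → ℝ≥0∞) : Set (H →L[ℂ] H) :=
  {T | T ∈ M ∧ φ (CFC.abs T) < ∞}

/-- The linear extension of an additive positively homogeneous function `v` on positive operators,
by splitting an operator into the positive and negative parts of its real and imaginary parts. -/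
def linearExtension (v : (H →L[ℂ] H) → ℝ) (T : H →L[ℂ] H) : ℂ :=
  ((v (realPart T : H →L[ℂ] H)⁺ - v (realPart T : H →L[ℂ] H)⁻ : ℝ) : ℂ) +
    Complex.I * ((v (imaginaryPart T : H →L[ℂ] H)⁺ - v (imaginaryPart T : H →L[ℂ] H)⁻ : ℝ) : ℂ)

/-- The value `φ(T)` of a trace `φ` on a trace-class operator `T`, not necessarily positive. -/
def traceValue (φ : (H →L[ℂ] H) → ℝ≥0∞) (T : H →L[ℂ] H) : ℂ :=
  linearExtension (fun P => (φ P).toReal) T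

/-- A dilation invariant generalised limit at infinity: a (real) linear functional `ω` on
`L^∞(0, ∞)` that is dominated by the essential limit superior at infinity (hence is a state, lies
between the limits inferior and superior, and vanishes on functions tending to zero at infinity)
and is invariant under the dilations `g ↦ g(a ·)`, `a > 0`. -/
structure DixmierState extends
    MeasureTheory.Lp ℝ ∞ (MeasureTheory.volume.restrict (Set.Ioi (0 : ℝ))) →ₗ[ℝ] ℝ where
  le_of_eventually_le' : ∀ (g : MeasureTheory.Lp ℝ ∞
      (MeasureTheory.volume.restrict (Set.Ioi (0 : ℝ)))) (c t₀ : ℝ),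
    (∀ᵐ t ∂(MeasureTheory.volume.restrict (Set.Ioi (0 : ℝ))), t₀ ≤ t → g t ≤ c) → toFun g ≤ c
  dilation' : ∀ (a : ℝ), 0 < a → ∀ (g h : MeasureTheory.Lp ℝ ∞
      (MeasureTheory.volume.restrict (Set.Ioi (0 : ℝ)))),
    (∀ᵐ t ∂(MeasureTheory.volume.restrict (Set.Ioi (0 : ℝ))), h t = g (a * t)) → toFun h = toFun g

open scoped Classical in
/-- The value of `ω` on (the class of) an essentially bounded measurable function `g` on
`(0, ∞)`. -/
def DixmierState.eval (ω : DixmierState) (g : ℝ → ℝ) : ℝ :=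
  if h : MeasureTheory.MemLp g ∞ (MeasureTheory.volume.restrict (Set.Ioi (0 : ℝ))) then
    ω.toLinearMap (h.toLp g) else 0

/-- The Dixmier trace `φ_ω` on `𝓛^{(1,∞)}(M, φ)`: the linear extension of `T ↦ ω(F_T)`,
`T ≥ 0`. -/
def dixmierTrace (ω : DixmierState) (M : VonNeumannAlgebra H) (φ : (H →L[ℂ] H) → ℝ≥0∞)
    (T : H →L[ℂ] H) : ℂ :=
  linearExtension (fun P => ω.eval (logMean M φ P)) T

/-- `T` is measurable: it lies in `𝓛^{(1,∞)}(M, φ)` and all Dixmier traces take the same value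
on it. -/
def IsMeasurableOperator (M : VonNeumannAlgebra H) (φ : (H →L[ℂ] H) → ℝ≥0∞) (T : H →L[ℂ] H) :
    Prop :=
  T ∈ weakTraceIdeal M φ ∧ ∃ c : ℂ, ∀ ω : DixmierState, dixmierTrace ω M φ T = c

end HilbertSpace

/-! ### The Cuntz algebra, its gauge action and the trace on the fixed-point algebra -/

/-- The separable infinite-dimensional Hilbert space `ℓ²(ℕ)`. -/
abbrev SeqHilbert : Type := lp (fun _ : ℕ => ℂ) 2

/-- Bounded operators on `ℓ²(ℕ)`. -/
abbrev SeqOp : Type := SeqHilbert →L[ℂ] SeqHilbert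

instance : Nontrivial SeqHilbert := by
  refine ⟨⟨lp.single 2 0 (1:ℂ), 0, fun h => ?_⟩⟩
  have := congrArg (fun x : SeqHilbert => (x : ℕ → ℂ) 0) h
  simp at this

/-- `n` isometries `T i` with `∑ T i (T i)* = 1`. -/
structure IsCuntzFamily {B : Type*} [Ring B] [StarRing B] {n : ℕ} (T : Fin n → B) : Prop where
  isometry : ∀ i, star (T i) * T i = 1
  sum_range : ∑ i, T i * star (T i) = 1

/-- All Cuntz families of `n` isometries on `ℓ²(ℕ)`, i.e. all representations of the Cuntz relations
on a separable infinite-dimensional Hilbert space. -/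
abbrev Rep (n : ℕ) : Type := {T : Fin n → SeqOp // IsCuntzFamily T}

/-- Bounded families of operators indexed by all Cuntz families, with the supremum norm: the
`ℓ^∞`-product C*-algebra over all representations of the Cuntz relations. -/
abbrev BoundedFields (n : ℕ) : Type := lp (fun _ : Rep n => SeqOp) ∞
instance (n : ℕ) : CStarAlgebra (BoundedFields n) where


theorem IsCuntzFamily.norm_le_one {n : ℕ} {T : Fin n → SeqOp} (h : IsCuntzFamily T) (i : Fin n) :
    ‖T i‖ ≤ 1 := by
  have h1 : ‖T i‖ * ‖T i‖ = 1 := by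
    rw [← CStarRing.norm_star_mul_self, h.isometry i, norm_one]
  nlinarith [norm_nonneg (T i)]

/-- The `i`-th generator of the universal family: its value at a family `T` is `T i`. -/
def universalGenerator (n : ℕ) (i : Fin n) : BoundedFields n :=
  ⟨fun T => T.1 i, memℓp_infty ⟨1, by rintro _ ⟨T, rfl⟩; exact T.2.norm_le_one i⟩⟩

/-- The closed *-subalgebra generated by the universal family. -/
def cuntzSubalgebra (n : ℕ) : StarSubalgebra ℂ (BoundedFields n) :=
  (StarAlgebra.adjoin ℂ (Set.range (universalGenerator n))).topologicalClosure

/-- The Cuntz algebra `O_n`: the universal C*-algebra generated by `n` isometries `S i` with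
`∑ S i (S i)* = 1`. It is realised as the completion of the *-polynomials in the `S i` in the
universal norm, the supremum of the operator norms over all representations of the relations on
`ℓ²(ℕ)`. (For `n ≥ 2` the cyclic representations are separable and infinite-dimensional, so these
representations give the full universal norm.) -/
def CuntzAlgebra (n : ℕ) : Type := cuntzSubalgebra n

instance (n : ℕ) : CStarAlgebra (CuntzAlgebra n) :=
  haveI : IsClosed (cuntzSubalgebra n : Set (BoundedFields n)) :=
    StarSubalgebra.isClosed_topologicalClosure _
  inferInstanceAs (CStarAlgebra (cuntzSubalgebra n))

/-- The usual order on a C*-algebra, with positive cone `{a* a}`. -/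
instance (n : ℕ) : PartialOrder (CuntzAlgebra n) := CStarAlgebra.spectralOrder _

instance (n : ℕ) : StarOrderedRing (CuntzAlgebra n) := CStarAlgebra.spectralOrderedRing _

variable {n : ℕ}

/-- The generating isometries `S i` of `O_n`. -/
def gen (i : Fin n) : CuntzAlgebra n :=
  ⟨universalGenerator n i,
    StarSubalgebra.le_topologicalClosure _ (StarAlgebra.subset_adjoin ℂ _ ⟨i, rfl⟩)⟩

theorem isCuntzFamily_gen : IsCuntzFamily (gen : Fin n → CuntzAlgebra n) where
  isometry i := Subtype.ext (Subtype.ext (funext fun T => T.2.isometry i))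
  sum_range := by
    apply Subtype.ext
    apply Subtype.ext
    funext T
    have h : ((∑ i, universalGenerator n i * star (universalGenerator n i) :
        BoundedFields n) : ∀ _ : Rep n, SeqOp) T = 1 := by
      rw [lp.coeFn_sum, Finset.sum_apply]
      exact T.2.sum_range
    have h2 : ((∑ i, gen i * star (gen i) : CuntzAlgebra n) : cuntzSubalgebra n).1 =
        ∑ i, universalGenerator n i * star (universalGenerator n i) :=
      map_sum (cuntzSubalgebra n).subtype (fun i => gen i * star (gen i)) _
    rw [h2]
    exact h

theorem star_mul_circle (z : Circle) : star (z : ℂ) * z = 1 := by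
  simp [← Complex.normSq_eq_conj_mul_self]

/-- Multiplying a Cuntz family by `z` of modulus one gives a Cuntz family. -/
def rotate (z : Circle) (T : Rep n) : Rep n :=
  ⟨fun i => (z : ℂ) • T.1 i,
    { isometry := fun i => by
        rw [star_smul, smul_mul_smul_comm, T.2.isometry i, star_mul_circle, one_smul]
      sum_range := by
        simp_rw [star_smul, smul_mul_smul_comm, mul_comm (z : ℂ), star_mul_circle, one_smul]
        exact T.2.sum_range }⟩

/-- Relabelling of the coordinates by `T ↦ z T`. -/
def fieldGauge (z : Circle) : BoundedFields n →⋆ₐ[ℂ] BoundedFields n where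
  toFun a := ⟨fun T => a (rotate z T), by
    obtain ⟨C, hC⟩ := memℓp_infty_iff.mp (lp.memℓp a)
    exact memℓp_infty ⟨C, by rintro _ ⟨T, rfl⟩; exact hC ⟨rotate z T, rfl⟩⟩⟩
  map_one' := rfl
  map_mul' _ _ := rfl
  map_zero' := rfl
  map_add' _ _ := rfl
  commutes' _ := rfl
  map_star' _ := rfl

theorem norm_fieldGauge_le (z : Circle) (a : BoundedFields n) : ‖fieldGauge z a‖ ≤ ‖a‖ :=
  NonUnitalStarAlgHom.norm_apply_le (fieldGauge z) a

theorem fieldGauge_mem (z : Circle) {a : BoundedFields n} (ha : a ∈ cuntzSubalgebra n) :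
    fieldGauge z a ∈ cuntzSubalgebra n := by
  have h1 : StarAlgebra.adjoin ℂ (Set.range (universalGenerator n)) ≤
      (cuntzSubalgebra n).comap (fieldGauge z) := by
    apply StarAlgebra.adjoin_le
    rintro _ ⟨i, rfl⟩
    exact (cuntzSubalgebra n).smul_mem (gen i).2 (z : ℂ)
  refine StarSubalgebra.topologicalClosure_minimal h1 ?_ ha
  exact (StarSubalgebra.isClosed_topologicalClosure _).preimage
    (AddMonoidHomClass.continuous_of_bound (fieldGauge (n := n) z) 1
      fun a => by simpa using norm_fieldGauge_le z a)

/-- The gauge action: the automorphism of `O_n` with `S i ↦ z S i`. -/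
def gauge (z : Circle) : CuntzAlgebra n →⋆ₐ[ℂ] CuntzAlgebra n :=
  ((fieldGauge z).comp (cuntzSubalgebra n).subtype).codRestrict (cuntzSubalgebra n)
    fun a => fieldGauge_mem z a.2

theorem gauge_gen (z : Circle) (i : Fin n) : gauge z (gen i) = (z : ℂ) • gen i := rfl


theorem gauge_mul (z w : Circle) (a : CuntzAlgebra n) :
    gauge z (gauge w a) = gauge (z * w) a := by
  apply Subtype.ext
  apply Subtype.ext
  funext T
  change (a.1 : ∀ _, _) (rotate w (rotate z T)) = (a.1 : ∀ _, _) (rotate (z * w) T)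
  have h : rotate w (rotate z T) = rotate (z * w) T :=
    Subtype.ext (funext fun i => by simp [rotate, smul_smul, mul_comm])
  rw [h]

theorem continuous_gauge (a : CuntzAlgebra n) : Continuous fun z : Circle => gauge z a := by
  have h1 : ∀ b ∈ StarAlgebra.adjoin ℂ (Set.range (universalGenerator n)),
      Continuous fun z : Circle => fieldGauge z b := by
    intro b hb
    induction hb using StarAlgebra.adjoin_induction with
    | mem x hx =>
      obtain ⟨i, rfl⟩ := hx
      change Continuous fun z : Circle => (z : ℂ) • universalGenerator n i
      fun_prop
    | algebraMap r => simpa only [AlgHomClass.commutes] using continuous_const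
    | add x y _ _ hx hy => simp only [map_add]; fun_prop
    | mul x y _ _ hx hy => simp only [map_mul]; fun_prop
    | star x _ hx => simpa only [map_star] using hx.star
  refine Continuous.subtype_mk (f := fun z : Circle => fieldGauge z a.1) ?_ _
  refine continuous_of_uniform_approx_of_continuous fun u hu => ?_
  obtain ⟨ε, hε, hu⟩ := Metric.mem_uniformity_dist.mp hu
  obtain ⟨b, hb, hab⟩ := Metric.mem_closure_iff.mp a.2 ε hε
  refine ⟨_, h1 b hb, fun z => hu ?_⟩
  rw [dist_eq_norm, ← map_sub]
  exact (norm_fieldGauge_le z _).trans_lt (by rwa [← dist_eq_norm])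

theorem intervalIntegrable_gauge (a : CuntzAlgebra n) (x y : ℝ) :
    IntervalIntegrable (fun θ : ℝ => gauge (Circle.exp θ) a) MeasureTheory.volume x y :=
  ((continuous_gauge a).comp Circle.exp.continuous).intervalIntegrable _ _

/-- `gauge z` as a continuous linear map. -/
def gaugeL (z : Circle) : CuntzAlgebra n →L[ℂ] CuntzAlgebra n :=
  LinearMap.mkContinuous (gauge z).toAlgHom.toLinearMap 1
    fun a => by simpa using NonUnitalStarAlgHom.norm_apply_le (gauge z) a

/-- `S_μ = S_{μ 1} ⋯ S_{μ k}` for a word `μ` (with `S_∅ = 1`). -/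
def wordGen (μ : List (Fin n)) : CuntzAlgebra n := (μ.map gen).prod

/-- The dense *-algebra `O_{nc}`, the linear span of the monomials `S_μ (S_ν)*`. -/
def polyAlgebra (n : ℕ) : Submodule ℂ (CuntzAlgebra n) :=
  Submodule.span ℂ {a | ∃ μ ν : List (Fin n), a = wordGen μ * star (wordGen ν)}

/-- The fixed-point algebra `F` of the gauge action. -/
def fixedAlgebra (n : ℕ) : StarSubalgebra ℂ (CuntzAlgebra n) :=
  ⨅ z : Circle, StarAlgHom.equalizer (gauge z) (StarAlgHom.id ℂ (CuntzAlgebra n))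

theorem mem_fixedAlgebra {a : CuntzAlgebra n} :
    a ∈ fixedAlgebra n ↔ ∀ z : Circle, gauge z a = a := by
  simp [fixedAlgebra, StarSubalgebra.mem_iInf, StarAlgHom.mem_equalizer]

/-- `(1/2π) ∫ σ_z(a) dθ`, `z = e^{iθ}`, as an element of `O_n`. -/
def gaugeMean (a : CuntzAlgebra n) : CuntzAlgebra n :=
  (1 / (2 * Real.pi) : ℝ) • ∫ θ in (0 : ℝ)..(2 * Real.pi), gauge (Circle.exp θ) a

theorem gaugeMean_mem (a : CuntzAlgebra n) : gaugeMean a ∈ fixedAlgebra n := by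
  rw [mem_fixedAlgebra]
  intro z
  obtain ⟨φ, rfl⟩ := Circle.exp_surjective z
  have h1 : gaugeL (Circle.exp φ) (gaugeMean a) = (1 / (2 * Real.pi) : ℝ) •
      ∫ θ in (0 : ℝ)..(2 * Real.pi), gauge (Circle.exp (θ + φ)) a := by
    rw [gaugeMean, ← Complex.coe_smul, map_smul, Complex.coe_smul,
      ← ContinuousLinearMap.intervalIntegral_comp_comm _ (intervalIntegrable_gauge a _ _)]
    congr 2
    funext θ
    change gauge (Circle.exp φ) (gauge (Circle.exp θ) a) = _
    rw [gauge_mul, ← Circle.exp_add, add_comm]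
  have hper : Function.Periodic (fun θ : ℝ => gauge (Circle.exp θ) a) (2 * Real.pi) :=
    fun θ => by simp [Circle.exp_add]
  refine h1.trans ?_
  rw [intervalIntegral.integral_comp_add_right (fun θ : ℝ => gauge (Circle.exp θ) a), gaugeMean,
    zero_add, add_comm (2 * Real.pi) φ, hper.intervalIntegral_add_eq φ 0, zero_add]

/-- The conditional expectation `Φ : O_n → F`, the average over the gauge action. -/
def expectation : CuntzAlgebra n →ₗ[ℂ] fixedAlgebra n where
  toFun a := ⟨gaugeMean a, gaugeMean_mem a⟩
  map_add' a b := by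
    apply Subtype.ext
    change gaugeMean (a + b) = gaugeMean a + gaugeMean b
    simp only [gaugeMean, map_add]
    rw [intervalIntegral.integral_add (intervalIntegrable_gauge a _ _)
      (intervalIntegrable_gauge b _ _), smul_add]
  map_smul' c a := by
    apply Subtype.ext
    change gaugeMean (c • a) = c • gaugeMean a
    simp only [gaugeMean, map_smul]
    rw [intervalIntegral.integral_smul, smul_comm]

theorem expectation_nonneg {a : CuntzAlgebra n} (ha : 0 ≤ a) :
    (0 : CuntzAlgebra n) ≤ expectation a := by
  have h1 : ∀ θ : ℝ, 0 ≤ gauge (Circle.exp θ) a := fun θ => map_nonneg _ ha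
  change 0 ≤ (1 / (2 * Real.pi) : ℝ) • ∫ θ in (0 : ℝ)..(2 * Real.pi), gauge (Circle.exp θ) a
  rw [intervalIntegral.integral_of_le Real.two_pi_pos.le]
  exact smul_nonneg (by positivity) (MeasureTheory.integral_nonneg h1)

/-- A faithful normalised (positive) trace on `F`. There is exactly one when `n ≥ 2`. Positivity in
the closed subalgebra `F` is positivity in `O_n`. -/
structure FaithfulNormalizedTrace (n : ℕ) extends fixedAlgebra n →ₗ[ℂ] ℂ where
  nonneg' : ∀ f : fixedAlgebra n, (0 : CuntzAlgebra n) ≤ f → 0 ≤ toFun f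
  tracial' : ∀ f g : fixedAlgebra n, toFun (f * g) = toFun (g * f)
  normalized' : toFun 1 = 1
  faithful' : ∀ f : fixedAlgebra n, toFun (star f * f) = 0 → f = 0

instance : CoeFun (FaithfulNormalizedTrace n) fun _ => fixedAlgebra n → ℂ where
  coe τ := τ.toLinearMap

/-- The state `ψ = τ ∘ Φ` on `O_n`. -/
def FaithfulNormalizedTrace.kms (τ : FaithfulNormalizedTrace n) : CuntzAlgebra n →ₚ[ℂ] ℂ :=
  PositiveLinearMap.mk₀ (τ.toLinearMap ∘ₗ expectation)
    fun _ ha => τ.nonneg' _ (expectation_nonneg ha)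

/-- The GNS Hilbert space `L²(O_n, ψ)`: the completion of `O_n` for `⟨a, b⟩ = ψ(a* b)`. -/
abbrev L2 (τ : FaithfulNormalizedTrace n) : Type := τ.kms.GNS

/-- The representation `π` of `O_n` on `L²(O_n, ψ)` by left multiplication. -/
def rep (τ : FaithfulNormalizedTrace n) : CuntzAlgebra n →⋆ₐ[ℂ] (L2 τ →L[ℂ] L2 τ) :=
  τ.kms.gnsStarAlgHom

/-- The element `a ∈ O_n`, regarded as a vector of `L²(O_n, ψ)`. -/
def vec (τ : FaithfulNormalizedTrace n) : CuntzAlgebra n →ₗ[ℂ] L2 τ :=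
  (UniformSpace.Completion.toComplₗᵢ (𝕜 := ℂ) (E := τ.kms.PreGNS)).toLinearMap ∘ₗ
    τ.kms.toPreGNS.toLinearMap

/-! ### The modular spectral triple -/

section Triple

variable (τ : FaithfulNormalizedTrace n)

/-- The generator `D` of the gauge action on `L²(O_n, ψ)`: the closure of the operator on `O_{nc}`
with `D (S_μ (S_ν)*) = (|μ| - |ν|) S_μ (S_ν)*`. -/
def gaugeGenerator : L2 τ →ₗ.[ℂ] L2 τ :=
  (Submodule.span ℂ {p : L2 τ × L2 τ | ∃ μ ν : List (Fin n),
    p = (vec τ (wordGen μ * star (wordGen ν)),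
      ((μ.length : ℂ) - (ν.length : ℂ)) • vec τ (wordGen μ * star (wordGen ν)))}
    ).topologicalClosure.toLinearPMap

/-- The spectral projections `Φ_k` of `D`, for `k ∈ ℤ`. -/
def gaugeProjection (k : ℤ) : L2 τ →L[ℂ] L2 τ :=
  spectralProjection (gaugeGenerator τ) (k : ℝ)

/-- The operator `(1 + D²)^{-s/2}`. -/
def resolventPower (s : ℝ) : L2 τ →L[ℂ] L2 τ :=
  functionalCalculus (gaugeGenerator τ) fun x => (1 + x ^ 2) ^ (-s / 2)

/-- The rank one endomorphisms `Θ_{x,y} z = x Φ(y* z)`, `x, y ∈ O_{nc}`, of the right `F`-module,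
as bounded operators on `L²(O_n, ψ)`. Their linear span is `End_F^{00}(O_{nc})`. -/
def rankOneEndomorphisms : Set (L2 τ →L[ℂ] L2 τ) :=
  {T | ∃ x ∈ polyAlgebra n, ∃ y ∈ polyAlgebra n, ∀ z : CuntzAlgebra n,
    T (vec τ z) = vec τ (x * (expectation (star y * z) : CuntzAlgebra n))}

/-- The von Neumann algebra `𝓝 = End_F^{00}(O_{nc})''`. -/
def algN : VonNeumannAlgebra (L2 τ) :=
  (commutantOf (rankOneEndomorphisms τ)).commutant

/-- The von Neumann algebra `𝓜`, the relative commutant in `𝓝` of the spectral projections `Φ_k`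
of `Δ = n^{-D}`. -/
def algM : VonNeumannAlgebra (L2 τ) :=
  commutantOf (((algN τ).commutant : Set (L2 τ →L[ℂ] L2 τ)) ∪ Set.range (gaugeProjection τ))

theorem spectralProjection_star {H : Type*} [NormedAddCommGroup H] [InnerProductSpace ℂ H]
    [CompleteSpace H] (D : H →ₗ.[ℂ] H) (x : ℝ) :
    star (spectralProjection D x) = spectralProjection D x :=
  (isStarProjection_starProjection (U := (eigenspace D x).topologicalClosure)).isSelfAdjoint

theorem mem_algM {T : L2 τ →L[ℂ] L2 τ} :
    T ∈ algM τ ↔ T ∈ algN τ ∧ ∀ k, gaugeProjection τ k * T = T * gaugeProjection τ k := by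
  have h1 : T ∈ algM τ ↔ ∀ g ∈ ((algN τ).commutant : Set (L2 τ →L[ℂ] L2 τ)) ∪
      Set.range (gaugeProjection τ), g * T = T * g ∧ star g * T = T * star g :=
    StarSubalgebra.mem_centralizer_iff ℂ
  have h2 : T ∈ algN τ ↔ ∀ g ∈ (algN τ).commutant, g * T = T * g := by
    rw [← VonNeumannAlgebra.mem_commutant_iff, VonNeumannAlgebra.commutant_commutant]
  rw [h1, h2]
  constructor
  · exact fun h => ⟨fun g hg => (h g (Or.inl hg)).1, fun k => (h _ (Or.inr ⟨k, rfl⟩)).1⟩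
  · rintro ⟨h, h'⟩ g (hg | ⟨k, rfl⟩)
    · exact ⟨h g hg, h _ (star_mem hg)⟩
    · refine ⟨h' k, ?_⟩
      rw [gaugeProjection, spectralProjection_star]
      exact h' k

/-- The vector functional `T ↦ ⟨a, T a⟩`, for `T ≥ 0`. -/
def vectorWeight (a : CuntzAlgebra n) (T : L2 τ →L[ℂ] L2 τ) : ℝ≥0∞ :=
  ENNReal.ofReal (inner ℂ (vec τ a) (T (vec τ a))).re

/-- The faithful normal semifinite trace `τ̃` on `𝓝₊` with `τ̃(Θ_{x,y}) = ψ(y* x)`: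
`τ̃(T) = ⟨1, T 1⟩ + ∑_{μ ≠ ∅} (⟨S_μ, T S_μ⟩ + n^{-|μ|} ⟨(S_μ)*, T (S_μ)*⟩)`. -/
def tauTilde (T : L2 τ →L[ℂ] L2 τ) : ℝ≥0∞ :=
  vectorWeight τ 1 T + ∑' μ : {μ : List (Fin n) // μ ≠ []},
    (vectorWeight τ (wordGen μ.1) T +
      ((n : ℝ≥0∞)⁻¹) ^ μ.1.length * vectorWeight τ (star (wordGen μ.1)) T)

/-- `(Δ_N)^{1/2}`, where `Δ_N = Δ ∑_{|k| ≤ N} Φ_k = ∑_{|k| ≤ N} n^{-k} Φ_k`. -/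
def sqrtDeltaTrunc (N : ℕ) : L2 τ →L[ℂ] L2 τ :=
  ∑ k ∈ Finset.Icc (-(N : ℤ)) N, (((n : ℝ) ^ (-(k : ℝ) / 2) : ℝ) : ℂ) • gaugeProjection τ k

/-- The weight `τ_Δ(T) = sup_N τ̃(Δ_N T)` on `𝓝₊`. As usual, `τ̃(Δ_N T)` for positive `T` is
`τ̃(Δ_N^{1/2} T Δ_N^{1/2})`. -/
def tauDelta (T : L2 τ →L[ℂ] L2 τ) : ℝ≥0∞ :=
  ⨆ N : ℕ, tauTilde τ (sqrtDeltaTrunc τ N * T * sqrtDeltaTrunc τ N)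

end Triple

end ModularCuntz

end

open Filter Topology ENNReal ModularCuntz

/-!
The expectation, the trace and the operators in question all respect the grading of `O_n`
by `|μ| - |ν|`. The spectral subspaces of the generator `D` are the closures of the homogeneous
parts of `O_{nc}` (`eigenspace_gaugeGenerator_int`), so a bounded function `g(D)` is the diagonal
operator `diag τ g = ∑ g(k) Φ_k`, and `(1 + D²)^{-s/2}` is `diag τ (resolventSymbol s)`.

*The weight.* The factors `n^{-k}` of `Δ` turn `τ_Δ` into a sum of vector functionals over words
(`tauDelta_eq`). A trace on `F` satisfies `∑_{|μ| = k} τ(S_μ* f S_μ) = n^k τ(f)` and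
`∑_{|μ| = k} τ(S_μ f S_μ*) = τ(f)`, so each degree contributes `τ(f)` and
`τ_Δ(π(f) g(D)) = τ(f) ∑_k g(k)` for positive `f ∈ F` and `g ≥ 0` (`tauDelta_rep_mul_diag`). With
`g(k) = (1 + k²)^{-s/2}` the sum differs from `2 ζ(s)` by a bounded amount, which gives finiteness
for `s > 1` and the residue `2 τ(f)` (`tendsto_sub_one_mul_intSum`); general `f` follow because
`linearExtension` respects the splitting of `f` (`linearExtension_rep_mul_diag`).

*The singular values.* The weight is a trace on `𝓜` (`tauDelta_star_mul_self`): the matrix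
coefficients of `X ∈ 𝓜` with respect to words commute with the right action of `F`, and on
`L²(F, τ)` the adjoint is isometric. Consequently a projection at a positive angle to `E` has trace
at most `τ_Δ(1 - E)` (`trace_le_trace_one_sub`). If `a ∈ F` is positive with finite spectrum,
`a = ∑ x p_x`, the spectral projection of `π(a) (1 + D²)^{-1/2}` for values above `c` has trace
close to `∑ τ(p_x) 2 x / c = 2 τ(a) / c`, whence `μ_s ~ 2 τ(a) / s`. Elements of finite spectrum are
dense in the positive part of `F` (`exists_spectralDecomposition_near`), and
`μ_{s + 2m}(π(f) (1 + D²)^{-1/2}) ≤ μ_s(π(a) (1 + D²)^{-1/2}) + ‖f - a‖ / m`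
(`modelSingularValue_add_le`) carries the asymptotics over to all positive `f ∈ F`
(`tendsto_mul_modelSingularValue`). Then `F_T(t)` converges to `2 τ(f)` (`tendsto_logMean`), so
every dilation invariant generalised limit takes this value, and the Dixmier traces agree.
-/

namespace ModularCuntz

/-! ### Hilbert sums and projections -/

section HilbertSum

variable {H : Type*} [NormedAddCommGroup H] [InnerProductSpace ℂ H] [CompleteSpace H]

theorem hasSum_starProjection_of_isHilbertSum {ι : Type*} {V : ι → Submodule ℂ H}
    [∀ i, CompleteSpace (V i)]
    (hV : IsHilbertSum ℂ (fun i => V i) fun i => (V i).subtypeₗᵢ) (x : H) :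
    HasSum (fun i => (V i).starProjection x) x := by
  obtain ⟨w, rfl⟩ := hV.linearIsometryEquiv.symm.surjective x
  have h := hV.hasSum_linearIsometryEquiv_symm w
  convert h using 2 with i
  have h2 := h.mapL (V i).starProjection
  refine h2.unique ?_
  have h3 : (V i).starProjection (w i : H) = w i :=
    Submodule.starProjection_eq_self_iff.mpr (w i).2
  change HasSum (fun j => (V i).starProjection ((V j).subtypeₗᵢ (w j))) (w i : H)
  rw [← h3]
  refine hasSum_single i fun j hj => ?_
  refine (Submodule.starProjection_apply_eq_zero_iff _).mpr ?_
  exact (Submodule.isOrtho_iff_le.mp (hV.OrthogonalFamily.isOrtho hj)) (w j).2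

/-- A bounded sequence acts diagonally on a Hilbert sum. -/
theorem exists_diagonal {ι : Type*} {V : ι → Submodule ℂ H} [∀ i, CompleteSpace (V i)]
    (hV : IsHilbertSum ℂ (fun i => V i) fun i => (V i).subtypeₗᵢ) (g : ι → ℝ) (C : ℝ)
    (hg : ∀ i, |g i| ≤ C) (hC : 0 ≤ C) :
    ∃ T : H →L[ℂ] H, (∀ x, HasSum (fun i => (g i : ℂ) • (V i).starProjection x) (T x)) ∧
      ‖T‖ ≤ C := by
  have hle : ∀ x i, ‖(g i : ℂ) • (V i).starProjection x‖ ^ 2 ≤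
      C ^ 2 * ‖(V i).starProjection x‖ ^ 2 := fun x i => by
    rw [norm_smul, mul_pow, Complex.norm_real, Real.norm_eq_abs]
    exact mul_le_mul_of_nonneg_right (pow_le_pow_left₀ (abs_nonneg _) (hg i) 2) (sq_nonneg _)
  have hsum : ∀ x, Summable fun i => (g i : ℂ) • (V i).starProjection x := fun x => by
    have h1 := (hasSum_starProjection_of_isHilbertSum hV x).summable
    have h2 := (hV.OrthogonalFamily.summable_iff_norm_sq_summable
      fun i => (V i).orthogonalProjectionOnto x).mp h1
    refine (hV.OrthogonalFamily.summable_iff_norm_sq_summable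
      fun i => (g i : ℂ) • (V i).orthogonalProjectionOnto x).mpr ?_
    exact Summable.of_nonneg_of_le (fun i => sq_nonneg _) (hle x) (h2.mul_left (C ^ 2))
  have hbound : ∀ x, ‖∑' i, (g i : ℂ) • (V i).starProjection x‖ ≤ C * ‖x‖ := fun x => by
    have hfin : ∀ s : Finset ι, ‖∑ i ∈ s, (g i : ℂ) • (V i).starProjection x‖ ≤
        C * ‖∑ i ∈ s, (V i).starProjection x‖ := fun s => by
      have e1 : ‖∑ i ∈ s, (g i : ℂ) • (V i).starProjection x‖ ^ 2 =
          ∑ i ∈ s, ‖(g i : ℂ) • (V i).starProjection x‖ ^ 2 :=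
        hV.OrthogonalFamily.norm_sum (fun i => (g i : ℂ) • (V i).orthogonalProjectionOnto x) s
      have e2 : ‖∑ i ∈ s, (V i).starProjection x‖ ^ 2 = ∑ i ∈ s, ‖(V i).starProjection x‖ ^ 2 :=
        hV.OrthogonalFamily.norm_sum (fun i => (V i).orthogonalProjectionOnto x) s
      refine le_of_sq_le_sq ?_ (by positivity)
      rw [e1, mul_pow, e2, Finset.mul_sum]
      exact Finset.sum_le_sum fun i _ => hle x i
    refine le_of_tendsto_of_tendsto' (hsum x).hasSum.norm
      ((hasSum_starProjection_of_isHilbertSum hV x).norm.const_mul C) hfin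
  let L : H →ₗ[ℂ] H :=
    { toFun := fun x => ∑' i, (g i : ℂ) • (V i).starProjection x
      map_add' := fun x y => by
        rw [← (hsum x).tsum_add (hsum y)]
        simp
      map_smul' := fun c x => by
        rw [RingHom.id_apply, ← (hsum x).tsum_const_smul]
        simp [smul_comm c] }
  exact ⟨L.mkContinuous C hbound, fun x => (hsum x).hasSum,
    LinearMap.mkContinuous_norm_le _ hC hbound⟩

/-- The functional calculus of an operator whose eigenspaces for the integers form a Hilbert sum is
the corresponding diagonal operator. -/
theorem hasSum_functionalCalculus {V : ℤ → Submodule ℂ H} [∀ i, CompleteSpace (V i)]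
    (hV : IsHilbertSum ℂ (fun i => V i) fun i => (V i).subtypeₗᵢ) {D : H →ₗ.[ℂ] H}
    (hD : ∀ k : ℤ, spectralProjection D k = (V k).starProjection)
    (hD' : ∀ x : ℝ, x ∉ Set.range ((↑) : ℤ → ℝ) → spectralProjection D x = 0)
    (g : ℝ → ℝ) (C : ℝ) (hg : ∀ k : ℤ, |g k| ≤ C) (x : H) :
    HasSum (fun k : ℤ => (g k : ℂ) • (V k).starProjection x) (functionalCalculus D g x) := by
  obtain ⟨T, hT, -⟩ := exists_diagonal hV (fun k : ℤ => g k) C hg ((abs_nonneg _).trans (hg 0))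
  have key : functionalCalculus D g = T := by
    have : HasSum (fun x : ℝ => ContinuousLinearMap.toPointwiseConvergenceCLM ℂ (RingHom.id ℂ) H H
        ((g x : ℂ) • spectralProjection D x))
        (ContinuousLinearMap.toPointwiseConvergenceCLM ℂ (RingHom.id ℂ) H H T) := by
      have hinj : Function.Injective ((↑) : ℤ → ℝ) := Int.cast_injective
      rw [← hinj.hasSum_iff fun x hx => by rw [hD' x hx, smul_zero, map_zero]]
      refine PointwiseConvergenceCLM.tendsto_iff_forall_tendsto.mpr fun x => ?_
      refine (hT x).congr' (Eventually.of_forall fun s => ?_)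
      beta_reduce
      rw [sum_apply]
      refine Finset.sum_congr rfl fun k _ => ?_
      simp [hD]
      rfl
    rw [functionalCalculus, this.tsum_eq]
    rfl
  rw [key]
  exact hT x

/-- If `X i` commutes with the projection `p i`, and the projections are mutually orthogonal, then
`∑ p i * X i` is block diagonal, so its norm is at most the largest of the `‖X i‖`. -/
theorem norm_sum_mul_le_of_commute {ι : Type*} (s : Finset ι) (p X : ι → H →L[ℂ] H) {C : ℝ}
    (hC : 0 ≤ C) (hp : ∀ i ∈ s, IsStarProjection (p i))
    (hpp : ∀ i ∈ s, ∀ j ∈ s, i ≠ j → p i * p j = 0)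
    (hX : ∀ i ∈ s, Commute (p i) (X i)) (hXC : ∀ i ∈ s, ‖X i‖ ≤ C) :
    ‖∑ i ∈ s, p i * X i‖ ≤ C := by
  have pyth : ∀ v : ι → H, ‖∑ i ∈ s, p i (v i)‖ ^ 2 = ∑ i ∈ s, ‖p i (v i)‖ ^ 2 := fun v => by
    have h : inner ℂ (∑ i ∈ s, p i (v i)) (∑ i ∈ s, p i (v i)) =
        ∑ i ∈ s, inner ℂ (p i (v i)) (p i (v i)) := by
      rw [sum_inner]
      refine Finset.sum_congr rfl fun i hi => ?_
      rw [inner_sum]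
      refine Finset.sum_eq_single i (fun j hj hji => ?_) fun h => absurd hi h
      have h1 : inner ℂ (p i (v i)) (p j (v j)) = inner ℂ (v i) ((p i * p j) (v j)) := by
        rw [← (hp i hi).isSelfAdjoint.star_eq, ContinuousLinearMap.star_eq_adjoint,
          ContinuousLinearMap.adjoint_inner_left, ← ContinuousLinearMap.star_eq_adjoint,
          (hp i hi).isSelfAdjoint.star_eq]
        rfl
      rw [h1, hpp i hi j hj hji.symm]
      simp
    simp only [inner_self_eq_norm_sq_to_K] at h
    exact_mod_cast h
  refine ContinuousLinearMap.opNorm_le_bound _ hC fun x => ?_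
  have hq : IsStarProjection (∑ i ∈ s, p i) := by
    refine ⟨?_, ?_⟩
    · rw [IsIdempotentElem, Finset.sum_mul_sum]
      refine Finset.sum_congr rfl fun i hi => ?_
      rw [Finset.sum_eq_single i (fun j hj hji => hpp i hi j hj hji.symm) fun h => absurd hi h]
      exact (hp i hi).isIdempotentElem
    · rw [IsSelfAdjoint, star_sum]
      exact Finset.sum_congr rfl fun i hi => (hp i hi).isSelfAdjoint
  have h1 : ‖∑ i ∈ s, p i x‖ ≤ ‖x‖ := by
    have := (∑ i ∈ s, p i).le_of_opNorm_le (IsStarProjection.norm_le _ hq) x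
    simpa using this
  refine le_of_sq_le_sq ?_ (by positivity)
  rw [sum_apply]
  have e1 : ∀ i ∈ s, (p i * X i) x = p i (X i x) := fun i _ => rfl
  rw [Finset.sum_congr rfl e1, pyth]
  calc ∑ i ∈ s, ‖p i (X i x)‖ ^ 2 ≤ ∑ i ∈ s, C ^ 2 * ‖p i x‖ ^ 2 := by
        refine Finset.sum_le_sum fun i hi => ?_
        have e2 : p i (X i x) = X i (p i x) := DFunLike.congr_fun (hX i hi).eq x
        rw [e2, ← mul_pow]
        exact pow_le_pow_left₀ (norm_nonneg _) ((X i).le_of_opNorm_le (hXC i hi) _) 2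
    _ = C ^ 2 * ‖∑ i ∈ s, p i x‖ ^ 2 := by rw [pyth fun _ => x, Finset.mul_sum]
    _ ≤ (C * ‖x‖) ^ 2 := by
        rw [mul_pow]
        gcongr

theorem VonNeumannAlgebra.cfc_mem (M : VonNeumannAlgebra H) {T : H →L[ℂ] H} (hT : T ∈ M)
    (f : ℝ → ℝ) : cfc f T ∈ M := by
  rw [← VonNeumannAlgebra.commutant_commutant M, VonNeumannAlgebra.mem_commutant_iff]
  intro U hU
  have h : T * U = U * T := (VonNeumannAlgebra.mem_commutant_iff.mp hU) T hT
  exact (Commute.cfc_real h f).eq.symm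

/-- Comparison of projections: if `φ` is a trace on `M` and the projections `Q`, `E` of `M` are at
a positive angle, then `Q` is equivalent to a subprojection of `1 - E`. The partial isometry is
the polar part of `(1 - E) * Q`. -/
theorem trace_le_trace_one_sub (M : VonNeumannAlgebra H) (φ : (H →L[ℂ] H) → ℝ≥0∞)
    (hmono : ∀ S T, S ≤ T → φ S ≤ φ T) (htr : ∀ X ∈ M, φ (star X * X) = φ (X * star X))
    {Q E : H →L[ℂ] H} (hQM : Q ∈ M) (hEM : E ∈ M) (hQ : IsStarProjection Q)
    (hE : IsStarProjection E) (hQE : ‖Q * E‖ < 1) : φ Q ≤ φ (1 - E) := by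
  set r : ℝ := ‖Q * E‖ ^ 2 with hr
  have hr1 : r < 1 := by rw [hr]; exact pow_lt_one₀ (norm_nonneg _) hQE two_ne_zero
  set Y : H →L[ℂ] H := 1 - Q * E * Q with hY
  have hstar : star (Q * E) = E * Q := by
    rw [star_mul, hQ.isSelfAdjoint.star_eq, hE.isSelfAdjoint.star_eq]
  have hQEQ : Q * E * Q = (Q * E) * star (Q * E) := by
    rw [hstar, ← mul_assoc, mul_assoc Q E E, hE.isIdempotentElem.eq]
  have hYsa : IsSelfAdjoint Y := by
    rw [hY, hQEQ]
    exact (IsSelfAdjoint.one _).sub (IsSelfAdjoint.mul_star_self _)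
  have hQE_le : Q * E * Q ≤ algebraMap ℝ (H →L[ℂ] H) r := by
    refine (IsSelfAdjoint.le_algebraMap_norm_self ?_).trans_eq ?_
    · rw [hQEQ]; exact IsSelfAdjoint.mul_star_self _
    · rw [hQEQ, CStarRing.norm_self_mul_star, hr, sq]
  have hYpos : algebraMap ℝ (H →L[ℂ] H) (1 - r) ≤ Y := by
    rw [map_sub, map_one, hY]
    exact sub_le_sub_left hQE_le 1
  have hspec : ∀ x ∈ spectrum ℝ Y, 0 < x := fun x hx =>
    (sub_pos.mpr hr1).trans_le ((algebraMap_le_iff_le_spectrum (r := 1 - r) (a := Y)).mp hYpos x hx)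
  set Z : H →L[ℂ] H := cfc (fun x : ℝ => (√x)⁻¹) Y with hZ
  have hcont : ContinuousOn (fun x : ℝ => (√x)⁻¹) (spectrum ℝ Y) :=
    Real.continuous_sqrt.continuousOn.inv₀ fun x hx => (Real.sqrt_pos.mpr (hspec x hx)).ne'
  have hYM : Y ∈ M := sub_mem (one_mem M) (mul_mem (mul_mem hQM hEM) hQM)
  have hZM : Z ∈ M := VonNeumannAlgebra.cfc_mem M hYM _
  have hZsa : star Z = Z := (cfc_predicate (fun x : ℝ => (√x)⁻¹) Y).star_eq
  have hQY : Commute Y Q := by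
    change (1 - Q * E * Q) * Q = Q * (1 - Q * E * Q)
    rw [sub_mul, mul_sub, one_mul, mul_one, mul_assoc (Q * E), hQ.isIdempotentElem.eq,
      ← mul_assoc Q, ← mul_assoc Q Q, hQ.isIdempotentElem.eq]
  have hZQ : Commute Z Q := Commute.cfc_real hQY _
  have hZYZ : Z * Y * Z = 1 := by
    conv_lhs => rw [hZ]; arg 1; arg 2; rw [← cfc_id' ℝ Y]
    rw [← cfc_mul (fun x : ℝ => (√x)⁻¹) (fun x => x) Y hcont,
      ← cfc_mul (fun x : ℝ => (√x)⁻¹ * x) (fun x => (√x)⁻¹) Y (hcont.mul continuousOn_id) hcont,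
      ← cfc_one ℝ Y]
    refine cfc_congr fun x hx => ?_
    have := Real.sqrt_pos.mpr (hspec x hx)
    have h2 := Real.mul_self_sqrt (hspec x hx).le
    simp only [Pi.one_apply]
    field_simp
    rw [sq, h2]
  set X : H →L[ℂ] H := (1 - E) * Q * Z with hX
  have hE' : IsStarProjection (1 - E) := hE.one_sub
  have hXM : X ∈ M := mul_mem (mul_mem (sub_mem (one_mem M) hEM) hQM) hZM
  have hXs : star X = Z * (Q * (1 - E)) := by
    rw [hX, star_mul, star_mul, hZsa, hQ.isSelfAdjoint.star_eq, hE'.isSelfAdjoint.star_eq]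
  have hXX : star X * X = Q := by
    have h1 : Q * (1 - E) * ((1 - E) * Q) = Y * Q := by
      rw [mul_assoc Q, ← mul_assoc (1 - E), hE'.isIdempotentElem.eq, hY]
      simp only [mul_sub, sub_mul, one_mul, mul_assoc, hQ.isIdempotentElem.eq]
    calc star X * X = Z * (Q * (1 - E) * ((1 - E) * Q)) * Z := by
          rw [hXs, hX]; simp only [mul_assoc]
      _ = Z * Y * (Q * Z) := by rw [h1]; simp only [mul_assoc]
      _ = Q := by rw [← hZQ.eq, ← mul_assoc, hZYZ, one_mul]
  have hX1 : X * star X ≤ 1 := by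
    have h1 : ‖X * star X‖ ≤ 1 := by
      rw [CStarRing.norm_self_mul_star, ← CStarRing.norm_star_mul_self, hXX]
      exact IsStarProjection.norm_le _ hQ
    refine (IsSelfAdjoint.le_algebraMap_norm_self (IsSelfAdjoint.mul_star_self X)).trans ?_
    rw [← map_one (algebraMap ℝ (H →L[ℂ] H))]
    exact algebraMap_mono _ h1
  have hX2 : X * star X ≤ 1 - E := by
    have h1 : (1 - E) * X = X := by
      rw [hX, ← mul_assoc, ← mul_assoc, hE'.isIdempotentElem.eq]
    have h2 := star_left_conjugate_le_conjugate hX1 (1 - E)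
    rw [hE'.isSelfAdjoint.star_eq, mul_one, hE'.isIdempotentElem.eq, ← mul_assoc, h1,
      mul_assoc] at h2
    have h3 : star X * (1 - E) = star X := by
      conv_rhs => rw [← h1, star_mul, hE'.isSelfAdjoint.star_eq]
    rwa [h3] at h2
  calc φ Q = φ (X * star X) := by rw [← hXX, htr X hXM]
    _ ≤ φ (1 - E) := hmono _ _ hX2

end HilbertSum

/-! ### Words in the generators and the grading of the Cuntz algebra -/

section Words

variable {n : ℕ}

@[simp]
theorem wordGen_nil : wordGen ([] : List (Fin n)) = 1 := rfl

@[simp]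
theorem wordGen_cons (i : Fin n) (μ : List (Fin n)) : wordGen (i :: μ) = gen i * wordGen μ := by
  simp [wordGen]

theorem wordGen_append (μ ν : List (Fin n)) : wordGen (μ ++ ν) = wordGen μ * wordGen ν := by
  simp [wordGen]

/-- The isometries have orthogonal ranges: `∑ k, S_i* S_k S_k* S_i = 1` is a sum of positive
elements whose `i`-th summand is already `1`. -/
theorem star_gen_mul_gen (i j : Fin n) :
    star (gen i) * gen j = (if i = j then 1 else 0 : CuntzAlgebra n) := by
  have hiso := (isCuntzFamily_gen (n := n)).isometry
  split_ifs with h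
  · rw [h, hiso]
  have h1 : ∑ k, star (star (gen k) * gen j) * (star (gen k) * gen j) = (1 : CuntzAlgebra n) := by
    have e : ∀ k : Fin n, star (star (gen k) * gen j) * (star (gen k) * gen j) =
        star (gen j) * (gen k * star (gen k)) * gen j := fun k => by
      rw [star_mul, star_star]; simp only [mul_assoc]
    simp_rw [e]
    rw [← Finset.sum_mul, ← Finset.mul_sum, isCuntzFamily_gen.sum_range, mul_one, hiso]
  rw [← Finset.add_sum_erase _ _ (Finset.mem_univ j), hiso, star_one, one_mul,
    add_eq_left, Finset.sum_eq_zero_iff_of_nonneg fun k _ => star_mul_self_nonneg _] at h1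
  exact CStarRing.star_mul_self_eq_zero_iff _ |>.mp
    (h1 i (Finset.mem_erase.mpr ⟨h, Finset.mem_univ i⟩))

theorem star_wordGen_mul_wordGen : ∀ {μ ν : List (Fin n)}, μ.length = ν.length →
    star (wordGen μ) * wordGen ν = (if μ = ν then 1 else 0 : CuntzAlgebra n)
  | [], [], _ => by simp
  | i :: μ, j :: ν, h => by
    have h' : μ.length = ν.length := by simpa using h
    rw [wordGen_cons, wordGen_cons, star_mul, mul_assoc, ← mul_assoc (star (gen i)),
      star_gen_mul_gen]
    by_cases hij : i = j
    · simp [hij, star_wordGen_mul_wordGen h']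
    · simp [hij]

/-- The spectral subspace of degree `k` of `O_{nc}`: the span of the monomials `S_μ (S_ν)*` with
`|μ| - |ν| = k`. -/
noncomputable def homogeneous (n : ℕ) (k : ℤ) : Submodule ℂ (CuntzAlgebra n) :=
  Submodule.span ℂ {a | ∃ μ ν : List (Fin n), (μ.length : ℤ) - ν.length = k ∧
    a = wordGen μ * star (wordGen ν)}

theorem monomial_mem_homogeneous (μ ν : List (Fin n)) :
    wordGen μ * star (wordGen ν) ∈ homogeneous n ((μ.length : ℤ) - ν.length) :=
  Submodule.subset_span ⟨μ, ν, rfl, rfl⟩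

theorem wordGen_mem_homogeneous (μ : List (Fin n)) : wordGen μ ∈ homogeneous n μ.length := by
  simpa using monomial_mem_homogeneous μ []

theorem star_wordGen_mem_homogeneous (μ : List (Fin n)) :
    star (wordGen μ) ∈ homogeneous n (-μ.length) := by
  simpa using monomial_mem_homogeneous [] μ

theorem one_mem_homogeneous : (1 : CuntzAlgebra n) ∈ homogeneous n 0 := by
  simpa using wordGen_mem_homogeneous (n := n) []

theorem gen_mul_mem_homogeneous (i : Fin n) {k : ℤ} {a : CuntzAlgebra n}
    (ha : a ∈ homogeneous n k) : gen i * a ∈ homogeneous n (k + 1) := by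
  induction ha using Submodule.span_induction with
  | mem x hx =>
    obtain ⟨μ, ν, rfl, rfl⟩ := hx
    have := monomial_mem_homogeneous (i :: μ) ν
    rw [wordGen_cons, mul_assoc] at this
    convert this using 2
    simp
    ring
  | zero => simp
  | add x y _ _ hx hy => rw [mul_add]; exact add_mem hx hy
  | smul c x _ hx => rw [mul_smul_comm]; exact Submodule.smul_mem _ _ hx

theorem star_gen_mul_mem_homogeneous (i : Fin n) {k : ℤ} {a : CuntzAlgebra n}
    (ha : a ∈ homogeneous n k) : star (gen i) * a ∈ homogeneous n (k - 1) := by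
  induction ha using Submodule.span_induction with
  | mem x hx =>
    obtain ⟨μ, ν, rfl, rfl⟩ := hx
    cases μ with
    | nil =>
      have := monomial_mem_homogeneous [] (ν ++ [i])
      rw [wordGen_append, wordGen_cons, wordGen_nil, mul_one, star_mul, one_mul] at this
      rw [wordGen_nil, one_mul]
      convert this using 2
      simp
      ring
    | cons j μ =>
      rw [wordGen_cons, mul_assoc, ← mul_assoc, star_gen_mul_gen]
      split_ifs with h
      · have := monomial_mem_homogeneous μ ν
        rw [one_mul]
        convert this using 2
        simp
        ring
      · simp
  | zero => simp
  | add x y _ _ hx hy => rw [mul_add]; exact add_mem hx hy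
  | smul c x _ hx => rw [mul_smul_comm]; exact Submodule.smul_mem _ _ hx

theorem wordGen_mul_mem_homogeneous : ∀ (μ : List (Fin n)) {k : ℤ} {a : CuntzAlgebra n},
    a ∈ homogeneous n k → wordGen μ * a ∈ homogeneous n (k + μ.length)
  | [], k, a, ha => by simpa using ha
  | i :: μ, k, a, ha => by
    have := gen_mul_mem_homogeneous i (wordGen_mul_mem_homogeneous μ ha)
    rw [wordGen_cons, mul_assoc]
    convert this using 2
    push_cast [List.length_cons]
    ring

theorem star_wordGen_mul_mem_homogeneous : ∀ (μ : List (Fin n)) {k : ℤ} {a : CuntzAlgebra n},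
    a ∈ homogeneous n k → star (wordGen μ) * a ∈ homogeneous n (k - μ.length)
  | [], k, a, ha => by simpa using ha
  | i :: μ, k, a, ha => by
    have := star_wordGen_mul_mem_homogeneous μ (star_gen_mul_mem_homogeneous i ha)
    rw [wordGen_cons, star_mul, mul_assoc]
    convert this using 2
    push_cast [List.length_cons]
    ring

theorem mul_mem_homogeneous {k l : ℤ} {a b : CuntzAlgebra n} (ha : a ∈ homogeneous n k)
    (hb : b ∈ homogeneous n l) : a * b ∈ homogeneous n (k + l) := by
  induction ha using Submodule.span_induction with
  | mem x hx =>
    obtain ⟨μ, ν, rfl, rfl⟩ := hx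
    have := wordGen_mul_mem_homogeneous μ (star_wordGen_mul_mem_homogeneous ν hb)
    rw [mul_assoc]
    convert this using 2
    ring
  | zero => simp
  | add x y _ _ hx hy => rw [add_mul]; exact add_mem hx hy
  | smul c x _ hx => rw [smul_mul_assoc]; exact Submodule.smul_mem _ _ hx

theorem star_mem_homogeneous {k : ℤ} {a : CuntzAlgebra n} (ha : a ∈ homogeneous n k) :
    star a ∈ homogeneous n (-k) := by
  induction ha using Submodule.span_induction with
  | mem x hx =>
    obtain ⟨μ, ν, rfl, rfl⟩ := hx
    have := monomial_mem_homogeneous ν μ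
    rw [star_mul, star_star]
    convert this using 2
    ring
  | zero => simp
  | add x y _ _ hx hy => rw [star_add]; exact add_mem hx hy
  | smul c x _ hx => rw [star_smul]; exact Submodule.smul_mem _ _ hx

theorem homogeneous_le_polyAlgebra (k : ℤ) : homogeneous n k ≤ polyAlgebra n :=
  Submodule.span_mono fun _ ⟨μ, ν, _, h⟩ => ⟨μ, ν, h⟩

/-- Induction over `O_{nc}` through homogeneous elements. -/
theorem polyAlgebra_induction {p : CuntzAlgebra n → Prop}
    (hom : ∀ k, ∀ a ∈ homogeneous n k, p a) (add : ∀ a b, p a → p b → p (a + b))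
    {a : CuntzAlgebra n} (ha : a ∈ polyAlgebra n) : p a := by
  have h : polyAlgebra n ≤ ⨆ k, homogeneous n k := by
    refine Submodule.span_le.mpr ?_
    rintro _ ⟨μ, ν, rfl⟩
    exact Submodule.mem_iSup_of_mem _ (monomial_mem_homogeneous μ ν)
  exact Submodule.iSup_induction (homogeneous n) (motive := p) (h ha) hom
    (hom 0 0 (zero_mem _)) add

theorem mul_mem_polyAlgebra {a b : CuntzAlgebra n} (ha : a ∈ polyAlgebra n)
    (hb : b ∈ polyAlgebra n) : a * b ∈ polyAlgebra n := by
  refine polyAlgebra_induction (p := fun a => a * b ∈ polyAlgebra n) (fun k a ha => ?_)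
    (fun a a' h h' => by rw [add_mul]; exact add_mem h h') ha
  refine polyAlgebra_induction (p := fun b => a * b ∈ polyAlgebra n) (fun l b hb => ?_)
    (fun b b' h h' => by rw [mul_add]; exact add_mem h h') hb
  exact homogeneous_le_polyAlgebra _ (mul_mem_homogeneous ha hb)

theorem star_mem_polyAlgebra {a : CuntzAlgebra n} (ha : a ∈ polyAlgebra n) :
    star a ∈ polyAlgebra n :=
  polyAlgebra_induction (fun _ _ ha => homogeneous_le_polyAlgebra _ (star_mem_homogeneous ha))
    (fun _ _ h h' => by rw [star_add]; exact add_mem h h') ha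

theorem dense_polyAlgebra : Dense (polyAlgebra n : Set (CuntzAlgebra n)) := by
  have h1 : ∀ b ∈ StarAlgebra.adjoin ℂ (Set.range (universalGenerator n)),
      ∃ p ∈ polyAlgebra n, p.1 = b := by
    intro b hb
    induction hb using StarAlgebra.adjoin_induction with
    | mem x hx =>
      obtain ⟨i, rfl⟩ := hx
      refine ⟨gen i, homogeneous_le_polyAlgebra 1 ?_, rfl⟩
      simpa using wordGen_mem_homogeneous [i]
    | algebraMap r =>
      exact ⟨algebraMap ℂ _ r, by
        rw [Algebra.algebraMap_eq_smul_one]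
        exact Submodule.smul_mem _ _ (homogeneous_le_polyAlgebra 0 one_mem_homogeneous), rfl⟩
    | add x y _ _ hx hy =>
      obtain ⟨p, hp, rfl⟩ := hx
      obtain ⟨q, hq, rfl⟩ := hy
      exact ⟨p + q, add_mem hp hq, rfl⟩
    | mul x y _ _ hx hy =>
      obtain ⟨p, hp, rfl⟩ := hx
      obtain ⟨q, hq, rfl⟩ := hy
      exact ⟨p * q, mul_mem_polyAlgebra hp hq, rfl⟩
    | star x _ hx =>
      obtain ⟨p, hp, rfl⟩ := hx
      exact ⟨star p, star_mem_polyAlgebra hp, rfl⟩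
  intro a
  refine Metric.mem_closure_iff.mpr fun ε hε => ?_
  obtain ⟨b, hb, hab⟩ := Metric.mem_closure_iff.mp a.2 ε hε
  obtain ⟨p, hp, rfl⟩ := h1 b hb
  exact ⟨p, hp, hab⟩

theorem gauge_eq_of_mem_homogeneous (z : Circle) {k : ℤ} {a : CuntzAlgebra n}
    (ha : a ∈ homogeneous n k) : gauge z a = ((z ^ k : Circle) : ℂ) • a := by
  have hw : ∀ μ : List (Fin n),
      gauge z (wordGen μ) = ((z ^ μ.length : Circle) : ℂ) • wordGen μ := by
    intro μ
    induction μ with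
    | nil => simp
    | cons i μ ih =>
      rw [wordGen_cons, map_mul, ih, gauge_gen, smul_mul_smul_comm, List.length_cons, pow_succ']
      rfl
  induction ha using Submodule.span_induction with
  | mem x hx =>
    obtain ⟨μ, ν, rfl, rfl⟩ := hx
    rw [map_mul, map_star, hw, hw, star_smul, smul_mul_smul_comm, zpow_sub, zpow_natCast,
      zpow_natCast, Circle.coe_mul, Circle.coe_inv_eq_conj]
    rfl
  | zero => simp
  | add x y _ _ hx hy => rw [map_add, hx, hy, smul_add]
  | smul c x _ hx => rw [map_smul, hx, smul_comm]

theorem homogeneous_zero_le_fixedAlgebra {a : CuntzAlgebra n} (ha : a ∈ homogeneous n 0) :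
    a ∈ fixedAlgebra n :=
  mem_fixedAlgebra.mpr fun z => by simpa using gauge_eq_of_mem_homogeneous z ha

theorem gaugeMean_eq_self {a : CuntzAlgebra n} (ha : a ∈ fixedAlgebra n) : gaugeMean a = a := by
  have h := mem_fixedAlgebra.mp ha
  rw [gaugeMean]
  simp_rw [h]
  rw [intervalIntegral.integral_const, sub_zero, smul_smul, one_div,
    inv_mul_cancel₀ (by positivity), one_smul]

/-- The mean of `σ_z(a) = z ^ k a` vanishes for `k ≠ 0`, as `e^{ikθ}` has mean zero over a
period. -/
theorem gaugeMean_eq_zero {k : ℤ} (hk : k ≠ 0) {a : CuntzAlgebra n} (ha : a ∈ homogeneous n k) :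
    gaugeMean a = 0 := by
  rw [gaugeMean]
  have e : ∀ θ : ℝ, gauge (Circle.exp θ) a = Complex.exp ((k * Complex.I) * θ) • a := fun θ => by
    rw [gauge_eq_of_mem_homogeneous _ ha, Circle.coe_zpow, Circle.coe_exp, ← Complex.exp_int_mul]
    ring_nf
  simp_rw [e]
  rw [intervalIntegral.integral_smul_const,
    integral_exp_mul_complex (by simpa using hk)]
  have : Complex.exp (k * Complex.I * ((2 * Real.pi : ℝ) : ℂ)) = 1 := by
    rw [Complex.exp_eq_one_iff]
    exact ⟨k, by push_cast; ring⟩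
  rw [this]
  simp

theorem norm_gaugeMean_le (a : CuntzAlgebra n) : ‖gaugeMean a‖ ≤ ‖a‖ := by
  rw [gaugeMean, norm_smul]
  have h := intervalIntegral.norm_integral_le_of_norm_le_const (a := 0) (b := 2 * Real.pi)
    (f := fun θ : ℝ => gauge (Circle.exp θ) a) (C := ‖a‖)
    fun θ _ => NonUnitalStarAlgHom.norm_apply_le (gauge (Circle.exp θ)) a
  rw [sub_zero, abs_of_pos Real.two_pi_pos] at h
  rw [Real.norm_of_nonneg (by positivity)]
  calc _ ≤ 1 / (2 * Real.pi) * (‖a‖ * (2 * Real.pi)) := by gcongr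
    _ = ‖a‖ := by field_simp

theorem continuous_expectation :
    Continuous fun a : CuntzAlgebra n => (expectation a : CuntzAlgebra n) :=
  AddMonoidHomClass.continuous_of_bound
    ((fixedAlgebra n).toSubalgebra.toSubmodule.subtype ∘ₗ expectation) 1
    fun a => by rw [one_mul]; exact norm_gaugeMean_le a

theorem expectation_of_mem_homogeneous {k : ℤ} {a : CuntzAlgebra n} (ha : a ∈ homogeneous n k) :
    (expectation a : CuntzAlgebra n) = if k = 0 then a else 0 := by
  split_ifs with h
  · subst h
    exact gaugeMean_eq_self (homogeneous_zero_le_fixedAlgebra ha)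
  · exact gaugeMean_eq_zero h ha

theorem expectation_eq_self (f : fixedAlgebra n) : expectation (f : CuntzAlgebra n) = f :=
  Subtype.ext (gaugeMean_eq_self f.2)

theorem fixedAlgebra_subset_closure_homogeneous :
    (fixedAlgebra n : Set (CuntzAlgebra n)) ⊆ closure (homogeneous n 0 : Set (CuntzAlgebra n)) := by
  intro f hf
  have h1 : Set.MapsTo (fun a : CuntzAlgebra n => (expectation a : CuntzAlgebra n))
      (polyAlgebra n) (homogeneous n 0) := fun a ha => by
    refine polyAlgebra_induction (p := fun a => (expectation a : CuntzAlgebra n) ∈ homogeneous n 0)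
      (fun k a ha => ?_) (fun a b h h' => ?_) ha
    · rw [expectation_of_mem_homogeneous ha]
      split_ifs with h
      · exact h ▸ ha
      · exact zero_mem _
    · rw [map_add]
      exact add_mem h h'
  have h2 := h1.closure continuous_expectation (dense_polyAlgebra f)
  simpa [expectation_eq_self ⟨f, hf⟩] using h2

theorem expectation_mul_right (a : CuntzAlgebra n) (f : fixedAlgebra n) :
    expectation (a * (f : CuntzAlgebra n)) = expectation a * f := by
  refine Subtype.ext ?_
  change gaugeMean (a * (f : CuntzAlgebra n)) = gaugeMean a * (f : CuntzAlgebra n)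
  simp only [gaugeMean, map_mul, mem_fixedAlgebra.mp f.2]
  rw [smul_mul_assoc]
  congr 1
  exact ContinuousLinearMap.intervalIntegral_comp_comm
    ((ContinuousLinearMap.mul ℂ (CuntzAlgebra n)).flip (f : CuntzAlgebra n))
    (intervalIntegrable_gauge a _ _)

theorem expectation_mul_left (f : fixedAlgebra n) (a : CuntzAlgebra n) :
    expectation ((f : CuntzAlgebra n) * a) = f * expectation a := by
  refine Subtype.ext ?_
  change gaugeMean ((f : CuntzAlgebra n) * a) = (f : CuntzAlgebra n) * gaugeMean a
  simp only [gaugeMean, map_mul, mem_fixedAlgebra.mp f.2]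
  rw [mul_smul_comm]
  congr 1
  exact (ContinuousLinearMap.mul ℂ (CuntzAlgebra n) (f : CuntzAlgebra n)).intervalIntegral_comp_comm
    (intervalIntegrable_gauge a _ _)

end Words

/-! ### The trace on the fixed-point algebra -/

section Trace

variable {n : ℕ}

theorem star_mul_mul_mem_fixedAlgebra {k : ℤ} {a b f : CuntzAlgebra n} (ha : a ∈ homogeneous n k)
    (hb : b ∈ homogeneous n k) (hf : f ∈ fixedAlgebra n) : star a * f * b ∈ fixedAlgebra n := by
  refine mem_fixedAlgebra.mpr fun z => ?_
  rw [map_mul, map_mul, map_star, gauge_eq_of_mem_homogeneous z ha,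
    gauge_eq_of_mem_homogeneous z hb, mem_fixedAlgebra.mp hf, star_smul, smul_mul_assoc,
    smul_mul_smul_comm, star_mul_circle, one_smul]

theorem mul_star_mem_fixedAlgebra {k : ℤ} {a b : CuntzAlgebra n} (ha : a ∈ homogeneous n k)
    (hb : b ∈ homogeneous n k) : a * star b ∈ fixedAlgebra n :=
  homogeneous_zero_le_fixedAlgebra (by
    simpa using mul_mem_homogeneous ha (star_mem_homogeneous hb))

theorem mul_mul_star_mem_fixedAlgebra {k : ℤ} {a b f : CuntzAlgebra n} (ha : a ∈ homogeneous n k)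
    (hb : b ∈ homogeneous n k) (hf : f ∈ fixedAlgebra n) : a * f * star b ∈ fixedAlgebra n := by
  have := star_mul_mul_mem_fixedAlgebra (star_mem_homogeneous ha) (star_mem_homogeneous hb) hf
  rwa [star_star] at this

/-- The element `S_μ` for a word given as a tuple: the words of a fixed length then form a
finite type. -/
noncomputable def tupleGen {k : ℕ} (μ : Fin k → Fin n) : CuntzAlgebra n := wordGen (List.ofFn μ)

theorem tupleGen_mem_homogeneous {k : ℕ} (μ : Fin k → Fin n) : tupleGen μ ∈ homogeneous n k := by
  simpa [tupleGen] using wordGen_mem_homogeneous (List.ofFn μ)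

theorem star_tupleGen_mul_tupleGen {k : ℕ} (μ ν : Fin k → Fin n) :
    star (tupleGen μ) * tupleGen ν = if μ = ν then 1 else 0 := by
  rw [tupleGen, tupleGen, star_wordGen_mul_wordGen (by simp)]
  simp [List.ofFn_injective.eq_iff]

theorem star_tupleGen_mul_self {k : ℕ} (μ : Fin k → Fin n) :
    star (tupleGen μ) * tupleGen μ = 1 := by simp [star_tupleGen_mul_tupleGen]

theorem sum_tupleGen_succ {M : Type*} [AddCommMonoid M] (F : CuntzAlgebra n → M) (k : ℕ) :
    ∑ μ : Fin (k + 1) → Fin n, F (tupleGen μ) =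
      ∑ i, ∑ μ : Fin k → Fin n, F (gen i * tupleGen μ) := by
  rw [← Fintype.sum_prod_type']
  refine (Fintype.sum_equiv (Fin.consEquiv fun _ => Fin n) _ _ fun p => ?_).symm
  simp [tupleGen, Fin.consEquiv, List.ofFn_succ]

theorem sum_tupleGen_mul_star (k : ℕ) :
    ∑ μ : Fin k → Fin n, tupleGen μ * star (tupleGen μ) = 1 := by
  induction k with
  | zero => simp [tupleGen]
  | succ k ih =>
    rw [sum_tupleGen_succ fun a => a * star a]
    have : ∀ i : Fin n, ∑ μ : Fin k → Fin n, gen i * tupleGen μ * star (gen i * tupleGen μ) =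
        gen i * star (gen i) := fun i => by
      have e : ∀ μ : Fin k → Fin n, gen i * tupleGen μ * star (gen i * tupleGen μ) =
          gen i * (tupleGen μ * star (tupleGen μ)) * star (gen i) := fun μ => by
        rw [star_mul]; simp only [mul_assoc]
      simp_rw [e]
      rw [← Finset.sum_mul, ← Finset.mul_sum, ih, mul_one]
    simp_rw [this]
    exact isCuntzFamily_gen.sum_range

variable (τ : FaithfulNormalizedTrace n)

theorem kms_apply (a : CuntzAlgebra n) : τ.kms a = τ (expectation a) := rfl

theorem kms_coe (f : fixedAlgebra n) : τ.kms (f : CuntzAlgebra n) = τ f := by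
  rw [kms_apply, expectation_eq_self]

theorem kms_one : τ.kms 1 = 1 := (kms_coe τ 1).trans τ.normalized'

theorem continuous_kms : Continuous fun a => τ.kms a := by
  obtain ⟨C, hC⟩ := PositiveLinearMap.exists_norm_apply_le τ.kms
  exact AddMonoidHomClass.continuous_of_bound τ.kms C hC

/-- The fixed-point algebra lies in the centraliser of `ψ`. -/
theorem kms_mul_comm {f : CuntzAlgebra n} (hf : f ∈ fixedAlgebra n) (a : CuntzAlgebra n) :
    τ.kms (f * a) = τ.kms (a * f) := by
  lift f to fixedAlgebra n using hf
  rw [kms_apply, kms_apply, expectation_mul_left, expectation_mul_right]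
  exact τ.tracial' _ _

theorem kms_of_mem_homogeneous {k : ℤ} (hk : k ≠ 0) {a : CuntzAlgebra n}
    (ha : a ∈ homogeneous n k) : τ.kms a = 0 := by
  have : expectation a = 0 := Subtype.ext (by simpa [hk] using expectation_of_mem_homogeneous ha)
  rw [kms_apply, this]
  exact τ.map_zero

theorem FaithfulNormalizedTrace.ne_zero (τ : FaithfulNormalizedTrace n) : n ≠ 0 := by
  rintro rfl
  have h : (1 : CuntzAlgebra 0) = 0 := by
    rw [← (isCuntzFamily_gen (n := 0)).sum_range, Finset.univ_eq_empty, Finset.sum_empty]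
  have := kms_one τ
  rw [h, map_zero] at this
  exact zero_ne_one this

theorem kms_tupleGen_mul_star {k : ℕ} (μ ν : Fin k → Fin n) :
    τ.kms (tupleGen μ * star (tupleGen ν)) = if μ = ν then ((n : ℂ) ^ k)⁻¹ else 0 := by
  have hmem : ∀ μ ν : Fin k → Fin n, tupleGen μ * star (tupleGen ν) ∈ fixedAlgebra n := fun μ ν =>
    mul_star_mem_fixedAlgebra (tupleGen_mem_homogeneous μ) (tupleGen_mem_homogeneous ν)
  split_ifs with h
  · subst h
    have heq : ∀ ν : Fin k → Fin n, τ.kms (tupleGen ν * star (tupleGen ν)) =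
        τ.kms (tupleGen μ * star (tupleGen μ)) := fun ν => by
      have e1 : ∀ μ ν : Fin k → Fin n, tupleGen μ * star (tupleGen μ) =
          (tupleGen μ * star (tupleGen ν)) * (tupleGen ν * star (tupleGen μ)) := fun μ ν => by
        rw [mul_assoc, ← mul_assoc (star (tupleGen ν)), star_tupleGen_mul_self, one_mul]
      rw [e1 μ ν, e1 ν μ, kms_mul_comm τ (hmem _ _)]
    have hsum := congrArg τ.kms (sum_tupleGen_mul_star (n := n) k)
    rw [map_sum, kms_one, Finset.sum_congr rfl fun ν _ => heq ν, Finset.sum_const] at hsum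
    refine eq_inv_of_mul_eq_one_left ?_
    rw [← hsum]
    simp [mul_comm]
  · have e : tupleGen μ * star (tupleGen ν) =
        (tupleGen μ * star (tupleGen ν)) * (tupleGen ν * star (tupleGen ν)) := by
      rw [mul_assoc, ← mul_assoc (star (tupleGen ν)), star_tupleGen_mul_self, one_mul]
    rw [e, kms_mul_comm τ (hmem _ _), mul_assoc, ← mul_assoc (star (tupleGen ν)),
      star_tupleGen_mul_tupleGen, if_neg (Ne.symm h)]
    simp

/-- Induction over the fixed-point algebra: a closed linear condition that holds on the matrix
units `S_μ (S_ν)*`, `|μ| = |ν|`, holds on all of `F`. -/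
theorem fixedAlgebra_induction {p : CuntzAlgebra n → Prop} (hp : IsClosed {a | p a})
    (unit : ∀ (k : ℕ) (μ ν : Fin k → Fin n), p (tupleGen μ * star (tupleGen ν)))
    (zero : p 0) (add : ∀ a b, p a → p b → p (a + b)) (smul : ∀ (c : ℂ) a, p a → p (c • a))
    {f : CuntzAlgebra n} (hf : f ∈ fixedAlgebra n) : p f := by
  refine closure_minimal (fun a ha => ?_) hp (fixedAlgebra_subset_closure_homogeneous hf)
  induction ha using Submodule.span_induction with
  | mem x hx =>
    obtain ⟨μ, ν, h, rfl⟩ := hx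
    have h' : ν.length = μ.length := by omega
    have e : ν = List.ofFn fun i : Fin μ.length => ν.get (i.cast h'.symm) := by
      apply List.ext_get
      · simp [h']
      · intro i h1 h2; simp
    have := unit μ.length μ.get fun i => ν.get (i.cast h'.symm)
    rwa [tupleGen, tupleGen, ← e, List.ofFn_get] at this
  | zero => exact zero
  | add x y _ _ hx hy => exact add x y hx hy
  | smul c x _ hx => exact smul c x hx

/-- The scaling property of the trace under compression by the generators. -/
theorem sum_kms_star_gen_mul_mul {f : CuntzAlgebra n} (hf : f ∈ fixedAlgebra n) :
    ∑ i, τ.kms (star (gen i) * f * gen i) = n * τ.kms f := by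
  refine fixedAlgebra_induction (p := fun f => ∑ i, τ.kms (star (gen i) * f * gen i) = n * τ.kms f)
    ?_ (fun k μ ν => ?_) (by simp) (fun a b ha hb => ?_) (fun c a ha => ?_) hf
  · have := continuous_kms τ
    exact isClosed_eq (by fun_prop) (by fun_prop)
  · cases k with
    | zero => simp [tupleGen, star_gen_mul_gen, kms_one]
    | succ k =>
      have hn : (n : ℂ) ≠ 0 := Nat.cast_ne_zero.mpr τ.ne_zero
      have e : ∀ μ : Fin (k + 1) → Fin n, tupleGen μ = gen (μ 0) * tupleGen (Fin.tail μ) := by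
        intro μ
        rw [tupleGen, List.ofFn_succ, wordGen_cons]
        rfl
      have e2 : ∀ i : Fin n, τ.kms (star (gen i) * (tupleGen μ * star (tupleGen ν)) * gen i) =
          if μ 0 = i then if μ = ν then ((n : ℂ) ^ k)⁻¹ else 0 else 0 := fun i => by
        have e3 : star (gen i) * (tupleGen μ * star (tupleGen ν)) * gen i =
            (star (gen i) * gen (μ 0)) * (tupleGen (Fin.tail μ) * star (tupleGen (Fin.tail ν))) *
              (star (gen (ν 0)) * gen i) := by
          rw [e μ, e ν, star_mul]
          simp only [mul_assoc]
        have e4 : μ = ν ↔ μ 0 = ν 0 ∧ Fin.tail μ = Fin.tail ν := by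
          conv_lhs => rw [← Fin.cons_self_tail μ, ← Fin.cons_self_tail ν]
          exact Fin.cons_inj
        rw [e3, star_gen_mul_gen, star_gen_mul_gen]
        by_cases h1 : μ 0 = i
        · by_cases h2 : ν 0 = i
          · simp [h1, h2, e4, kms_tupleGen_mul_star]
          · have : μ ≠ ν := fun h => h2 (h ▸ h1)
            simp [h2, this]
        · simp [h1, Ne.symm h1]
      simp_rw [e2]
      rw [Finset.sum_ite_eq, if_pos (Finset.mem_univ _), kms_tupleGen_mul_star]
      split_ifs
      · rw [pow_succ]; field_simp
      · simp
  · simp only [mul_add, add_mul, map_add, Finset.sum_add_distrib, ha, hb]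
  · simp only [mul_smul_comm, smul_mul_assoc, map_smul, ← Finset.smul_sum, ha]

theorem sum_kms_star_tupleGen_mul_mul (k : ℕ) {f : CuntzAlgebra n} (hf : f ∈ fixedAlgebra n) :
    ∑ μ : Fin k → Fin n, τ.kms (star (tupleGen μ) * f * tupleGen μ) = n ^ k * τ.kms f := by
  induction k generalizing f with
  | zero => simp [tupleGen]
  | succ k ih =>
    rw [sum_tupleGen_succ fun a => τ.kms (star a * f * a)]
    have e : ∀ i : Fin n, ∑ μ : Fin k → Fin n,
        τ.kms (star (gen i * tupleGen μ) * f * (gen i * tupleGen μ)) =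
          n ^ k * τ.kms (star (gen i) * f * gen i) := fun i => by
      have hi : gen i ∈ homogeneous n 1 := by simpa using wordGen_mem_homogeneous [i]
      rw [← ih (star_mul_mul_mem_fixedAlgebra hi hi hf)]
      refine Finset.sum_congr rfl fun μ _ => ?_
      rw [star_mul]
      simp only [mul_assoc]
    simp_rw [e]
    rw [← Finset.mul_sum, sum_kms_star_gen_mul_mul τ hf, pow_succ, mul_assoc]

/-- The trace is invariant under the shift endomorphism `f ↦ ∑ S_μ f (S_μ)*`, because compressing
with the words `ν` recovers `f` once for each `ν`. -/
theorem sum_kms_tupleGen_mul_mul_star (k : ℕ) {f : CuntzAlgebra n} (hf : f ∈ fixedAlgebra n) :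
    ∑ μ : Fin k → Fin n, τ.kms (tupleGen μ * f * star (tupleGen μ)) = τ.kms f := by
  have hmem : ∑ μ : Fin k → Fin n, tupleGen μ * f * star (tupleGen μ) ∈ fixedAlgebra n :=
    sum_mem fun μ _ => mul_mul_star_mem_fixedAlgebra (tupleGen_mem_homogeneous μ)
      (tupleGen_mem_homogeneous μ) hf
  have h := sum_kms_star_tupleGen_mul_mul τ k hmem
  have e : ∀ ν : Fin k → Fin n, star (tupleGen ν) *
      (∑ μ : Fin k → Fin n, tupleGen μ * f * star (tupleGen μ)) * tupleGen ν = f := fun ν => by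
    rw [Finset.mul_sum, Finset.sum_mul, Finset.sum_eq_single ν]
    · rw [mul_assoc, mul_assoc (tupleGen ν * f), star_tupleGen_mul_self, mul_one, ← mul_assoc,
        star_tupleGen_mul_self, one_mul]
    · intro μ _ hμ
      rw [mul_assoc, mul_assoc (tupleGen μ * f), star_tupleGen_mul_tupleGen, if_neg hμ]
      simp
    · simp
  simp_rw [e, Finset.sum_const] at h
  have hn : (n : ℂ) ^ k ≠ 0 := pow_ne_zero _ (Nat.cast_ne_zero.mpr τ.ne_zero)
  rw [← map_sum]
  refine (mul_left_cancel₀ hn ?_).symm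
  rw [← h]
  simp

end Trace

/-! ### The GNS space and the spectral decomposition of the generator -/

section GNS

variable {n : ℕ} (τ : FaithfulNormalizedTrace n)

theorem inner_vec_vec (a b : CuntzAlgebra n) :
    inner ℂ (vec τ a) (vec τ b) = τ.kms (star a * b) :=
  (UniformSpace.Completion.inner_coe _ _).trans (PositiveLinearMap.preGNS_inner_def _ _ _)

theorem rep_vec (a b : CuntzAlgebra n) : rep τ a (vec τ b) = vec τ (a * b) :=
  PositiveLinearMap.gnsNonUnitalStarAlgHom_apply_coe _

theorem norm_vec_sq (a : CuntzAlgebra n) : ((‖vec τ a‖ ^ 2 : ℝ) : ℂ) = τ.kms (star a * a) := by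
  rw [← inner_vec_vec, inner_self_eq_norm_sq_to_K]
  simp

theorem continuous_vec : Continuous (vec τ) := by
  obtain ⟨C, hC⟩ := PositiveLinearMap.exists_norm_apply_le τ.kms
  refine AddMonoidHomClass.continuous_of_bound (vec τ) (√C) fun a => ?_
  refine le_of_sq_le_sq ?_ (by positivity)
  have h := hC (star a * a)
  rw [← norm_vec_sq, Complex.norm_real, Real.norm_of_nonneg (by positivity),
    CStarRing.norm_star_mul_self] at h
  rwa [mul_pow, Real.sq_sqrt C.coe_nonneg, sq ‖a‖]

theorem denseRange_vec : DenseRange (vec τ) := by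
  have h : DenseRange ((↑) : τ.kms.PreGNS → τ.kms.GNS) := UniformSpace.Completion.denseRange_coe
  exact h.comp τ.kms.toPreGNS.surjective.denseRange (UniformSpace.Completion.continuous_coe _)

/-- Operators that agree on the homogeneous elements of `O_{nc}` are equal. -/
theorem ext_homogeneous {T S : L2 τ →L[ℂ] L2 τ}
    (h : ∀ k, ∀ a ∈ homogeneous n k, T (vec τ a) = S (vec τ a)) : T = S := by
  have h1 : ∀ a ∈ polyAlgebra n, T (vec τ a) = S (vec τ a) := fun a ha =>
    polyAlgebra_induction (p := fun a => T (vec τ a) = S (vec τ a)) h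
      (fun a b ha hb => by simp only [map_add, ha, hb]) ha
  have h2 : (fun a => T (vec τ a)) = fun a => S (vec τ a) :=
    Continuous.ext_on dense_polyAlgebra (T.continuous.comp (continuous_vec τ))
      (S.continuous.comp (continuous_vec τ)) h1
  exact DFunLike.coe_injective
    ((denseRange_vec τ).equalizer T.continuous S.continuous h2)

/-- The closed subspace of `L²(O_n, ψ)` of vectors of degree `k`. -/
noncomputable def degreeSpace (k : ℤ) : Submodule ℂ (L2 τ) :=
  ((homogeneous n k).map (vec τ)).topologicalClosure

instance (k : ℤ) : CompleteSpace (degreeSpace τ k) :=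
  (Submodule.isClosed_topologicalClosure _).completeSpace_coe

theorem vec_mem_degreeSpace {k : ℤ} {a : CuntzAlgebra n} (ha : a ∈ homogeneous n k) :
    vec τ a ∈ degreeSpace τ k :=
  Submodule.le_topologicalClosure _ (Submodule.mem_map_of_mem ha)

theorem isOrtho_degreeSpace {k l : ℤ} (h : k ≠ l) : degreeSpace τ k ⟂ degreeSpace τ l := by
  rw [degreeSpace, degreeSpace, Submodule.isOrtho_iff_le, Submodule.orthogonal_closure]
  refine Submodule.topologicalClosure_minimal _ ?_ (Submodule.isClosed_orthogonal _)
  rintro _ ⟨a, ha, rfl⟩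
  rw [Submodule.mem_orthogonal]
  rintro _ ⟨b, hb, rfl⟩
  rw [inner_vec_vec]
  exact kms_of_mem_homogeneous τ (by omega) (mul_mem_homogeneous (star_mem_homogeneous hb) ha)

theorem isHilbertSum_degreeSpace :
    IsHilbertSum ℂ (fun k => degreeSpace τ k) fun k => (degreeSpace τ k).subtypeₗᵢ := by
  refine IsHilbertSum.mkInternal _ (OrthogonalFamily.of_pairwise fun k l h =>
    isOrtho_degreeSpace τ h) ?_
  intro x _
  have h1 : Set.MapsTo (vec τ) (polyAlgebra n) (⨆ k, degreeSpace τ k : Submodule ℂ (L2 τ)) :=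
    fun a ha => polyAlgebra_induction (p := fun a => vec τ a ∈ ⨆ k, degreeSpace τ k)
      (fun k a ha => Submodule.mem_iSup_of_mem k (vec_mem_degreeSpace τ ha))
      (fun a b ha hb => by rw [map_add]; exact add_mem ha hb) ha
  have h2 : ∀ a, vec τ a ∈ (⨆ k, degreeSpace τ k).topologicalClosure := fun a =>
    h1.closure (continuous_vec τ) (dense_polyAlgebra a)
  exact closure_minimal (Set.range_subset_iff.mpr h2) (Submodule.isClosed_topologicalClosure _)
    (denseRange_vec τ x)

theorem starProjection_degreeSpace_vec {k l : ℤ} {a : CuntzAlgebra n} (ha : a ∈ homogeneous n l) :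
    (degreeSpace τ k).starProjection (vec τ a) = if l = k then vec τ a else 0 := by
  split_ifs with h
  · exact Submodule.starProjection_eq_self_iff.mpr (h ▸ vec_mem_degreeSpace τ ha)
  · exact (Submodule.starProjection_apply_eq_zero_iff _).mpr
      (Submodule.isOrtho_iff_le.mp (isOrtho_degreeSpace τ h) (vec_mem_degreeSpace τ ha))

theorem eq_zero_of_starProjection_degreeSpace_eq_zero {x : L2 τ}
    (h : ∀ k, (degreeSpace τ k).starProjection x = 0) : x = 0 := by
  have := hasSum_starProjection_of_isHilbertSum (isHilbertSum_degreeSpace τ) x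
  simp_rw [h] at this
  exact this.unique hasSum_zero

/-- The graph of the generator of the gauge action before its single-valuedness is known. -/
noncomputable def generatorGraph : Submodule ℂ (L2 τ × L2 τ) :=
  (Submodule.span ℂ {p : L2 τ × L2 τ | ∃ μ ν : List (Fin n),
    p = (vec τ (wordGen μ * star (wordGen ν)),
      ((μ.length : ℂ) - (ν.length : ℂ)) • vec τ (wordGen μ * star (wordGen ν)))}
    ).topologicalClosure

theorem starProjection_snd_of_mem_generatorGraph {p : L2 τ × L2 τ} (hp : p ∈ generatorGraph τ)
    (k : ℤ) : (degreeSpace τ k).starProjection p.2 =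
      (k : ℂ) • (degreeSpace τ k).starProjection p.1 := by
  let L : L2 τ × L2 τ →L[ℂ] L2 τ :=
    (degreeSpace τ k).starProjection ∘L ContinuousLinearMap.snd ℂ _ _ -
      (k : ℂ) • ((degreeSpace τ k).starProjection ∘L ContinuousLinearMap.fst ℂ _ _)
  have h : generatorGraph τ ≤ L.ker := by
    refine Submodule.topologicalClosure_minimal _ (Submodule.span_le.mpr ?_) L.isClosed_ker
    rintro _ ⟨μ, ν, rfl⟩
    change (degreeSpace τ k).starProjection (((μ.length : ℂ) - ν.length) •
      vec τ (wordGen μ * star (wordGen ν))) - (k : ℂ) • (degreeSpace τ k).starProjection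
      (vec τ (wordGen μ * star (wordGen ν))) = 0
    rw [map_smul, starProjection_degreeSpace_vec τ (monomial_mem_homogeneous μ ν)]
    split_ifs with h
    · rw [← h]
      push_cast
      exact sub_self _
    · simp
  exact sub_eq_zero.mp (h hp)

theorem graph_gaugeGenerator : (gaugeGenerator τ).graph = generatorGraph τ := by
  refine Submodule.toLinearPMap_graph_eq _ fun p hp h => ?_
  refine eq_zero_of_starProjection_degreeSpace_eq_zero τ fun k => ?_
  rw [starProjection_snd_of_mem_generatorGraph τ hp, h, map_zero, smul_zero]

theorem mem_eigenspace_gaugeGenerator {x : ℝ} {v : L2 τ} :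
    v ∈ eigenspace (gaugeGenerator τ) x ↔ (v, (x : ℂ) • v) ∈ generatorGraph τ := by
  rw [← graph_gaugeGenerator]
  rfl

theorem starProjection_eq_zero_of_mem_eigenspace {x : ℝ} {v : L2 τ}
    (hv : v ∈ eigenspace (gaugeGenerator τ) x) {k : ℤ} (hk : (k : ℝ) ≠ x) :
    (degreeSpace τ k).starProjection v = 0 := by
  have h := starProjection_snd_of_mem_generatorGraph τ
    ((mem_eigenspace_gaugeGenerator τ).mp hv) k
  simp only [map_smul] at h
  rw [← sub_eq_zero, ← sub_smul, smul_eq_zero] at h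
  refine h.resolve_left fun h0 => hk ?_
  exact_mod_cast (sub_eq_zero.mp h0).symm

theorem eigenspace_gaugeGenerator_int (k : ℤ) :
    eigenspace (gaugeGenerator τ) k = degreeSpace τ k := by
  refine le_antisymm (fun v hv => ?_) fun v hv => ?_
  · have h := hasSum_starProjection_of_isHilbertSum (isHilbertSum_degreeSpace τ) v
    have h2 : HasSum (fun j => (degreeSpace τ j).starProjection v)
        ((degreeSpace τ k).starProjection v) := hasSum_single k fun j hj =>
      starProjection_eq_zero_of_mem_eigenspace τ hv (by exact_mod_cast hj)
    rw [← h2.unique h]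
    exact Submodule.starProjection_apply_mem _ _
  · rw [mem_eigenspace_gaugeGenerator]
    let J : L2 τ →L[ℂ] L2 τ × L2 τ :=
      (ContinuousLinearMap.id ℂ _).prod (((k : ℝ) : ℂ) • ContinuousLinearMap.id ℂ _)
    have h : degreeSpace τ k ≤ (generatorGraph τ).comap J.toLinearMap := by
      refine Submodule.topologicalClosure_minimal _ ?_
        ((Submodule.isClosed_topologicalClosure _).preimage J.continuous)
      rw [Submodule.map_le_iff_le_comap, homogeneous, Submodule.span_le]
      rintro _ ⟨μ, ν, h, rfl⟩
      refine Submodule.le_topologicalClosure _ (Submodule.subset_span ⟨μ, ν, Prod.ext rfl ?_⟩)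
      change ((k : ℝ) : ℂ) • vec τ (wordGen μ * star (wordGen ν)) = _
      rw [← h]
      push_cast
      rfl
    exact h hv

theorem spectralProjection_gaugeGenerator_int (k : ℤ) :
    spectralProjection (gaugeGenerator τ) k = (degreeSpace τ k).starProjection := by
  have : (eigenspace (gaugeGenerator τ) k).topologicalClosure = degreeSpace τ k := by
    rw [eigenspace_gaugeGenerator_int]
    exact (Submodule.isClosed_topologicalClosure _).submodule_topologicalClosure_eq
  rw [spectralProjection]
  congr!

theorem spectralProjection_gaugeGenerator_of_notMem {x : ℝ}
    (hx : x ∉ Set.range ((↑) : ℤ → ℝ)) : spectralProjection (gaugeGenerator τ) x = 0 := by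
  have h : eigenspace (gaugeGenerator τ) x = ⊥ := by
    refine (Submodule.eq_bot_iff _).mpr fun v hv => ?_
    exact eq_zero_of_starProjection_degreeSpace_eq_zero τ fun k =>
      starProjection_eq_zero_of_mem_eigenspace τ hv fun h => hx ⟨k, h⟩
  have h2 : (eigenspace (gaugeGenerator τ) x).topologicalClosure = ⊥ := by
    rw [h]
    exact isClosed_singleton.submodule_topologicalClosure_eq
  ext v
  rw [spectralProjection]
  refine (Submodule.starProjection_apply_eq_zero_iff _).mpr ?_
  rw [h2]
  simp

theorem gaugeProjection_eq (k : ℤ) :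
    gaugeProjection τ k = (degreeSpace τ k).starProjection :=
  spectralProjection_gaugeGenerator_int τ k

theorem gaugeProjection_vec {k l : ℤ} {a : CuntzAlgebra n} (ha : a ∈ homogeneous n l) :
    gaugeProjection τ k (vec τ a) = if l = k then vec τ a else 0 := by
  rw [gaugeProjection_eq, starProjection_degreeSpace_vec τ ha]

theorem isStarProjection_gaugeProjection (k : ℤ) : IsStarProjection (gaugeProjection τ k) := by
  rw [gaugeProjection_eq]
  exact isStarProjection_starProjection

theorem hasSum_gaugeProjection (x : L2 τ) : HasSum (fun k => gaugeProjection τ k x) x := by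
  simp_rw [gaugeProjection_eq]
  exact hasSum_starProjection_of_isHilbertSum (isHilbertSum_degreeSpace τ) x

/-- Operators that agree on the range of every spectral projection of `D` are equal. -/
theorem ext_mul_gaugeProjection {T S : L2 τ →L[ℂ] L2 τ}
    (h : ∀ k, T * gaugeProjection τ k = S * gaugeProjection τ k) : T = S := by
  ext x
  refine ((hasSum_gaugeProjection τ x).mapL T).unique ?_
  convert (hasSum_gaugeProjection τ x).mapL S using 2 with k
  exact DFunLike.congr_fun (h k) x

theorem gaugeProjection_zero_vec (a : CuntzAlgebra n) :
    gaugeProjection τ 0 (vec τ a) = vec τ (expectation a : CuntzAlgebra n) := by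
  have h : ∀ a ∈ polyAlgebra n,
      gaugeProjection τ 0 (vec τ a) = vec τ (expectation a : CuntzAlgebra n) := fun a ha =>
    polyAlgebra_induction
      (p := fun a => gaugeProjection τ 0 (vec τ a) = vec τ (expectation a : CuntzAlgebra n))
      (fun k a ha => by
        rw [gaugeProjection_vec τ ha, expectation_of_mem_homogeneous ha]
        split_ifs <;> simp)
      (fun a b ha hb => by simp only [map_add, ha, hb]; rw [← map_add]; rfl) ha
  exact congrFun (Continuous.ext_on dense_polyAlgebra
    ((gaugeProjection τ 0).continuous.comp (continuous_vec τ))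
    ((continuous_vec τ).comp continuous_expectation) h) a

theorem rep_mul_gaugeProjection {k : ℤ} {a : CuntzAlgebra n} (ha : a ∈ homogeneous n k) (l : ℤ) :
    rep τ a * gaugeProjection τ l = gaugeProjection τ (k + l) * rep τ a := by
  refine ext_homogeneous τ fun j b hb => ?_
  change rep τ a (gaugeProjection τ l (vec τ b)) = gaugeProjection τ (k + l) (rep τ a (vec τ b))
  rw [rep_vec, gaugeProjection_vec τ hb, gaugeProjection_vec τ (mul_mem_homogeneous ha hb)]
  by_cases h : j = l
  · simp [h, rep_vec]
  · simp [h]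

theorem norm_rep_le (a : CuntzAlgebra n) : ‖rep τ a‖ ≤ ‖a‖ :=
  NonUnitalStarAlgHom.norm_apply_le (rep τ) a

theorem continuous_rep : Continuous (rep τ) :=
  AddMonoidHomClass.continuous_of_bound (rep τ) 1 fun a => by simpa using norm_rep_le τ a

theorem commute_rep_gaugeProjection {f : CuntzAlgebra n} (hf : f ∈ fixedAlgebra n) (k : ℤ) :
    Commute (rep τ f) (gaugeProjection τ k) := by
  have hc := continuous_rep τ
  refine closure_minimal (t := {f | rep τ f * gaugeProjection τ k = gaugeProjection τ k * rep τ f})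
    (fun a ha => ?_) (isClosed_eq (by fun_prop) (by fun_prop))
    (fixedAlgebra_subset_closure_homogeneous hf)
  simpa using rep_mul_gaugeProjection τ ha k

end GNS

/-! ### Functions of the generator -/

section Diagonal

variable {n : ℕ} (τ : FaithfulNormalizedTrace n)

/-- The operator `∑ g(k) Φ_k`, for a bounded function `g` on `ℤ`. It is the functional calculus of
`D` with `g` extended to `ℝ` (by means of the floor function: only the values on `ℤ` matter). -/
noncomputable def diag (g : ℤ → ℝ) : L2 τ →L[ℂ] L2 τ :=
  functionalCalculus (gaugeGenerator τ) fun x => g ⌊x⌋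

variable {τ} {g h : ℤ → ℝ}

theorem hasSum_diag (hg : ∃ C, ∀ k, |g k| ≤ C) (x : L2 τ) :
    HasSum (fun k => (g k : ℂ) • gaugeProjection τ k x) (diag τ g x) := by
  obtain ⟨C, hC⟩ := hg
  have := hasSum_functionalCalculus (isHilbertSum_degreeSpace τ)
    (spectralProjection_gaugeGenerator_int τ)
    (fun x hx => spectralProjection_gaugeGenerator_of_notMem τ hx) (fun x => g ⌊x⌋) C
    (fun k => by simpa using hC k) x
  simpa [gaugeProjection_eq, diag] using this

theorem functionalCalculus_eq_diag {G : ℝ → ℝ} (hG : ∃ C, ∀ k : ℤ, |G k| ≤ C) :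
    functionalCalculus (gaugeGenerator τ) G = diag τ fun k => G k := by
  ext x
  refine HasSum.unique ?_ (hasSum_diag hG x)
  obtain ⟨C, hC⟩ := hG
  have := hasSum_functionalCalculus (isHilbertSum_degreeSpace τ)
    (spectralProjection_gaugeGenerator_int τ)
    (fun x hx => spectralProjection_gaugeGenerator_of_notMem τ hx) G C hC x
  simpa [gaugeProjection_eq] using this

theorem norm_diag_le {C : ℝ} (hC : 0 ≤ C) (hg : ∀ k, |g k| ≤ C) : ‖diag τ g‖ ≤ C := by
  obtain ⟨T, hT, hTC⟩ := exists_diagonal (isHilbertSum_degreeSpace τ) g C hg hC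
  have : diag τ g = T := by
    ext x
    refine (hasSum_diag ⟨C, hg⟩ x).unique ?_
    simpa [gaugeProjection_eq] using hT x
  rwa [this]

theorem gaugeProjection_mul_self (k : ℤ) :
    gaugeProjection τ k * gaugeProjection τ k = gaugeProjection τ k :=
  (isStarProjection_gaugeProjection τ k).isIdempotentElem

theorem gaugeProjection_mul_of_ne {k l : ℤ} (hkl : k ≠ l) :
    gaugeProjection τ k * gaugeProjection τ l = 0 := by
  refine ext_homogeneous τ fun j a ha => ?_
  change gaugeProjection τ k (gaugeProjection τ l (vec τ a)) = 0
  rw [gaugeProjection_vec τ ha]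
  split_ifs with h
  · rw [gaugeProjection_vec τ ha, if_neg (by omega)]
  · simp

theorem diag_mul_gaugeProjection (hg : ∃ C, ∀ k, |g k| ≤ C) (k : ℤ) :
    diag τ g * gaugeProjection τ k = (g k : ℂ) • gaugeProjection τ k := by
  ext x
  refine (hasSum_diag hg (gaugeProjection τ k x)).unique ?_
  have h1 : ((g k : ℂ) • gaugeProjection τ k) x =
      (g k : ℂ) • gaugeProjection τ k (gaugeProjection τ k x) := by
    conv_lhs => rw [← gaugeProjection_mul_self]
    rfl
  rw [h1]
  refine hasSum_single k fun j hj => ?_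
  have := DFunLike.congr_fun (gaugeProjection_mul_of_ne (τ := τ) hj) x
  change gaugeProjection τ j (gaugeProjection τ k x) = 0 at this
  rw [this, smul_zero]

theorem eq_diag {T : L2 τ →L[ℂ] L2 τ} (hg : ∃ C, ∀ k, |g k| ≤ C)
    (hT : ∀ k, T * gaugeProjection τ k = (g k : ℂ) • gaugeProjection τ k) : T = diag τ g :=
  ext_mul_gaugeProjection τ fun k => by rw [hT, diag_mul_gaugeProjection hg]

theorem diag_vec (hg : ∃ C, ∀ k, |g k| ≤ C) {k : ℤ} {a : CuntzAlgebra n}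
    (ha : a ∈ homogeneous n k) : diag τ g (vec τ a) = (g k : ℂ) • vec τ a := by
  have := DFunLike.congr_fun (diag_mul_gaugeProjection (τ := τ) hg k) (vec τ a)
  change diag τ g (gaugeProjection τ k (vec τ a)) =
    (g k : ℂ) • gaugeProjection τ k (vec τ a) at this
  rwa [gaugeProjection_vec τ ha, if_pos rfl] at this

theorem commute_diag (hg : ∃ C, ∀ k, |g k| ≤ C) {U : L2 τ →L[ℂ] L2 τ}
    (hU : ∀ k, Commute U (gaugeProjection τ k)) : Commute U (diag τ g) := by
  refine ext_mul_gaugeProjection τ fun k => ?_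
  rw [mul_assoc, diag_mul_gaugeProjection hg, mul_assoc, (hU k).eq, ← mul_assoc,
    diag_mul_gaugeProjection hg, mul_smul_comm, smul_mul_assoc, (hU k).eq]

theorem commute_gaugeProjection_gaugeProjection (k l : ℤ) :
    Commute (gaugeProjection τ k) (gaugeProjection τ l) := by
  by_cases h : k = l
  · rw [h]
  · rw [Commute, SemiconjBy, gaugeProjection_mul_of_ne h, gaugeProjection_mul_of_ne (Ne.symm h)]

theorem commute_gaugeProjection_diag (hg : ∃ C, ∀ k, |g k| ≤ C) (k : ℤ) :
    Commute (gaugeProjection τ k) (diag τ g) :=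
  commute_diag hg (commute_gaugeProjection_gaugeProjection k)

theorem star_diag (hg : ∃ C, ∀ k, |g k| ≤ C) : star (diag τ g) = diag τ g := by
  refine eq_diag hg fun k => ?_
  have hk := (isStarProjection_gaugeProjection τ k).isSelfAdjoint.star_eq
  calc star (diag τ g) * gaugeProjection τ k
      = star (gaugeProjection τ k * diag τ g) := by rw [star_mul, hk]
    _ = (g k : ℂ) • gaugeProjection τ k := by
      rw [(commute_gaugeProjection_diag hg k).eq, diag_mul_gaugeProjection hg, star_smul, hk]
      simp

theorem bounded_mul (hg : ∃ C, ∀ k, |g k| ≤ C) (hh : ∃ C, ∀ k, |h k| ≤ C) :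
    ∃ C, ∀ k, |g k * h k| ≤ C := by
  obtain ⟨C, hC⟩ := hg
  obtain ⟨C', hC'⟩ := hh
  exact ⟨C * C', fun k => by
    rw [abs_mul]
    exact mul_le_mul (hC k) (hC' k) (abs_nonneg _) ((abs_nonneg _).trans (hC k))⟩

theorem diag_mul_diag (hg : ∃ C, ∀ k, |g k| ≤ C) (hh : ∃ C, ∀ k, |h k| ≤ C) :
    diag τ g * diag τ h = diag τ fun k => g k * h k := by
  refine eq_diag (bounded_mul hg hh) fun k => ?_
  rw [mul_assoc, diag_mul_gaugeProjection hh, mul_smul_comm, diag_mul_gaugeProjection hg,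
    smul_smul, mul_comm]
  push_cast
  rfl

theorem smul_diag (c : ℝ) (hg : ∃ C, ∀ k, |g k| ≤ C) :
    (c : ℂ) • diag τ g = diag τ fun k => c * g k := by
  refine eq_diag (bounded_mul ⟨|c|, fun _ => le_rfl⟩ hg) fun k => ?_
  rw [smul_mul_assoc, diag_mul_gaugeProjection hg, smul_smul]
  push_cast
  rfl

theorem one_sub_diag (hg : ∃ C, ∀ k, |g k| ≤ C) : 1 - diag τ g = diag τ fun k => 1 - g k := by
  obtain ⟨C, hC⟩ := hg
  refine eq_diag ⟨1 + C, fun k => ?_⟩ fun k => ?_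
  · calc |1 - g k| ≤ |1| + |g k| := abs_sub _ _
      _ ≤ 1 + C := by rw [abs_one]; gcongr; exact hC k
  · rw [sub_mul, one_mul, diag_mul_gaugeProjection ⟨C, hC⟩]
    push_cast
    rw [sub_smul, one_smul]

theorem isStarProjection_diag {p : ℤ → Prop} [DecidablePred p] :
    IsStarProjection (diag τ fun k => if p k then 1 else 0) := by
  have hb : ∃ C : ℝ, ∀ k, |if p k then (1 : ℝ) else 0| ≤ C :=
    ⟨1, fun k => by split_ifs <;> simp⟩
  refine ⟨?_, star_diag hb⟩
  rw [IsIdempotentElem, diag_mul_diag hb hb]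
  congr 1
  ext k
  split_ifs <;> simp

theorem bounded_sqrt (hg : ∃ C, ∀ k, |g k| ≤ C) : ∃ C, ∀ k, |√(g k)| ≤ C := by
  obtain ⟨C, hC⟩ := hg
  exact ⟨√C, fun k => by
    rw [abs_of_nonneg (Real.sqrt_nonneg _)]
    exact Real.sqrt_le_sqrt ((le_abs_self _).trans (hC k))⟩

theorem diag_eq_star_sqrt_mul_sqrt (hg : ∃ C, ∀ k, |g k| ≤ C) (h0 : ∀ k, 0 ≤ g k) :
    diag τ g = star (diag τ fun k => √(g k)) * diag τ fun k => √(g k) := by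
  rw [star_diag (bounded_sqrt hg), diag_mul_diag (bounded_sqrt hg) (bounded_sqrt hg)]
  simp_rw [Real.mul_self_sqrt (h0 _)]

theorem diag_nonneg (hg : ∃ C, ∀ k, |g k| ≤ C) (h0 : ∀ k, 0 ≤ g k) : 0 ≤ diag τ g := by
  rw [diag_eq_star_sqrt_mul_sqrt hg h0]
  exact star_mul_self_nonneg _

theorem commute_rep_diag {f : CuntzAlgebra n} (hf : f ∈ fixedAlgebra n)
    (hg : ∃ C, ∀ k, |g k| ≤ C) : Commute (rep τ f) (diag τ g) :=
  commute_diag hg (commute_rep_gaugeProjection τ hf)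

theorem rep_mul_diag_mul_rep_mul_diag {f f' : CuntzAlgebra n} (hf' : f' ∈ fixedAlgebra n)
    (hg : ∃ C, ∀ k, |g k| ≤ C) (hh : ∃ C, ∀ k, |h k| ≤ C) :
    rep τ f * diag τ g * (rep τ f' * diag τ h) =
      rep τ (f * f') * diag τ fun k => g k * h k := by
  rw [← diag_mul_diag hg hh, map_mul, mul_assoc, ← mul_assoc (diag τ g),
    ← (commute_rep_diag hf' hg).eq]
  simp only [mul_assoc]

theorem star_rep_mul_diag {f : CuntzAlgebra n} (hf : f ∈ fixedAlgebra n)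
    (hg : ∃ C, ∀ k, |g k| ≤ C) : star (rep τ f * diag τ g) = rep τ (star f) * diag τ g := by
  rw [star_mul, star_diag hg, ← map_star, (commute_rep_diag (star_mem hf) hg).eq]

end Diagonal

/-! ### Functional calculus in the fixed-point algebra -/

section FixedPointCalculus

variable {n : ℕ}

theorem continuous_gauge_apply (z : Circle) : Continuous (gauge z : CuntzAlgebra n → _) :=
  (gaugeL z).continuous

theorem cfc_mem_fixedAlgebra {a : CuntzAlgebra n} (ha : a ∈ fixedAlgebra n) (hsa : IsSelfAdjoint a)
    {F : ℝ → ℝ} (hF : ContinuousOn F (spectrum ℝ a)) : cfc F a ∈ fixedAlgebra n := by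
  refine mem_fixedAlgebra.mpr fun z => ?_
  have h := mem_fixedAlgebra.mp ha z
  have := StarAlgHomClass.map_cfc (gauge z) F a hF (continuous_gauge_apply z) hsa
    (by rw [h]; exact hsa)
  rw [this, h]

theorem posPart_mem_fixedAlgebra {a : CuntzAlgebra n} (ha : a ∈ fixedAlgebra n)
    (hsa : IsSelfAdjoint a) : a⁺ ∈ fixedAlgebra n := by
  rw [CFC.posPart_def, cfcₙ_eq_cfc]
  exact cfc_mem_fixedAlgebra ha hsa (by fun_prop)

theorem negPart_mem_fixedAlgebra {a : CuntzAlgebra n} (ha : a ∈ fixedAlgebra n)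
    (hsa : IsSelfAdjoint a) : a⁻ ∈ fixedAlgebra n := by
  rw [CFC.negPart_def, cfcₙ_eq_cfc]
  exact cfc_mem_fixedAlgebra ha hsa (by fun_prop)

theorem sqrt_mem_fixedAlgebra {a : CuntzAlgebra n} (ha : a ∈ fixedAlgebra n) (h0 : 0 ≤ a) :
    CFC.sqrt a ∈ fixedAlgebra n := by
  rw [CFC.sqrt_eq_real_sqrt a h0, cfcₙ_eq_cfc]
  exact cfc_mem_fixedAlgebra ha h0.isSelfAdjoint (by fun_prop)

theorem abs_mem_fixedAlgebra {a : CuntzAlgebra n} (ha : a ∈ fixedAlgebra n) :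
    CFC.abs a ∈ fixedAlgebra n :=
  sqrt_mem_fixedAlgebra (mul_mem (star_mem ha) ha) (star_mul_self_nonneg a)

end FixedPointCalculus

/-! ### The right action of the fixed-point algebra, and membership in `𝓝` and `𝓜` -/

section Algebras

variable {n : ℕ} (τ : FaithfulNormalizedTrace n)

/-- Right multiplication by an element `f` of the fixed-point algebra is bounded on `L²(O_n, ψ)`:
with `c = Φ(a* a)`, `ψ((a f)* (a f)) = ψ(f* c f) = ψ(c^{1/2} f f* c^{1/2}) ≤ ‖f‖² ψ(c)`. -/
theorem norm_vec_mul_le (a : CuntzAlgebra n) {f : CuntzAlgebra n} (hf : f ∈ fixedAlgebra n) :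
    ‖vec τ (a * f)‖ ≤ ‖f‖ * ‖vec τ a‖ := by
  set c : CuntzAlgebra n := ((expectation (star a * a) : fixedAlgebra n) : CuntzAlgebra n) with hc
  have hcF : c ∈ fixedAlgebra n := (expectation (star a * a)).2
  have hc0 : 0 ≤ c := expectation_nonneg (star_mul_self_nonneg a)
  set d := CFC.sqrt c with hd
  have hdF : d ∈ fixedAlgebra n := sqrt_mem_fixedAlgebra hcF hc0
  have hdsa : star d = d := (CFC.sqrt_nonneg c).isSelfAdjoint.star_eq
  have hdd : d * d = c := CFC.sqrt_mul_sqrt_self c hc0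
  have e1 : τ.kms (star (a * f) * (a * f)) = τ.kms (star d * (f * star f) * d) := by
    calc τ.kms (star (a * f) * (a * f)) = τ.kms (star f * (star a * a) * f) := by
          rw [star_mul]; simp only [mul_assoc]
      _ = τ.kms (star f * c * f) := by
          rw [kms_apply, kms_apply]
          congr 1
          lift f to fixedAlgebra n using hf
          rw [expectation_mul_right, expectation_mul_right]
          congr 1
          change expectation (((star f : fixedAlgebra n) : CuntzAlgebra n) * (star a * a)) =
            expectation (((star f : fixedAlgebra n) : CuntzAlgebra n) * c)
          rw [expectation_mul_left, expectation_mul_left, hc, expectation_eq_self]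
      _ = τ.kms (star f * d * (d * f)) := by rw [← hdd]; simp only [mul_assoc]
      _ = τ.kms (d * f * (star f * d)) := kms_mul_comm τ (mul_mem (star_mem hf) hdF) _
      _ = _ := by rw [hdsa]; simp only [mul_assoc]
  have e2 : τ.kms c = τ.kms (star a * a) := kms_coe τ _
  have e3 : star d * (f * star f) * d ≤ (‖f‖ ^ 2 : ℝ) • (star d * d) := by
    have := CStarAlgebra.star_left_conjugate_le_norm_smul (a := d) (b := f * star f)
    rwa [CStarRing.norm_self_mul_star, ← sq] at this
  have e4 : τ.kms (star d * (f * star f) * d) ≤ ((‖f‖ ^ 2 : ℝ) : ℂ) * τ.kms (star a * a) := by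
    have := OrderHomClass.mono τ.kms e3
    have hdd' : star d * d = c := by rw [hdsa, hdd]
    rwa [hdd', ← Complex.coe_smul, map_smul, e2, smul_eq_mul] at this
  rw [← e1, ← norm_vec_sq, ← norm_vec_sq] at e4
  refine le_of_sq_le_sq ?_ (by positivity)
  rw [mul_pow]
  exact_mod_cast e4

theorem exists_right_mul {f : CuntzAlgebra n} (hf : f ∈ fixedAlgebra n) :
    ∃ R : L2 τ →L[ℂ] L2 τ, ∀ a, R (vec τ a) = vec τ (a * f) := by
  let R₀ : τ.kms.PreGNS →L[ℂ] τ.kms.PreGNS :=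
    (τ.kms.toPreGNS.toLinearMap ∘ₗ (LinearMap.mulRight ℂ f) ∘ₗ
      τ.kms.ofPreGNS.toLinearMap).mkContinuous ‖f‖ fun x => by
        have := norm_vec_mul_le τ (τ.kms.ofPreGNS x) hf
        have hn : ∀ a, ‖vec τ a‖ = ‖τ.kms.toPreGNS a‖ := fun a =>
          UniformSpace.Completion.norm_coe _
        rw [hn, hn] at this
        exact this
  exact ⟨R₀.completion, fun a => ContinuousLinearMap.completion_apply_coe _ _⟩

/-- Right multiplication by an element of the fixed-point algebra. -/
noncomputable def rightMul (f : fixedAlgebra n) : L2 τ →L[ℂ] L2 τ :=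
  (exists_right_mul τ f.2).choose

theorem rightMul_vec (f : fixedAlgebra n) (a : CuntzAlgebra n) :
    rightMul τ f (vec τ a) = vec τ (a * f) :=
  (exists_right_mul τ f.2).choose_spec a

theorem ext_vec {T S : L2 τ →L[ℂ] L2 τ} (h : ∀ a, T (vec τ a) = S (vec τ a)) : T = S :=
  ext_homogeneous τ fun _ a _ => h a

theorem star_rightMul (f : fixedAlgebra n) : star (rightMul τ f) = rightMul τ (star f) := by
  rw [ContinuousLinearMap.star_eq_adjoint]
  refine ((ContinuousLinearMap.eq_adjoint_iff _ _).mpr fun x y => ?_).symm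
  refine (denseRange_vec τ).induction_on₂ (p := fun x y =>
    inner ℂ (rightMul τ (star f) x) y = inner ℂ x (rightMul τ f y))
    (isClosed_eq (by fun_prop) (by fun_prop)) (fun a b => ?_) x y
  rw [rightMul_vec, rightMul_vec, inner_vec_vec, inner_vec_vec, star_mul, ← mul_assoc]
  change τ.kms (star (star (f : CuntzAlgebra n)) * star a * b) = _
  rw [star_star, mul_assoc, kms_mul_comm τ f.2]

theorem mem_commutantOf {H : Type*} [NormedAddCommGroup H] [InnerProductSpace ℂ H]
    [CompleteSpace H] {E : Set (H →L[ℂ] H)} {T : H →L[ℂ] H} :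
    T ∈ commutantOf E ↔ ∀ S ∈ E, S * T = T * S ∧ star S * T = T * star S :=
  StarSubalgebra.mem_centralizer_iff ℂ

theorem rightMul_mem_commutantOf (f : fixedAlgebra n) :
    rightMul τ f ∈ commutantOf (rankOneEndomorphisms τ) := by
  have h : ∀ f : fixedAlgebra n, ∀ S ∈ rankOneEndomorphisms τ,
      S * rightMul τ f = rightMul τ f * S := by
    rintro f S ⟨x, -, y, -, hS⟩
    refine ext_vec τ fun a => ?_
    change S (rightMul τ f (vec τ a)) = rightMul τ f (S (vec τ a))
    rw [rightMul_vec, hS, hS, rightMul_vec, ← mul_assoc, expectation_mul_right]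
    exact congrArg (vec τ) (mul_assoc _ _ _).symm
  refine mem_commutantOf.mpr fun S hS => ⟨h f S hS, ?_⟩
  have := congrArg star (h (star f) S hS)
  rw [star_mul, star_mul, star_rightMul, star_star] at this
  exact this.symm

theorem commute_rightMul_of_mem_algM {X : L2 τ →L[ℂ] L2 τ} (hX : X ∈ algM τ) (f : fixedAlgebra n) :
    Commute X (rightMul τ f) :=
  ((VonNeumannAlgebra.mem_commutant_iff.mp ((mem_algM τ).mp hX).1) _
    (rightMul_mem_commutantOf τ f)).symm

theorem commute_gaugeProjection_of_mem_algM {X : L2 τ →L[ℂ] L2 τ} (hX : X ∈ algM τ) (k : ℤ) :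
    Commute X (gaugeProjection τ k) :=
  (((mem_algM τ).mp hX).2 k).symm

theorem rep_mul_gaugeProjection_zero_mul_rep_mem {x y : CuntzAlgebra n} (hx : x ∈ polyAlgebra n)
    (hy : y ∈ polyAlgebra n) :
    rep τ x * gaugeProjection τ 0 * rep τ (star y) ∈ rankOneEndomorphisms τ := by
  refine ⟨x, hx, y, hy, fun z => ?_⟩
  change rep τ x (gaugeProjection τ 0 (rep τ (star y) (vec τ z))) = _
  rw [rep_vec, gaugeProjection_zero_vec, rep_vec]

/-- The projection onto degree `k ≥ 0` is `∑ Θ_{S_μ, S_μ}` over the words of length `k`. -/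
theorem gaugeProjection_natCast (k : ℕ) :
    gaugeProjection τ k = ∑ μ : Fin k → Fin n,
      rep τ (tupleGen μ) * gaugeProjection τ 0 * rep τ (star (tupleGen μ)) := by
  have h : ∀ μ : Fin k → Fin n,
      rep τ (tupleGen μ) * gaugeProjection τ 0 * rep τ (star (tupleGen μ)) =
        gaugeProjection τ k * rep τ (tupleGen μ * star (tupleGen μ)) := fun μ => by
    rw [rep_mul_gaugeProjection τ (tupleGen_mem_homogeneous μ), add_zero, mul_assoc, map_mul]
  rw [Finset.sum_congr rfl fun μ _ => h μ, ← Finset.mul_sum, ← map_sum, sum_tupleGen_mul_star,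
    map_one, mul_one]

/-- The projection onto degree `-k` is `Θ_{(S_μ)*, (S_μ)*}` for any word `μ` of length `k`. -/
theorem gaugeProjection_neg_natCast {k : ℕ} (μ : Fin k → Fin n) :
    gaugeProjection τ (-k) =
      rep τ (star (tupleGen μ)) * gaugeProjection τ 0 * rep τ (tupleGen μ) := by
  rw [rep_mul_gaugeProjection τ (star_mem_homogeneous (tupleGen_mem_homogeneous μ)), add_zero,
    mul_assoc, ← map_mul, star_tupleGen_mul_self, map_one, mul_one]

theorem exists_gaugeProjection_eq_sum (k : ℤ) :
    ∃ s : Finset (CuntzAlgebra n), (∀ x ∈ s, x ∈ homogeneous n k) ∧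
      gaugeProjection τ k = ∑ x ∈ s, rep τ x * gaugeProjection τ 0 * rep τ (star x) := by
  classical
  obtain ⟨k, rfl | rfl⟩ := k.eq_nat_or_neg
  · refine ⟨Finset.univ.image fun μ : Fin k → Fin n => tupleGen μ, fun x hx => ?_, ?_⟩
    · obtain ⟨μ, -, rfl⟩ := Finset.mem_image.mp hx
      exact tupleGen_mem_homogeneous μ
    · rw [Finset.sum_image, ← gaugeProjection_natCast]
      intro μ _ ν _ h
      by_contra hne
      have h1 := star_tupleGen_mul_tupleGen μ ν
      rw [if_neg hne, ← (show tupleGen μ = tupleGen ν from h), star_tupleGen_mul_self] at h1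
      have := kms_one τ
      rw [h1, map_zero] at this
      exact zero_ne_one this
  · have : NeZero n := ⟨τ.ne_zero⟩
    let μ : Fin k → Fin n := fun _ => 0
    refine ⟨{star (tupleGen μ)}, fun x hx => ?_, ?_⟩
    · rw [Finset.mem_singleton.mp hx]
      exact star_mem_homogeneous (tupleGen_mem_homogeneous μ)
    · rw [Finset.sum_singleton, star_star, gaugeProjection_neg_natCast τ μ]

variable {τ} in
theorem commute_of_mem_commutantOf {U : L2 τ →L[ℂ] L2 τ}
    (hU : U ∈ commutantOf (rankOneEndomorphisms τ)) {x y : CuntzAlgebra n}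
    (hx : x ∈ polyAlgebra n) (hy : y ∈ polyAlgebra n) :
    Commute U (rep τ x * gaugeProjection τ 0 * rep τ (star y)) :=
  (mem_commutantOf.mp hU _ (rep_mul_gaugeProjection_zero_mul_rep_mem τ hx hy)).1.symm

theorem commute_gaugeProjection_of_mem_commutantOf {U : L2 τ →L[ℂ] L2 τ}
    (hU : U ∈ commutantOf (rankOneEndomorphisms τ)) (k : ℤ) : Commute U (gaugeProjection τ k) := by
  obtain ⟨s, hs, h⟩ := exists_gaugeProjection_eq_sum τ k
  rw [h]
  exact Commute.sum_right _ _ _ fun x hx => commute_of_mem_commutantOf hU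
    (homogeneous_le_polyAlgebra _ (hs x hx)) (homogeneous_le_polyAlgebra _ (hs x hx))

theorem commute_rep_of_mem_commutantOf {U : L2 τ →L[ℂ] L2 τ}
    (hU : U ∈ commutantOf (rankOneEndomorphisms τ)) {f : CuntzAlgebra n}
    (hf : f ∈ fixedAlgebra n) : Commute U (rep τ f) := by
  have hc := continuous_rep τ
  refine closure_minimal (t := {f | U * rep τ f = rep τ f * U}) (fun a ha => ?_)
    (isClosed_eq (by fun_prop) (by fun_prop)) (fixedAlgebra_subset_closure_homogeneous hf)
  refine ext_mul_gaugeProjection τ fun k => ?_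
  have h1 : Commute U (rep τ a * gaugeProjection τ k) := by
    obtain ⟨s, hs, h⟩ := exists_gaugeProjection_eq_sum τ k
    rw [h, Finset.mul_sum]
    refine Commute.sum_right _ _ _ fun x hx => ?_
    have := commute_of_mem_commutantOf hU (mul_mem_polyAlgebra
      (homogeneous_le_polyAlgebra _ ha) (homogeneous_le_polyAlgebra _ (hs x hx)))
      (homogeneous_le_polyAlgebra _ (hs x hx))
    rw [map_mul] at this
    simpa only [mul_assoc] using this
  rw [mul_assoc, h1.eq, mul_assoc, mul_assoc,
    (commute_gaugeProjection_of_mem_commutantOf τ hU k).eq]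

theorem rep_mem_algM {f : CuntzAlgebra n} (hf : f ∈ fixedAlgebra n) : rep τ f ∈ algM τ := by
  refine (mem_algM τ).mpr ⟨VonNeumannAlgebra.mem_commutant_iff.mpr fun U hU => ?_,
    fun k => (commute_rep_gaugeProjection τ hf k).eq.symm⟩
  exact (commute_rep_of_mem_commutantOf τ hU hf).eq

variable {τ} in
theorem diag_mem_algM {g : ℤ → ℝ} (hg : ∃ C, ∀ k, |g k| ≤ C) : diag τ g ∈ algM τ := by
  refine (mem_algM τ).mpr ⟨VonNeumannAlgebra.mem_commutant_iff.mpr fun U hU => ?_,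
    fun k => (commute_gaugeProjection_diag hg k).eq⟩
  exact (commute_diag hg (commute_gaugeProjection_of_mem_commutantOf τ hU)).eq

variable {τ} in
theorem rep_mul_diag_mem_algM {f : CuntzAlgebra n} (hf : f ∈ fixedAlgebra n) {g : ℤ → ℝ}
    (hg : ∃ C, ∀ k, |g k| ≤ C) : rep τ f * diag τ g ∈ algM τ :=
  mul_mem (rep_mem_algM τ hf) (diag_mem_algM hg)

end Algebras

/-! ### The weight -/

section Weight

variable {n : ℕ} (τ : FaithfulNormalizedTrace n)

theorem iSup_tsum_ite_le {β : Type*} (ℓ : β → ℕ) (F : β → ℝ≥0∞) :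
    ⨆ N : ℕ, ∑' b, (if ℓ b ≤ N then F b else 0) = ∑' b, F b := by
  refine le_antisymm (iSup_le fun N => ENNReal.tsum_le_tsum fun b => ?_) ?_
  · split_ifs <;> simp
  · rw [ENNReal.tsum_eq_iSup_sum]
    refine iSup_le fun s => ?_
    refine le_trans ?_ (le_iSup _ (s.sup ℓ))
    refine le_trans (Finset.sum_le_sum fun b hb => ?_) (ENNReal.sum_le_tsum s)
    rw [if_pos (Finset.le_sup hb)]

theorem sqrtDeltaTrunc_vec (N : ℕ) {k : ℤ} {a : CuntzAlgebra n} (ha : a ∈ homogeneous n k) :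
    sqrtDeltaTrunc τ N (vec τ a) =
      if k.natAbs ≤ N then (((n : ℝ) ^ (-(k : ℝ) / 2) : ℝ) : ℂ) • vec τ a else 0 := by
  rw [sqrtDeltaTrunc, sum_apply]
  have e : ∀ j : ℤ, ((((n : ℝ) ^ (-(j : ℝ) / 2) : ℝ) : ℂ) • gaugeProjection τ j) (vec τ a) =
      if k = j then (((n : ℝ) ^ (-(j : ℝ) / 2) : ℝ) : ℂ) • vec τ a else 0 := fun j => by
    change (((n : ℝ) ^ (-(j : ℝ) / 2) : ℝ) : ℂ) • gaugeProjection τ j (vec τ a) = _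
    rw [gaugeProjection_vec τ ha]
    split_ifs <;> simp
  simp_rw [e]
  rw [Finset.sum_ite_eq]
  congr 1
  rw [Finset.mem_Icc]
  exact propext (by omega)

theorem star_sqrtDeltaTrunc (N : ℕ) : star (sqrtDeltaTrunc τ N) = sqrtDeltaTrunc τ N := by
  rw [sqrtDeltaTrunc, star_sum]
  refine Finset.sum_congr rfl fun k _ => ?_
  rw [star_smul, (isStarProjection_gaugeProjection τ k).isSelfAdjoint.star_eq]
  simp

theorem vectorWeight_sqrtDeltaTrunc (N : ℕ) {k : ℤ} {a : CuntzAlgebra n}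
    (ha : a ∈ homogeneous n k) (T : L2 τ →L[ℂ] L2 τ) :
    vectorWeight τ a (sqrtDeltaTrunc τ N * T * sqrtDeltaTrunc τ N) =
      if k.natAbs ≤ N then ENNReal.ofReal ((n : ℝ) ^ (-(k : ℝ))) * vectorWeight τ a T else 0 := by
  have e : inner ℂ (vec τ a) ((sqrtDeltaTrunc τ N * T * sqrtDeltaTrunc τ N) (vec τ a)) =
      inner ℂ (sqrtDeltaTrunc τ N (vec τ a)) (T (sqrtDeltaTrunc τ N (vec τ a))) := by
    conv_rhs => rw [← star_sqrtDeltaTrunc, ContinuousLinearMap.star_eq_adjoint,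
      ContinuousLinearMap.adjoint_inner_left, ← ContinuousLinearMap.star_eq_adjoint,
      star_sqrtDeltaTrunc]
    rfl
  have hn : (0 : ℝ) < n := Nat.cast_pos.mpr (Nat.pos_of_ne_zero τ.ne_zero)
  rw [vectorWeight, e, sqrtDeltaTrunc_vec τ N ha]
  split_ifs with h
  · rw [map_smul, inner_smul_left, inner_smul_right, ← mul_assoc, Complex.conj_ofReal,
      ← Complex.ofReal_mul, Complex.re_ofReal_mul, ENNReal.ofReal_mul (by positivity),
      ← Real.rpow_add hn, vectorWeight]
    ring_nf
  · simp

theorem vectorWeight_wordGen_sqrtDeltaTrunc (N : ℕ) (μ : List (Fin n)) (T : L2 τ →L[ℂ] L2 τ) :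
    vectorWeight τ (wordGen μ) (sqrtDeltaTrunc τ N * T * sqrtDeltaTrunc τ N) =
      if μ.length ≤ N then ((n : ℝ≥0∞)⁻¹) ^ μ.length * vectorWeight τ (wordGen μ) T else 0 := by
  have hn : (0 : ℝ) < n := Nat.cast_pos.mpr (Nat.pos_of_ne_zero τ.ne_zero)
  have e : ENNReal.ofReal ((n : ℝ) ^ (-((μ.length : ℤ) : ℝ))) = ((n : ℝ≥0∞)⁻¹) ^ μ.length := by
    rw [Int.cast_natCast, Real.rpow_neg hn.le, Real.rpow_natCast, ENNReal.ofReal_inv_of_pos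
      (pow_pos hn _), ENNReal.ofReal_pow hn.le, ENNReal.ofReal_natCast, ENNReal.inv_pow]
  rw [vectorWeight_sqrtDeltaTrunc τ N (wordGen_mem_homogeneous μ), e]
  simp

theorem vectorWeight_star_wordGen_sqrtDeltaTrunc (N : ℕ) (μ : List (Fin n))
    (T : L2 τ →L[ℂ] L2 τ) :
    ((n : ℝ≥0∞)⁻¹) ^ μ.length *
        vectorWeight τ (star (wordGen μ)) (sqrtDeltaTrunc τ N * T * sqrtDeltaTrunc τ N) =
      if μ.length ≤ N then vectorWeight τ (star (wordGen μ)) T else 0 := by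
  have hn : (0 : ℝ) < n := Nat.cast_pos.mpr (Nat.pos_of_ne_zero τ.ne_zero)
  have hn' : (n : ℝ≥0∞) ≠ 0 := Nat.cast_ne_zero.mpr τ.ne_zero
  have e : ENNReal.ofReal ((n : ℝ) ^ (-((-(μ.length : ℤ) : ℤ) : ℝ))) = (n : ℝ≥0∞) ^ μ.length := by
    rw [Int.cast_neg, neg_neg, Int.cast_natCast, Real.rpow_natCast, ENNReal.ofReal_pow hn.le,
      ENNReal.ofReal_natCast]
  rw [vectorWeight_sqrtDeltaTrunc τ N (star_wordGen_mem_homogeneous μ), e]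
  simp only [Int.natAbs_neg, Int.natAbs_natCast]
  split_ifs
  · rw [← mul_assoc, ← mul_pow, ENNReal.inv_mul_cancel hn' (ENNReal.natCast_ne_top n), one_pow,
      one_mul]
  · simp

theorem tsum_nonempty_list (F : List (Fin n) → ℝ≥0∞) :
    ∑' μ : {μ : List (Fin n) // μ ≠ []}, F μ.1 =
      ∑' k : ℕ, ∑ ν : Fin (k + 1) → Fin n, F (List.ofFn ν) := by
  let e : (Σ k : ℕ, Fin (k + 1) → Fin n) → {μ : List (Fin n) // μ ≠ []} :=
    fun p => ⟨List.ofFn p.2, by simp [List.ofFn_succ]⟩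
  have he : Function.Bijective e := by
    constructor
    · rintro ⟨k, ν⟩ ⟨l, ν'⟩ h
      have h1 : List.ofFn ν = List.ofFn ν' := congrArg Subtype.val h
      have h2 : k = l := by simpa using congrArg List.length h1
      subst h2
      rw [List.ofFn_injective h1]
    · rintro ⟨μ, hμ⟩
      cases μ with
      | nil => exact absurd rfl hμ
      | cons i μ => exact ⟨⟨μ.length, (i :: μ).get⟩, Subtype.ext (List.ofFn_get (i :: μ))⟩
  rw [← (Equiv.ofBijective e he).tsum_eq fun μ : {μ : List (Fin n) // μ ≠ []} => F μ.1,
    ENNReal.tsum_sigma']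
  refine tsum_congr fun k => ?_
  rw [tsum_fintype]
  rfl

/-- The weight `τ_Δ` as a sum of vector functionals. -/
theorem tauDelta_eq (T : L2 τ →L[ℂ] L2 τ) :
    tauDelta τ T = vectorWeight τ 1 T + ∑' k : ℕ, ∑ ν : Fin (k + 1) → Fin n,
      (((n : ℝ≥0∞)⁻¹) ^ (k + 1) * vectorWeight τ (tupleGen ν) T +
        vectorWeight τ (star (tupleGen ν)) T) := by
  have h1 : ∀ N : ℕ, tauTilde τ (sqrtDeltaTrunc τ N * T * sqrtDeltaTrunc τ N) =
      vectorWeight τ 1 T + ∑' μ : {μ : List (Fin n) // μ ≠ []},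
        if μ.1.length ≤ N then (((n : ℝ≥0∞)⁻¹) ^ μ.1.length * vectorWeight τ (wordGen μ.1) T +
          vectorWeight τ (star (wordGen μ.1)) T) else 0 := fun N => by
    rw [tauTilde]
    congr 1
    · simpa using vectorWeight_wordGen_sqrtDeltaTrunc τ N [] T
    · refine tsum_congr fun μ => ?_
      rw [vectorWeight_wordGen_sqrtDeltaTrunc, vectorWeight_star_wordGen_sqrtDeltaTrunc]
      split_ifs <;> simp
  simp_rw [tauDelta, h1]
  rw [← ENNReal.add_iSup, iSup_tsum_ite_le, tsum_nonempty_list fun μ =>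
    ((n : ℝ≥0∞)⁻¹) ^ μ.length * vectorWeight τ (wordGen μ) T + vectorWeight τ (star (wordGen μ)) T]
  simp only [List.length_ofFn, tupleGen]

theorem vectorWeight_mono (a : CuntzAlgebra n) {S T : L2 τ →L[ℂ] L2 τ} (h : S ≤ T) :
    vectorWeight τ a S ≤ vectorWeight τ a T := by
  refine ENNReal.ofReal_le_ofReal ?_
  have := (ContinuousLinearMap.le_def S T).mp h
  have h2 := this.re_inner_nonneg_right (vec τ a)
  rw [sub_apply, inner_sub_right] at h2
  simpa using h2

theorem tauDelta_mono {S T : L2 τ →L[ℂ] L2 τ} (h : S ≤ T) : tauDelta τ S ≤ tauDelta τ T := by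
  rw [tauDelta_eq, tauDelta_eq]
  gcongr <;> exact vectorWeight_mono τ _ h

theorem vectorWeight_add (a : CuntzAlgebra n) {S T : L2 τ →L[ℂ] L2 τ} (hS : 0 ≤ S) (hT : 0 ≤ T) :
    vectorWeight τ a (S + T) = vectorWeight τ a S + vectorWeight τ a T := by
  have hS' : 0 ≤ (inner ℂ (vec τ a) (S (vec τ a))).re :=
    ((ContinuousLinearMap.nonneg_iff_isPositive S).mp hS).re_inner_nonneg_right (vec τ a)
  have hT' : 0 ≤ (inner ℂ (vec τ a) (T (vec τ a))).re :=
    ((ContinuousLinearMap.nonneg_iff_isPositive T).mp hT).re_inner_nonneg_right (vec τ a)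
  rw [vectorWeight, vectorWeight, vectorWeight, ← ENNReal.ofReal_add hS' hT',
    add_apply, inner_add_right, Complex.add_re]

theorem tauDelta_add {S T : L2 τ →L[ℂ] L2 τ} (hS : 0 ≤ S) (hT : 0 ≤ T) :
    tauDelta τ (S + T) = tauDelta τ S + tauDelta τ T := by
  simp only [tauDelta_eq, vectorWeight_add τ _ hS hT, mul_add, Finset.sum_add_distrib,
    ENNReal.tsum_add]
  ring

theorem tauDelta_zero : tauDelta τ 0 = 0 := by
  simp [tauDelta_eq, vectorWeight]

theorem tauDelta_sum {ι : Type*} (s : Finset ι) (T : ι → L2 τ →L[ℂ] L2 τ)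
    (hT : ∀ i ∈ s, 0 ≤ T i) : tauDelta τ (∑ i ∈ s, T i) = ∑ i ∈ s, tauDelta τ (T i) := by
  classical
  induction s using Finset.induction_on with
  | empty => simp [tauDelta_zero]
  | insert i s hi ih =>
    have hs : ∀ j ∈ s, 0 ≤ T j := fun j hj => hT j (Finset.mem_insert_of_mem hj)
    rw [Finset.sum_insert hi, Finset.sum_insert hi,
      tauDelta_add τ (hT i (Finset.mem_insert_self i s)) (Finset.sum_nonneg hs), ih hs]

/-- The value of the counting weight on `ℤ` on a nonnegative function. -/
noncomputable def intSum (g : ℤ → ℝ) : ℝ≥0∞ :=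
  ENNReal.ofReal (g 0) + ∑' k : ℕ, (ENNReal.ofReal (g (k + 1)) + ENNReal.ofReal (g (-(k + 1))))

theorem kms_nonneg {a : CuntzAlgebra n} (ha : 0 ≤ a) : 0 ≤ τ.kms a := map_nonneg τ.kms ha

theorem kms_eq_ofReal {a : CuntzAlgebra n} (ha : 0 ≤ a) : τ.kms a = ((τ.kms a).re : ℂ) :=
  Complex.eq_re_of_ofReal_le (r := 0) (by rw [Complex.ofReal_zero]; exact kms_nonneg τ ha)

theorem re_kms_nonneg {a : CuntzAlgebra n} (ha : 0 ≤ a) : 0 ≤ (τ.kms a).re :=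
  (Complex.le_def.mp (kms_nonneg τ ha)).1

variable {τ} in
theorem vectorWeight_rep_mul_diag {g : ℤ → ℝ} (hg : ∃ C, ∀ k, |g k| ≤ C) (h0 : ∀ k, 0 ≤ g k)
    (f : CuntzAlgebra n) {k : ℤ} {a : CuntzAlgebra n} (ha : a ∈ homogeneous n k) :
    vectorWeight τ a (rep τ f * diag τ g) =
      ENNReal.ofReal (g k) * ENNReal.ofReal (τ.kms (star a * f * a)).re := by
  rw [vectorWeight, ← ENNReal.ofReal_mul (h0 k)]
  change ENNReal.ofReal (inner ℂ (vec τ a) (rep τ f (diag τ g (vec τ a)))).re = _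
  rw [diag_vec hg ha, map_smul, rep_vec, inner_smul_right, inner_vec_vec, Complex.re_ofReal_mul,
    mul_assoc]

variable {τ} in
/-- The value of `τ_Δ` on `π(f) g(D)`: every degree contributes `τ(f)`, by the scaling property of
the trace. -/
theorem tauDelta_rep_mul_diag {f : CuntzAlgebra n} (hf : f ∈ fixedAlgebra n) (hf0 : 0 ≤ f)
    {g : ℤ → ℝ} (hg : ∃ C, ∀ k, |g k| ≤ C) (h0 : ∀ k, 0 ≤ g k) :
    tauDelta τ (rep τ f * diag τ g) = ENNReal.ofReal (τ.kms f).re * intSum g := by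
  have hn : (0 : ℝ) < n := Nat.cast_pos.mpr (Nat.pos_of_ne_zero τ.ne_zero)
  have hn' : (n : ℝ≥0∞) ≠ 0 := Nat.cast_ne_zero.mpr τ.ne_zero
  have e1 : ∀ k : ℕ, ∑ ν : Fin k → Fin n,
      ENNReal.ofReal (τ.kms (star (tupleGen ν) * f * tupleGen ν)).re =
        (n : ℝ≥0∞) ^ k * ENNReal.ofReal (τ.kms f).re := fun k => by
    rw [← ENNReal.ofReal_sum_of_nonneg fun ν _ =>
      re_kms_nonneg τ (star_left_conjugate_nonneg hf0 _), ← Complex.re_sum,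
      sum_kms_star_tupleGen_mul_mul τ k hf, ← Complex.ofReal_natCast, ← Complex.ofReal_pow,
      Complex.re_ofReal_mul, ENNReal.ofReal_mul (by positivity), ENNReal.ofReal_pow hn.le,
      ENNReal.ofReal_natCast]
  have e2 : ∀ k : ℕ, ∑ ν : Fin k → Fin n,
      ENNReal.ofReal (τ.kms (tupleGen ν * f * star (tupleGen ν))).re =
        ENNReal.ofReal (τ.kms f).re := fun k => by
    rw [← ENNReal.ofReal_sum_of_nonneg fun ν _ =>
      re_kms_nonneg τ (star_right_conjugate_nonneg hf0 _), ← Complex.re_sum,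
      sum_kms_tupleGen_mul_mul_star τ k hf]
  rw [tauDelta_eq, intSum, mul_add, ← ENNReal.tsum_mul_left]
  congr 1
  · rw [vectorWeight_rep_mul_diag hg h0 f one_mem_homogeneous, mul_comm]
    simp
  · refine tsum_congr fun k => ?_
    rw [Finset.sum_add_distrib, mul_add]
    congr 1
    · rw [← Finset.mul_sum, Finset.sum_congr rfl fun ν _ =>
        vectorWeight_rep_mul_diag hg h0 f (tupleGen_mem_homogeneous ν), ← Finset.mul_sum, e1]
      have : ((n : ℝ≥0∞)⁻¹) ^ (k + 1) * (n : ℝ≥0∞) ^ (k + 1) = 1 := by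
        rw [← mul_pow, ENNReal.inv_mul_cancel hn' (ENNReal.natCast_ne_top n), one_pow]
      calc _ = (((n : ℝ≥0∞)⁻¹) ^ (k + 1) * (n : ℝ≥0∞) ^ (k + 1)) *
            (ENNReal.ofReal (τ.kms f).re * ENNReal.ofReal (g ((k + 1 : ℕ) : ℤ))) := by ring
        _ = _ := by rw [this, one_mul]; push_cast; rfl
    · rw [Finset.sum_congr rfl fun ν _ => vectorWeight_rep_mul_diag hg h0 f
        (star_mem_homogeneous (tupleGen_mem_homogeneous ν)), ← Finset.mul_sum]
      simp_rw [star_star]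
      rw [e2, mul_comm]
      push_cast
      rfl

end Weight

/-! ### The trace property of the weight on `𝓜` -/

section TraceProperty

variable {n : ℕ} (τ : FaithfulNormalizedTrace n)

theorem vectorWeight_star_mul_self (a : CuntzAlgebra n) (X : L2 τ →L[ℂ] L2 τ) :
    vectorWeight τ a (star X * X) = ENNReal.ofReal (‖X (vec τ a)‖ ^ 2) := by
  have : inner ℂ (vec τ a) ((star X * X) (vec τ a)) = inner ℂ (X (vec τ a)) (X (vec τ a)) := by
    change inner ℂ (vec τ a) (star X (X (vec τ a))) = _
    rw [ContinuousLinearMap.star_eq_adjoint, ContinuousLinearMap.adjoint_inner_right]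
  rw [vectorWeight, this, inner_self_eq_norm_sq_to_K]
  norm_cast

theorem gaugeProjection_mem_closure (x : L2 τ) :
    gaugeProjection τ 0 x ∈ closure (vec τ '' (fixedAlgebra n)) := by
  have h : ∀ v ∈ degreeSpace τ 0, v ∈ closure (vec τ '' (fixedAlgebra n)) := fun v hv => by
    rw [degreeSpace, ← SetLike.mem_coe, Submodule.topologicalClosure_coe] at hv
    refine closure_mono ?_ hv
    rintro _ ⟨a, ha, rfl⟩
    exact ⟨a, homogeneous_zero_le_fixedAlgebra ha, rfl⟩
  rw [gaugeProjection_eq]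
  exact h _ (Submodule.starProjection_apply_mem _ _)

theorem norm_star_apply_le_of_commute {X : L2 τ →L[ℂ] L2 τ}
    (hX : ∀ f : fixedAlgebra n, Commute X (rightMul τ f))
    (h0' : X * gaugeProjection τ 0 = X) :
    ‖star X (vec τ 1)‖ ≤ ‖X (vec τ 1)‖ := by
  set η := star X (vec τ 1) with hη
  have hF : ∀ v ∈ vec τ '' (fixedAlgebra n), ‖inner ℂ η v‖ ≤ ‖X (vec τ 1)‖ * ‖v‖ := by
    rintro _ ⟨f, hf, rfl⟩
    lift f to fixedAlgebra n using hf
    have h1 : vec τ (f : CuntzAlgebra n) = rightMul τ f (vec τ 1) := by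
      rw [rightMul_vec, one_mul]
    have h2 : inner ℂ η (vec τ (f : CuntzAlgebra n)) =
        inner ℂ (vec τ (star (f : CuntzAlgebra n))) (X (vec τ 1)) := by
      have e1 : inner ℂ η (vec τ (f : CuntzAlgebra n)) =
          inner ℂ (vec τ 1) (X (vec τ (f : CuntzAlgebra n))) := by
        rw [hη, ContinuousLinearMap.star_eq_adjoint, ContinuousLinearMap.adjoint_inner_left]
      have e2 : X (rightMul τ f (vec τ 1)) = rightMul τ f (X (vec τ 1)) :=
        DFunLike.congr_fun (hX f).eq (vec τ 1)
      have e3 : vec τ (star (f : CuntzAlgebra n)) = rightMul τ (star f) (vec τ 1) := by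
        rw [rightMul_vec, one_mul]
        rfl
      rw [e1, h1, e2, e3, ← star_rightMul, ContinuousLinearMap.star_eq_adjoint,
        ContinuousLinearMap.adjoint_inner_left]
    have h3 : ‖vec τ (star (f : CuntzAlgebra n))‖ = ‖vec τ (f : CuntzAlgebra n)‖ := by
      have : ‖vec τ (star (f : CuntzAlgebra n))‖ ^ 2 = ‖vec τ (f : CuntzAlgebra n)‖ ^ 2 := by
        have e : ((‖vec τ (star (f : CuntzAlgebra n))‖ ^ 2 : ℝ) : ℂ) =
            ((‖vec τ (f : CuntzAlgebra n)‖ ^ 2 : ℝ) : ℂ) := by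
          rw [norm_vec_sq, norm_vec_sq, star_star, kms_mul_comm τ f.2]
        exact_mod_cast e
      exact (sq_eq_sq₀ (norm_nonneg _) (norm_nonneg _)).mp this
    rw [h2, mul_comm, ← h3]
    exact norm_inner_le_norm _ _
  have hη0 : gaugeProjection τ 0 η = η := by
    have := congrArg star h0'
    rw [star_mul, (isStarProjection_gaugeProjection τ 0).isSelfAdjoint.star_eq] at this
    exact DFunLike.congr_fun this (vec τ 1)
  have hcl : ‖inner ℂ η η‖ ≤ ‖X (vec τ 1)‖ * ‖η‖ :=
    closure_minimal (t := {v | ‖inner ℂ η v‖ ≤ ‖X (vec τ 1)‖ * ‖v‖}) hF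
      (isClosed_le (by fun_prop) (by fun_prop)) (hη0 ▸ gaugeProjection_mem_closure τ η)
  rw [inner_self_eq_norm_sq_to_K, norm_pow, RCLike.norm_ofReal, abs_norm, sq] at hcl
  by_cases hz : ‖η‖ = 0
  · rw [hz]; exact norm_nonneg _
  · exact le_of_mul_le_mul_right hcl (lt_of_le_of_ne (norm_nonneg _) (Ne.symm hz))

/-- The trace property in degree zero: if `X` commutes with the right action of `F` and is
supported in degree zero, then `‖X 1‖ = ‖X* 1‖`. Indeed `⟨X* 1, f⟩ = ⟨f*, X 1⟩` for `f ∈ F`, and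
`f ↦ f*` preserves the norm of `L²(F, τ)`. -/
theorem norm_star_apply_one_of_commute {X : L2 τ →L[ℂ] L2 τ}
    (hX : ∀ f : fixedAlgebra n, Commute X (rightMul τ f)) (h0 : gaugeProjection τ 0 * X = X)
    (h0' : X * gaugeProjection τ 0 = X) :
    ‖star X (vec τ 1)‖ = ‖X (vec τ 1)‖ := by
  have hP := (isStarProjection_gaugeProjection τ 0).isSelfAdjoint.star_eq
  refine le_antisymm (norm_star_apply_le_of_commute τ hX h0') ?_
  have h := norm_star_apply_le_of_commute τ (X := star X) (fun f => ?_) ?_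
  · rwa [star_star] at h
  · have := congrArg star (hX (star f)).eq
    rw [star_mul, star_mul, star_rightMul, star_star] at this
    exact this.symm
  · conv_rhs => rw [← h0, star_mul, hP]

theorem commute_rep_rightMul (a : CuntzAlgebra n) (f : fixedAlgebra n) :
    Commute (rep τ a) (rightMul τ f) := by
  refine ext_vec τ fun b => ?_
  change rep τ a (rightMul τ f (vec τ b)) = rightMul τ f (rep τ a (vec τ b))
  rw [rightMul_vec, rep_vec, rep_vec, rightMul_vec, mul_assoc]

theorem commute_gaugeProjection_rightMul (k : ℤ) (f : fixedAlgebra n) :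
    Commute (gaugeProjection τ k) (rightMul τ f) :=
  (commute_gaugeProjection_of_mem_commutantOf τ (rightMul_mem_commutantOf τ f) k).symm

theorem gaugeProjection_apply_vec_of_commute {X : L2 τ →L[ℂ] L2 τ}
    (hX : ∀ k, Commute X (gaugeProjection τ k)) {k : ℤ} {a : CuntzAlgebra n}
    (ha : a ∈ homogeneous n k) : gaugeProjection τ k (X (vec τ a)) = X (vec τ a) := by
  have h := DFunLike.congr_fun (hX k).eq (vec τ a)
  change X (gaugeProjection τ k (vec τ a)) = gaugeProjection τ k (X (vec τ a)) at h
  rw [← h, gaugeProjection_vec τ ha, if_pos rfl]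

variable {τ} in
/-- The trace property for the matrix coefficients `Φ_0 π(b)* X π(a) Φ_0`. -/
theorem norm_gaugeProjection_rep_star_apply {X : L2 τ →L[ℂ] L2 τ} (hX : X ∈ algM τ)
    (a b : CuntzAlgebra n) :
    ‖gaugeProjection τ 0 (rep τ (star a) (star X (vec τ b)))‖ =
      ‖gaugeProjection τ 0 (rep τ (star b) (X (vec τ a)))‖ := by
  have hP := (isStarProjection_gaugeProjection τ 0).isSelfAdjoint.star_eq
  have hPP := gaugeProjection_mul_self (τ := τ) 0
  have h1 : gaugeProjection τ 0 (vec τ 1) = vec τ 1 := by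
    rw [gaugeProjection_vec τ one_mem_homogeneous, if_pos rfl]
  set Y := gaugeProjection τ 0 * rep τ (star b) * X * rep τ a * gaugeProjection τ 0 with hY
  have hYs : star Y =
      gaugeProjection τ 0 * rep τ (star a) * star X * rep τ b * gaugeProjection τ 0 := by
    rw [hY]
    simp only [star_mul, hP, ← map_star, star_star, mul_assoc]
  have h := norm_star_apply_one_of_commute τ (X := Y)
    (fun f => ((((commute_gaugeProjection_rightMul τ 0 f).mul_left
      (commute_rep_rightMul τ _ f)).mul_left (commute_rightMul_of_mem_algM τ hX f)).mul_left
      (commute_rep_rightMul τ _ f)).mul_left (commute_gaugeProjection_rightMul τ 0 f))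
    (by rw [hY]; simp only [← mul_assoc, hPP]) (by rw [hY, mul_assoc, hPP])
  rw [hYs, hY] at h
  change ‖gaugeProjection τ 0 (rep τ (star a) (star X (rep τ b (gaugeProjection τ 0 (vec τ 1)))))‖ =
    ‖gaugeProjection τ 0 (rep τ (star b) (X (rep τ a (gaugeProjection τ 0 (vec τ 1)))))‖ at h
  rwa [h1, rep_vec, rep_vec, mul_one, mul_one] at h

theorem gaugeProjection_rep_apply {k l : ℤ} {a : CuntzAlgebra n} (ha : a ∈ homogeneous n k)
    {v : L2 τ} (hv : gaugeProjection τ l v = v) :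
    gaugeProjection τ (k + l) (rep τ a v) = rep τ a v := by
  have := DFunLike.congr_fun (rep_mul_gaugeProjection τ ha l) v
  change rep τ a (gaugeProjection τ l v) = gaugeProjection τ (k + l) (rep τ a v) at this
  rw [← this, hv]

theorem inner_rep_star (a : CuntzAlgebra n) (v w : L2 τ) :
    inner ℂ (rep τ (star a) v) w = inner ℂ v (rep τ a w) := by
  rw [map_star, ContinuousLinearMap.star_eq_adjoint, ContinuousLinearMap.adjoint_inner_left]

/-- Every vector is the orthogonal sum of its components in the ranges of `S_ν`, `|ν| = k`. -/
theorem norm_sq_eq_sum_norm_rep_star_tupleGen (k : ℕ) (v : L2 τ) :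
    ‖v‖ ^ 2 = ∑ ν : Fin k → Fin n, ‖rep τ (star (tupleGen ν)) v‖ ^ 2 := by
  have h : ∑ ν : Fin k → Fin n, inner ℂ (rep τ (star (tupleGen ν)) v)
      (rep τ (star (tupleGen ν)) v) = inner ℂ v v := by
    simp_rw [inner_rep_star]
    rw [← inner_sum]
    congr 1
    have := congrArg (fun a => rep τ a v) (sum_tupleGen_mul_star (n := n) k)
    simp only [map_sum, map_mul, map_one] at this
    rw [sum_apply] at this
    exact this
  simp_rw [inner_self_eq_norm_sq_to_K] at h
  exact_mod_cast h.symm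

theorem norm_rep_tupleGen_apply {k : ℕ} (ν : Fin k → Fin n) (v : L2 τ) :
    ‖rep τ (tupleGen ν) v‖ = ‖v‖ := by
  have h : inner ℂ (rep τ (tupleGen ν) v) (rep τ (tupleGen ν) v) = inner ℂ v v := by
    have := inner_rep_star τ (star (tupleGen ν)) v (rep τ (tupleGen ν) v)
    rw [star_star] at this
    rw [this]
    congr 1
    have e : rep τ (star (tupleGen ν) * tupleGen ν) v = v := by
      rw [star_tupleGen_mul_self, map_one]
      rfl
    rwa [map_mul] at e
  simp_rw [inner_self_eq_norm_sq_to_K] at h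
  exact (sq_eq_sq₀ (norm_nonneg _) (norm_nonneg _)).mp (by exact_mod_cast h)

variable {τ} in
theorem sum_norm_apply_vec_tupleGen {X : L2 τ →L[ℂ] L2 τ} (hX : X ∈ algM τ) (k : ℕ) :
    ∑ μ : Fin k → Fin n, ‖X (vec τ (tupleGen μ))‖ ^ 2 =
      ∑ μ : Fin k → Fin n, ‖star X (vec τ (tupleGen μ))‖ ^ 2 := by
  have hdeg : ∀ Y ∈ algM τ, ∀ μ ν : Fin k → Fin n,
      rep τ (star (tupleGen ν)) (Y (vec τ (tupleGen μ))) =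
        gaugeProjection τ 0 (rep τ (star (tupleGen ν)) (Y (vec τ (tupleGen μ)))) := by
    intro Y hY μ ν
    have := gaugeProjection_rep_apply τ (star_mem_homogeneous (tupleGen_mem_homogeneous ν))
      (gaugeProjection_apply_vec_of_commute τ (commute_gaugeProjection_of_mem_algM τ hY)
        (tupleGen_mem_homogeneous μ))
    rw [neg_add_cancel] at this
    exact this.symm
  rw [Finset.sum_congr rfl fun μ _ =>
      norm_sq_eq_sum_norm_rep_star_tupleGen τ k (X (vec τ (tupleGen μ))),
    Finset.sum_congr rfl fun μ _ =>
      norm_sq_eq_sum_norm_rep_star_tupleGen τ k (star X (vec τ (tupleGen μ))), Finset.sum_comm]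
  refine Finset.sum_congr rfl fun μ _ => Finset.sum_congr rfl fun ν _ => ?_
  rw [hdeg X hX, hdeg (star X) (star_mem hX), norm_gaugeProjection_rep_star_apply hX]

variable {τ} in
theorem norm_apply_vec_star_tupleGen {X : L2 τ →L[ℂ] L2 τ} (hX : X ∈ algM τ) {k : ℕ}
    (μ : Fin k → Fin n) :
    ‖X (vec τ (star (tupleGen μ)))‖ = ‖star X (vec τ (star (tupleGen μ)))‖ := by
  have hmem := star_mem_homogeneous (tupleGen_mem_homogeneous μ)
  have hdeg : ∀ Y ∈ algM τ, ‖Y (vec τ (star (tupleGen μ)))‖ =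
      ‖gaugeProjection τ 0 (rep τ (star (star (tupleGen μ))) (Y (vec τ (star (tupleGen μ)))))‖ := by
    intro Y hY
    have := gaugeProjection_rep_apply τ (tupleGen_mem_homogeneous μ)
      (gaugeProjection_apply_vec_of_commute τ (commute_gaugeProjection_of_mem_algM τ hY) hmem)
    rw [add_neg_cancel] at this
    rw [star_star, this, norm_rep_tupleGen_apply]
  rw [hdeg X hX, hdeg (star X) (star_mem hX), norm_gaugeProjection_rep_star_apply hX]

/-- The weight `τ_Δ` is a trace on `𝓜`. -/
theorem tauDelta_star_mul_self {X : L2 τ →L[ℂ] L2 τ} (hX : X ∈ algM τ) :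
    tauDelta τ (star X * X) = tauDelta τ (X * star X) := by
  have e : ∀ a, vectorWeight τ a (X * star X) = ENNReal.ofReal (‖star X (vec τ a)‖ ^ 2) :=
    fun a => by
      have := vectorWeight_star_mul_self τ a (star X)
      rwa [star_star] at this
  simp_rw [tauDelta_eq, vectorWeight_star_mul_self, e]
  have h1 : ‖X (vec τ 1)‖ = ‖star X (vec τ 1)‖ := by
    simpa [tupleGen] using norm_apply_vec_star_tupleGen hX (Fin.elim0 : Fin 0 → Fin n)
  rw [h1]
  congr 1
  refine tsum_congr fun k => ?_
  simp_rw [norm_apply_vec_star_tupleGen hX]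
  rw [Finset.sum_add_distrib, Finset.sum_add_distrib, ← Finset.mul_sum, ← Finset.mul_sum]
  congr 2
  rw [← ENNReal.ofReal_sum_of_nonneg fun _ _ => sq_nonneg _,
    ← ENNReal.ofReal_sum_of_nonneg fun _ _ => sq_nonneg _, sum_norm_apply_vec_tupleGen hX]

end TraceProperty

/-! ### Positive parts and linear extensions -/

/-- `linearExtension` may be computed from any splitting of the real and imaginary parts into
differences of positive operators with product zero. -/
theorem linearExtension_eq {H : Type*} [NormedAddCommGroup H] [InnerProductSpace ℂ H]
    [CompleteSpace H] (v : (H →L[ℂ] H) → ℝ) {T b c b' c' : H →L[ℂ] H}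
    (hre : (realPart T : H →L[ℂ] H) = b - c) (hbc : b * c = 0) (hb : 0 ≤ b) (hc : 0 ≤ c)
    (him : (imaginaryPart T : H →L[ℂ] H) = b' - c') (hbc' : b' * c' = 0) (hb' : 0 ≤ b')
    (hc' : 0 ≤ c') :
    linearExtension v T = ((v b - v c : ℝ) : ℂ) + Complex.I * ((v b' - v c' : ℝ) : ℂ) := by
  obtain ⟨e1, e2⟩ := CFC.posPart_negPart_unique hre hbc hb hc
  obtain ⟨e3, e4⟩ := CFC.posPart_negPart_unique him hbc' hb' hc'
  rw [linearExtension, e1, e2, e3, e4]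

section LinearExtension

variable {n : ℕ} {τ : FaithfulNormalizedTrace n} {g : ℤ → ℝ}

theorem rep_mul_diag_nonneg {f : CuntzAlgebra n} (hf : f ∈ fixedAlgebra n) (hf0 : 0 ≤ f)
    (hg : ∃ C, ∀ k, |g k| ≤ C) (h0 : ∀ k, 0 ≤ g k) : 0 ≤ rep τ f * diag τ g := by
  have hF := sqrt_mem_fixedAlgebra hf hf0
  have e : star (rep τ (CFC.sqrt f) * diag τ fun k => √(g k)) *
      (rep τ (CFC.sqrt f) * diag τ fun k => √(g k)) = rep τ f * diag τ g := by
    rw [star_rep_mul_diag hF (bounded_sqrt hg), rep_mul_diag_mul_rep_mul_diag hF (bounded_sqrt hg)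
      (bounded_sqrt hg), (CFC.sqrt_nonneg f).isSelfAdjoint.star_eq, CFC.sqrt_mul_sqrt_self f hf0]
    simp_rw [Real.mul_self_sqrt (h0 _)]
  rw [← e]
  exact star_mul_self_nonneg _

theorem abs_rep_mul_diag {f : CuntzAlgebra n} (hf : f ∈ fixedAlgebra n)
    (hg : ∃ C, ∀ k, |g k| ≤ C) (h0 : ∀ k, 0 ≤ g k) :
    CFC.abs (rep τ f * diag τ g) = rep τ (CFC.abs f) * diag τ g := by
  have hF := abs_mem_fixedAlgebra hf
  refine CFC.sqrt_unique ?_ (rep_mul_diag_nonneg hF (CFC.abs_nonneg f) hg h0)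
  rw [star_rep_mul_diag hf hg, rep_mul_diag_mul_rep_mul_diag hf hg hg,
    rep_mul_diag_mul_rep_mul_diag hF hg hg, CFC.abs_mul_abs]

theorem realPart_rep_mul_diag {f : CuntzAlgebra n} (hf : f ∈ fixedAlgebra n)
    (hg : ∃ C, ∀ k, |g k| ≤ C) :
    (realPart (rep τ f * diag τ g) : L2 τ →L[ℂ] L2 τ) =
      rep τ (realPart f : CuntzAlgebra n) * diag τ g := by
  rw [realPart_apply_coe, realPart_apply_coe, star_rep_mul_diag hf hg, ← add_mul, ← map_add,
    ← Complex.coe_smul, ← Complex.coe_smul, map_smul, smul_mul_assoc]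

theorem imaginaryPart_rep_mul_diag {f : CuntzAlgebra n} (hf : f ∈ fixedAlgebra n)
    (hg : ∃ C, ∀ k, |g k| ≤ C) :
    (imaginaryPart (rep τ f * diag τ g) : L2 τ →L[ℂ] L2 τ) =
      rep τ (imaginaryPart f : CuntzAlgebra n) * diag τ g := by
  rw [imaginaryPart_apply_coe, imaginaryPart_apply_coe, star_rep_mul_diag hf hg, ← sub_mul,
    ← map_sub, ← Complex.coe_smul, ← Complex.coe_smul, map_smul, map_smul, smul_mul_assoc,
    smul_mul_assoc]

/-- A functional on positive operators that is proportional to the trace on the operators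
`π(a) g(D)`, `0 ≤ a ∈ F`, has a linear extension with the same property. -/
theorem linearExtension_rep_mul_diag {v : (L2 τ →L[ℂ] L2 τ) → ℝ} {c : ℝ}
    (hg : ∃ C, ∀ k, |g k| ≤ C) (h0 : ∀ k, 0 ≤ g k)
    (hv : ∀ a ∈ fixedAlgebra n, 0 ≤ a → v (rep τ a * diag τ g) = c * (τ.kms a).re)
    {f : CuntzAlgebra n} (hf : f ∈ fixedAlgebra n) :
    linearExtension v (rep τ f * diag τ g) = c * τ.kms f := by
  have key : ∀ a ∈ fixedAlgebra n, IsSelfAdjoint a →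
      ((v (rep τ a⁺ * diag τ g) - v (rep τ a⁻ * diag τ g) : ℝ) : ℂ) = c * τ.kms a := by
    intro a ha hsa
    have hpos := CFC.posPart_nonneg a
    have hneg := CFC.negPart_nonneg a
    rw [hv _ (posPart_mem_fixedAlgebra ha hsa) hpos, hv _ (negPart_mem_fixedAlgebra ha hsa) hneg]
    have e3 : τ.kms a = τ.kms a⁺ - τ.kms a⁻ := by
      rw [← map_sub, CFC.posPart_sub_negPart a hsa]
    rw [e3, kms_eq_ofReal τ hpos, kms_eq_ofReal τ hneg]
    push_cast
    simp only [Complex.ofReal_re]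
    ring
  have split : ∀ a ∈ fixedAlgebra n, IsSelfAdjoint a →
      rep τ a * diag τ g = rep τ a⁺ * diag τ g - rep τ a⁻ * diag τ g ∧
        rep τ a⁺ * diag τ g * (rep τ a⁻ * diag τ g) = 0 ∧ 0 ≤ rep τ a⁺ * diag τ g ∧
        0 ≤ rep τ a⁻ * diag τ g := by
    intro a ha hsa
    refine ⟨?_, ?_, rep_mul_diag_nonneg (posPart_mem_fixedAlgebra ha hsa) (CFC.posPart_nonneg a)
      hg h0, rep_mul_diag_nonneg (negPart_mem_fixedAlgebra ha hsa) (CFC.negPart_nonneg a) hg h0⟩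
    · rw [← sub_mul, ← map_sub, CFC.posPart_sub_negPart a hsa]
    · rw [rep_mul_diag_mul_rep_mul_diag (negPart_mem_fixedAlgebra ha hsa) hg hg,
        CFC.posPart_mul_negPart, map_zero, zero_mul]
  have hre : (realPart f : CuntzAlgebra n) ∈ fixedAlgebra n := by
    rw [realPart_apply_coe, ← Complex.coe_smul]
    exact (fixedAlgebra n).smul_mem (add_mem hf (star_mem hf)) _
  have him : (imaginaryPart f : CuntzAlgebra n) ∈ fixedAlgebra n := by
    rw [imaginaryPart_apply_coe, ← Complex.coe_smul]
    exact (fixedAlgebra n).smul_mem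
      ((fixedAlgebra n).smul_mem (sub_mem hf (star_mem hf)) _) _
  obtain ⟨r1, r2, r3, r4⟩ := split _ hre (realPart f).2
  obtain ⟨i1, i2, i3, i4⟩ := split _ him (imaginaryPart f).2
  rw [linearExtension_eq v ((realPart_rep_mul_diag hf hg).trans r1) r2 r3 r4
    ((imaginaryPart_rep_mul_diag hf hg).trans i1) i2 i3 i4,
    key _ hre (realPart f).2, key _ him (imaginaryPart f).2]
  conv_rhs => rw [← realPart_add_I_smul_imaginaryPart f, map_add, map_smul, smul_eq_mul]
  ring

end LinearExtension

/-! ### The zeta function of the generator -/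

section Residue

/-- The eigenvalues `(1 + k²)^{-s/2}` of `(1 + D²)^{-s/2}`. -/
noncomputable def resolventSymbol (s : ℝ) (k : ℤ) : ℝ := (1 + (k : ℝ) ^ 2) ^ (-s / 2)

theorem resolventSymbol_nonneg (s : ℝ) (k : ℤ) : 0 ≤ resolventSymbol s k :=
  Real.rpow_nonneg (by positivity) _

theorem resolventSymbol_bounded {s : ℝ} (hs : 0 ≤ s) : ∃ C, ∀ k, |resolventSymbol s k| ≤ C := by
  refine ⟨1, fun k => ?_⟩
  rw [abs_of_nonneg (resolventSymbol_nonneg s k)]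
  exact Real.rpow_le_one_of_one_le_of_nonpos (by nlinarith [sq_nonneg (k : ℝ)]) (by linarith)

theorem resolventSymbol_neg (s : ℝ) (k : ℤ) : resolventSymbol s (-k) = resolventSymbol s k := by
  simp [resolventSymbol]

theorem resolventSymbol_zero (s : ℝ) : resolventSymbol s 0 = 1 := by
  simp [resolventSymbol]

theorem sq_rpow_neg_half {x : ℝ} (hx : 0 ≤ x) (s : ℝ) : (x ^ 2) ^ (-s / 2) = 1 / x ^ s := by
  rw [← Real.rpow_natCast, ← Real.rpow_mul hx, one_div, ← Real.rpow_neg hx]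
  congr 1
  push_cast
  ring

theorem resolventSymbol_le {s : ℝ} (hs : 0 ≤ s) {k : ℤ} (hk : 0 < k) :
    resolventSymbol s k ≤ 1 / (k : ℝ) ^ s := by
  have hk' : (0 : ℝ) < k := by exact_mod_cast hk
  rw [← sq_rpow_neg_half hk'.le]
  exact Real.rpow_le_rpow_of_nonpos (by positivity) (by linarith) (by linarith)

theorem le_resolventSymbol {s : ℝ} (hs : 0 ≤ s) {k : ℤ} (hk : 0 ≤ k) :
    1 / ((k : ℝ) + 1) ^ s ≤ resolventSymbol s k := by
  have hk' : (0 : ℝ) ≤ k := by exact_mod_cast hk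
  rw [← sq_rpow_neg_half (by positivity)]
  exact Real.rpow_le_rpow_of_nonpos (by positivity) (by nlinarith) (by linarith)

theorem summable_one_div_succ_rpow {s : ℝ} (hs : 1 < s) :
    Summable fun k : ℕ => 1 / ((k : ℝ) + 1) ^ s := by
  have := (summable_nat_add_iff 1).mpr (Real.summable_one_div_nat_rpow.mpr hs)
  exact_mod_cast this

theorem resolventSymbol_succ_le {s : ℝ} (hs : 0 ≤ s) (k : ℕ) :
    resolventSymbol s (k + 1) ≤ 1 / ((k : ℝ) + 1) ^ s := by
  have := resolventSymbol_le hs (k := (k : ℤ) + 1) (by positivity)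
  exact_mod_cast this

theorem summable_resolventSymbol {s : ℝ} (hs : 1 < s) :
    Summable fun k : ℕ => resolventSymbol s (k + 1) :=
  Summable.of_nonneg_of_le (fun _ => resolventSymbol_nonneg _ _)
    (resolventSymbol_succ_le (by linarith)) (summable_one_div_succ_rpow hs)

theorem intSum_resolventSymbol {s : ℝ} (hs : 1 < s) :
    intSum (resolventSymbol s) =
      ENNReal.ofReal (1 + 2 * ∑' k : ℕ, resolventSymbol s (k + 1)) := by
  have h0 : ∀ k : ℕ, 0 ≤ resolventSymbol s (k + 1) := fun _ => resolventSymbol_nonneg _ _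
  simp_rw [intSum, resolventSymbol_neg, resolventSymbol_zero, ← two_mul]
  rw [ENNReal.tsum_mul_left, ← ENNReal.ofReal_tsum_of_nonneg h0 (summable_resolventSymbol hs),
    ENNReal.ofReal_add zero_le_one (mul_nonneg zero_le_two (tsum_nonneg h0)),
    ENNReal.ofReal_mul zero_le_two]
  simp

/-- The residue at `s = 1` of `∑_{k ∈ ℤ} (1 + k²)^{-s/2}` is `2`: since
`(k + 1)^{-s} ≤ (1 + k²)^{-s/2} ≤ k^{-s}`, the sum differs from `2 ζ(s)` by a bounded amount. -/
theorem tendsto_sub_one_mul_intSum :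
    Tendsto (fun s : ℝ => (s - 1) * (intSum (resolventSymbol s)).toReal) (𝓝[>] 1) (𝓝 2) := by
  set A : ℝ → ℝ := fun s => ∑' k : ℕ, 1 / ((k : ℝ) + 1) ^ s with hA
  set B : ℝ → ℝ := fun s => ∑' k : ℕ, resolventSymbol s (k + 1) with hB
  have hA1 : Tendsto (fun s : ℝ => (s - 1) * A s) (𝓝[>] 1) (𝓝 1) := by
    refine tendsto_sub_mul_tsum_nat_rpow.congr' ?_
    filter_upwards [self_mem_nhdsWithin] with s hs
    have hs' : (1 : ℝ) < s := hs
    rw [(Real.summable_one_div_nat_rpow.mpr hs').tsum_eq_zero_add, hA]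
    simp [Real.zero_rpow (by linarith : s ≠ 0)]
  have hs0 : Tendsto (fun s : ℝ => s - 1) (𝓝[>] 1) (𝓝 0) := by
    have : Tendsto (fun s : ℝ => s - 1) (𝓝 1) (𝓝 (1 - 1)) := tendsto_id.sub_const 1
    rw [sub_self] at this
    exact this.mono_left nhdsWithin_le_nhds
  have hA2 : Tendsto (fun s : ℝ => (s - 1) * (A s - 1)) (𝓝[>] 1) (𝓝 1) := by
    have := hA1.sub hs0
    rw [sub_zero] at this
    exact this.congr fun s => by ring
  have hB1 : Tendsto (fun s : ℝ => (s - 1) * B s) (𝓝[>] 1) (𝓝 1) := by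
    refine tendsto_of_tendsto_of_tendsto_of_le_of_le' hA2 hA1 ?_ ?_
    · filter_upwards [self_mem_nhdsWithin] with s hs
      have hs' : (1 : ℝ) < s := hs
      refine mul_le_mul_of_nonneg_left ?_ (by linarith)
      have h1 : A s - 1 = ∑' k : ℕ, 1 / (((k + 1 : ℕ) : ℝ) + 1) ^ s := by
        rw [hA]
        beta_reduce
        rw [(summable_one_div_succ_rpow hs').tsum_eq_zero_add]
        simp
      rw [h1]
      refine Summable.tsum_le_tsum (fun k => ?_)
        ((summable_nat_add_iff 1).mpr (summable_one_div_succ_rpow hs'))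
        (summable_resolventSymbol hs')
      have := le_resolventSymbol (s := s) (by linarith) (k := (k : ℤ) + 1) (by positivity)
      exact_mod_cast this
    · filter_upwards [self_mem_nhdsWithin] with s hs
      have hs' : (1 : ℝ) < s := hs
      exact mul_le_mul_of_nonneg_left (Summable.tsum_le_tsum
        (resolventSymbol_succ_le (by linarith)) (summable_resolventSymbol hs')
        (summable_one_div_succ_rpow hs')) (by linarith)
  have h := hs0.add (hB1.const_mul 2)
  rw [zero_add, mul_one] at h
  refine h.congr' ?_
  filter_upwards [self_mem_nhdsWithin] with s hs
  have hs' : (1 : ℝ) < s := hs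
  rw [intSum_resolventSymbol hs', ENNReal.toReal_ofReal (add_nonneg zero_le_one
    (mul_nonneg zero_le_two (tsum_nonneg fun _ => resolventSymbol_nonneg _ _)))]
  ring

variable {n : ℕ} {τ : FaithfulNormalizedTrace n}

theorem resolventPower_eq_diag {s : ℝ} (hs : 0 ≤ s) :
    resolventPower τ s = diag τ (resolventSymbol s) :=
  functionalCalculus_eq_diag (G := fun x => (1 + x ^ 2) ^ (-s / 2)) (resolventSymbol_bounded hs)

theorem tauDelta_rep_mul_resolventSymbol_lt_top {f : CuntzAlgebra n} (hf : f ∈ fixedAlgebra n)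
    (hf0 : 0 ≤ f) {s : ℝ} (hs : 1 < s) :
    tauDelta τ (rep τ f * diag τ (resolventSymbol s)) < ∞ := by
  rw [tauDelta_rep_mul_diag hf hf0 (resolventSymbol_bounded (by linarith))
    (resolventSymbol_nonneg s), intSum_resolventSymbol hs]
  exact ENNReal.mul_lt_top ENNReal.ofReal_lt_top ENNReal.ofReal_lt_top

theorem traceValue_rep_mul_resolventSymbol {f : CuntzAlgebra n} (hf : f ∈ fixedAlgebra n)
    {s : ℝ} (hs : 1 < s) :
    traceValue (tauDelta τ) (rep τ f * diag τ (resolventSymbol s)) =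
      (intSum (resolventSymbol s)).toReal * τ.kms f := by
  have hb := resolventSymbol_bounded (s := s) (by linarith)
  refine linearExtension_rep_mul_diag hb (resolventSymbol_nonneg s) (fun a ha ha0 => ?_) hf
  rw [tauDelta_rep_mul_diag ha ha0 hb (resolventSymbol_nonneg s), ENNReal.toReal_mul,
    ENNReal.toReal_ofReal (re_kms_nonneg τ ha0), mul_comm]

end Residue

/-! ### Singular values, logarithmic means and Dixmier states -/

section SingularValue

variable {H : Type*} [NormedAddCommGroup H] [InnerProductSpace ℂ H] [CompleteSpace H]
  {M : VonNeumannAlgebra H} {φ : (H →L[ℂ] H) → ℝ≥0∞} {T : H →L[ℂ] H}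

theorem singularValue_le {E : H →L[ℂ] H} {s : ℝ} (hE : E ∈ M) (hEp : IsStarProjection E)
    (hφ : φ (1 - E) ≤ ENNReal.ofReal s) : singularValue M φ T s ≤ ‖T * E‖ :=
  csInf_le ⟨0, by rintro _ ⟨E, -, -, -, rfl⟩; exact norm_nonneg _⟩ ⟨E, hE, hEp, hφ, rfl⟩

theorem singularValue_nonneg (s : ℝ) : 0 ≤ singularValue M φ T s :=
  Real.sInf_nonneg (by rintro _ ⟨E, -, -, -, rfl⟩; exact norm_nonneg _)

theorem le_singularValue (h0 : φ 0 = 0) {s r : ℝ}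
    (h : ∀ E ∈ M, IsStarProjection E → φ (1 - E) ≤ ENNReal.ofReal s → r ≤ ‖T * E‖) :
    r ≤ singularValue M φ T s := by
  refine le_csInf ⟨_, 1, one_mem M, .one _, ?_, rfl⟩ ?_
  · rw [sub_self, h0]; exact zero_le
  · rintro _ ⟨E, hE, hEp, hφ, rfl⟩
    exact h E hE hEp hφ

theorem antitone_singularValue (h0 : φ 0 = 0) : Antitone (singularValue M φ T) := fun _ _ hst =>
  le_singularValue h0 fun _ hE hEp hφ =>
    singularValue_le hE hEp (hφ.trans (ENNReal.ofReal_le_ofReal hst))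

theorem singularValue_le_norm (h0 : φ 0 = 0) (s : ℝ) : singularValue M φ T s ≤ ‖T‖ := by
  simpa using singularValue_le (T := T) (one_mem M) (.one _)
    (show φ (1 - 1) ≤ ENNReal.ofReal s by rw [sub_self, h0]; exact zero_le)

theorem integral_div_one_add (K : ℝ) {a t : ℝ} (ha : 0 ≤ a) (ht : a ≤ t) :
    ∫ s in a..t, K / (1 + s) = K * (Real.log (1 + t) - Real.log (1 + a)) := by
  simp_rw [div_eq_mul_inv]
  rw [intervalIntegral.integral_const_mul,
    intervalIntegral.integral_comp_add_left (fun x : ℝ => x⁻¹) 1,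
    integral_inv_of_pos (by linarith) (by linarith), Real.log_div (by linarith) (by linarith)]

theorem intervalIntegrable_div_one_add (K : ℝ) {a t : ℝ} (ha : 0 ≤ a) (ht : a ≤ t) :
    IntervalIntegrable (fun s : ℝ => K / (1 + s)) MeasureTheory.volume a t := by
  refine ContinuousOn.intervalIntegrable ?_
  rw [Set.uIcc_of_le ht]
  refine continuousOn_const.div (by fun_prop) fun s hs => ?_
  linarith [hs.1]

theorem logMean_nonneg {t : ℝ} (ht : 0 < t) : 0 ≤ logMean M φ T t :=
  mul_nonneg (one_div_nonneg.mpr (Real.log_nonneg (by linarith)))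
    (intervalIntegral.integral_nonneg ht.le fun s _ => singularValue_nonneg s)

theorem logMean_le (h0 : φ 0 = 0) {K : ℝ} (hK : ∀ s, 0 ≤ s → singularValue M φ T s ≤ K / (1 + s))
    {t : ℝ} (ht : 0 < t) : logMean M φ T t ≤ K := by
  have hlog : 0 < Real.log (1 + t) := Real.log_pos (by linarith)
  have h := intervalIntegral.integral_mono_on ht.le
    (antitone_singularValue (M := M) (T := T) h0).intervalIntegrable
    (intervalIntegrable_div_one_add K le_rfl ht.le) fun s hs => hK s hs.1
  rw [integral_div_one_add K le_rfl ht.le, add_zero, Real.log_one, sub_zero] at h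
  rw [logMean, one_div, inv_mul_le_iff₀ hlog, mul_comm]
  exact h

theorem memLp_logMean (h0 : φ 0 = 0) {K : ℝ}
    (hK : ∀ s, 0 ≤ s → singularValue M φ T s ≤ K / (1 + s)) :
    MeasureTheory.MemLp (logMean M φ T) ∞
      (MeasureTheory.volume.restrict (Set.Ioi (0 : ℝ))) := by
  have hcont : ContinuousOn (logMean M φ T) (Set.Ioi 0) := by
    have h1 : Continuous fun t : ℝ => ∫ s in (0 : ℝ)..t, singularValue M φ T s :=
      intervalIntegral.continuous_primitive
        (fun a b => (antitone_singularValue h0).intervalIntegrable) 0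
    have h2 : ContinuousOn (fun t : ℝ => 1 / Real.log (1 + t)) (Set.Ioi 0) := by
      refine continuousOn_const.div ?_ fun t ht => (Real.log_pos (by
        have : (0 : ℝ) < t := ht
        linarith)).ne'
      refine ContinuousOn.log (by fun_prop) fun t ht => ?_
      have : (0 : ℝ) < t := ht
      linarith
    exact h2.mul h1.continuousOn
  refine MeasureTheory.memLp_top_of_bound (hcont.aestronglyMeasurable measurableSet_Ioi) K ?_
  refine (MeasureTheory.ae_restrict_mem measurableSet_Ioi).mono fun t ht => ?_
  rw [Real.norm_of_nonneg (logMean_nonneg ht)]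
  exact logMean_le h0 hK ht

/-- If `μ_s(T) ~ L / s`, then the logarithmic means of the singular values converge to `L`. -/
theorem tendsto_logMean (h0 : φ 0 = 0) {K L : ℝ}
    (hK : ∀ s, 0 ≤ s → singularValue M φ T s ≤ K / (1 + s))
    (hL : Tendsto (fun s => s * singularValue M φ T s) atTop (𝓝 L)) :
    Tendsto (logMean M φ T) atTop (𝓝 L) := by
  set m := singularValue M φ T with hm
  have hint : ∀ a b, IntervalIntegrable m MeasureTheory.volume a b := fun a b =>
    (antitone_singularValue h0).intervalIntegrable
  have hm0 : Tendsto m atTop (𝓝 0) := by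
    have h1 : Tendsto (fun s : ℝ => K / (1 + s)) atTop (𝓝 0) :=
      tendsto_const_nhds.div_atTop (tendsto_atTop_add_const_left _ _ tendsto_id)
    exact tendsto_of_tendsto_of_tendsto_of_le_of_le' tendsto_const_nhds h1
      (Eventually.of_forall fun s => singularValue_nonneg s)
      ((eventually_ge_atTop 0).mono fun s hs => hK s hs)
  have hL' : Tendsto (fun s => (1 + s) * m s) atTop (𝓝 L) := by
    have := hm0.add hL
    rw [zero_add] at this
    exact this.congr fun s => by ring
  have hlog : Tendsto (fun t : ℝ => Real.log (1 + t)) atTop atTop :=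
    Real.tendsto_log_atTop.comp (tendsto_atTop_add_const_left _ _ tendsto_id)
  -- After the time `a` from which `(1 + s) μ_s` is within `ε` of `L`, the integral is compared
  -- with `∫ (L ± ε) / (1 + s)`; what comes before contributes a constant over `log (1 + t)`.
  have hbounds : ∀ ε > 0, ∃ C : ℝ, ∀ᶠ t in atTop,
      L - ε - C / Real.log (1 + t) ≤ logMean M φ T t ∧
        logMean M φ T t ≤ L + ε + C / Real.log (1 + t) := by
    intro ε hε
    obtain ⟨a₀, ha₀⟩ := (hL'.eventually (Metric.closedBall_mem_nhds L hε)).exists_forall_of_atTop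
    set a := max a₀ 0 with ha
    have ha0 : 0 ≤ a := le_max_right _ _
    have hclose : ∀ s, a ≤ s → (L - ε) / (1 + s) ≤ m s ∧ m s ≤ (L + ε) / (1 + s) := fun s hs => by
      have h1 := ha₀ s ((le_max_left _ _).trans hs)
      rw [Real.dist_eq, abs_le] at h1
      have hs0 : 0 < 1 + s := by linarith
      rw [div_le_iff₀ hs0, le_div_iff₀ hs0]
      constructor <;> linarith [h1.1, h1.2]
    set I := ∫ s in (0 : ℝ)..a, m s with hI
    refine ⟨|I| + |(L - ε) * Real.log (1 + a)| + |(L + ε) * Real.log (1 + a)|, ?_⟩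
    filter_upwards [eventually_ge_atTop (a + 1)] with t ht
    have hat : a ≤ t := by linarith
    have hlt : 0 < Real.log (1 + t) := Real.log_pos (by linarith)
    have hsplit : ∫ s in (0 : ℝ)..t, m s = I + ∫ s in a..t, m s :=
      (intervalIntegral.integral_add_adjacent_intervals (hint _ _) (hint _ _)).symm
    have hlow := intervalIntegral.integral_mono_on hat
      (intervalIntegrable_div_one_add (L - ε) ha0 hat) (hint a t) fun s hs => (hclose s hs.1).1
    have hup := intervalIntegral.integral_mono_on hat (hint a t)
      (intervalIntegrable_div_one_add (L + ε) ha0 hat) fun s hs => (hclose s hs.1).2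
    rw [integral_div_one_add _ ha0 hat] at hlow hup
    have e : logMean M φ T t = (I + ∫ s in a..t, m s) / Real.log (1 + t) := by
      rw [logMean, ← hm, hsplit]
      ring
    rw [e]
    constructor
    · rw [sub_le_iff_le_add, ← add_div, le_div_iff₀ hlt]
      nlinarith [neg_abs_le I, le_abs_self ((L - ε) * Real.log (1 + a)),
        abs_nonneg ((L + ε) * Real.log (1 + a))]
    · rw [← sub_le_iff_le_add, ← sub_div, div_le_iff₀ hlt]
      nlinarith [le_abs_self I, neg_abs_le ((L + ε) * Real.log (1 + a)),
        abs_nonneg ((L - ε) * Real.log (1 + a))]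
  refine Metric.tendsto_nhds.mpr fun ε hε => ?_
  obtain ⟨C, hC⟩ := hbounds (ε / 4) (by linarith)
  have hsmall : Tendsto (fun t : ℝ => C / Real.log (1 + t)) atTop (𝓝 0) :=
    tendsto_const_nhds.div_atTop hlog
  filter_upwards [hC, Metric.tendsto_nhds.mp hsmall (ε / 4) (by linarith)] with t ht ht2
  rw [Real.dist_eq, sub_zero, abs_lt] at ht2
  rw [Real.dist_eq, abs_lt]
  constructor <;> linarith [ht.1, ht.2, ht2.1, ht2.2]

/-- A dilation invariant generalised limit extends the ordinary limit at infinity. -/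
theorem DixmierState.eval_eq_of_tendsto (ω : DixmierState) {g : ℝ → ℝ} {L : ℝ}
    (hg : MeasureTheory.MemLp g ∞ (MeasureTheory.volume.restrict (Set.Ioi (0 : ℝ))))
    (hL : Tendsto g atTop (𝓝 L)) : ω.eval g = L := by
  rw [DixmierState.eval, dif_pos hg]
  refine le_antisymm (le_of_forall_pos_le_add fun ε hε => ?_)
    (le_of_forall_pos_le_add fun ε hε => ?_)
  · obtain ⟨t₀, ht₀⟩ := (hL.eventually_le_const (lt_add_of_pos_right L hε)).exists_forall_of_atTop
    refine ω.le_of_eventually_le' (hg.toLp g) _ t₀ ?_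
    filter_upwards [hg.coeFn_toLp] with t ht h
    rw [ht]
    exact ht₀ t h
  · obtain ⟨t₀, ht₀⟩ := (hL.eventually_const_le (sub_lt_self L hε)).exists_forall_of_atTop
    have h : ω.toLinearMap (-hg.toLp g) ≤ -(L - ε) := by
      refine ω.le_of_eventually_le' (-hg.toLp g) _ t₀ ?_
      filter_upwards [hg.coeFn_toLp, MeasureTheory.Lp.coeFn_neg (hg.toLp g)] with t ht ht2 h
      rw [ht2, Pi.neg_apply, ht]
      exact neg_le_neg (ht₀ t h)
    rw [map_neg] at h
    linarith

end SingularValue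

/-! ### Elements of finite spectrum in the fixed-point algebra -/

section FiniteSpectrum

variable {n : ℕ}

/-- A spectral decomposition `a = ∑ x_i p_i` with finitely many mutually orthogonal projections
`p_i` of sum one in the fixed-point algebra, and `x_i ≥ 0`. -/
structure SpectralDecomposition (a : CuntzAlgebra n) where
  /-- The finite set of values. -/
  values : Finset ℝ
  /-- The spectral projection of a value. -/
  proj : ℝ → CuntzAlgebra n
  nonneg : ∀ x ∈ values, 0 ≤ x
  proj_mem : ∀ x, proj x ∈ fixedAlgebra n
  isStarProjection : ∀ x, IsStarProjection (proj x)
  mul_of_ne : ∀ x y, x ≠ y → proj x * proj y = 0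
  sum_proj : ∑ x ∈ values, proj x = 1
  sum_smul_proj : ∑ x ∈ values, (x : ℂ) • proj x = a

/-- The finite-dimensional algebra spanned by the matrix units `S_μ (S_ν)*` with `|μ| = |ν| = k`. -/
noncomputable def matrixLevel (n k : ℕ) : Submodule ℂ (CuntzAlgebra n) :=
  Submodule.span ℂ (Set.range fun p : (Fin k → Fin n) × (Fin k → Fin n) =>
    tupleGen p.1 * star (tupleGen p.2))

theorem matrixUnit_mem_matrixLevel {k : ℕ} (μ ν : Fin k → Fin n) :
    tupleGen μ * star (tupleGen ν) ∈ matrixLevel n k :=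
  Submodule.subset_span ⟨(μ, ν), rfl⟩

theorem one_mem_matrixLevel (k : ℕ) : (1 : CuntzAlgebra n) ∈ matrixLevel n k := by
  rw [← sum_tupleGen_mul_star k]
  exact sum_mem fun μ _ => matrixUnit_mem_matrixLevel μ μ

theorem mul_mem_matrixLevel {k : ℕ} {a b : CuntzAlgebra n} (ha : a ∈ matrixLevel n k)
    (hb : b ∈ matrixLevel n k) : a * b ∈ matrixLevel n k := by
  induction ha using Submodule.span_induction with
  | mem x hx =>
    obtain ⟨⟨μ, ν⟩, rfl⟩ := hx
    induction hb using Submodule.span_induction with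
    | mem y hy =>
      obtain ⟨⟨μ', ν'⟩, rfl⟩ := hy
      change tupleGen μ * star (tupleGen ν) * (tupleGen μ' * star (tupleGen ν')) ∈ _
      rw [mul_assoc, ← mul_assoc (star (tupleGen ν)), star_tupleGen_mul_tupleGen]
      split_ifs
      · rw [one_mul]
        exact matrixUnit_mem_matrixLevel μ ν'
      · simp
    | zero => simp
    | add x y _ _ hx hy => rw [mul_add]; exact add_mem hx hy
    | smul c x _ hx => rw [mul_smul_comm]; exact Submodule.smul_mem _ _ hx
  | zero => simp
  | add x y _ _ hx hy => rw [add_mul]; exact add_mem hx hy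
  | smul c x _ hx => rw [smul_mul_assoc]; exact Submodule.smul_mem _ _ hx

theorem star_mem_matrixLevel {k : ℕ} {a : CuntzAlgebra n} (ha : a ∈ matrixLevel n k) :
    star a ∈ matrixLevel n k := by
  induction ha using Submodule.span_induction with
  | mem x hx =>
    obtain ⟨⟨μ, ν⟩, rfl⟩ := hx
    change star (tupleGen μ * star (tupleGen ν)) ∈ _
    rw [star_mul, star_star]
    exact matrixUnit_mem_matrixLevel ν μ
  | zero => simp
  | add x y _ _ hx hy => rw [star_add]; exact add_mem hx hy
  | smul c x _ hx => rw [star_smul]; exact Submodule.smul_mem _ _ hx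

theorem matrixLevel_le_fixedAlgebra {k : ℕ} {a : CuntzAlgebra n} (ha : a ∈ matrixLevel n k) :
    a ∈ fixedAlgebra n := by
  refine Submodule.span_le (p := (fixedAlgebra n).toSubalgebra.toSubmodule).mpr ?_ ha
  rintro _ ⟨⟨μ, ν⟩, rfl⟩
  exact mul_star_mem_fixedAlgebra (tupleGen_mem_homogeneous μ) (tupleGen_mem_homogeneous ν)

theorem matrixLevel_mono : Monotone (matrixLevel n) := by
  refine monotone_nat_of_le_succ fun k => Submodule.span_le.mpr ?_
  rintro _ ⟨⟨μ, ν⟩, rfl⟩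
  have hsnoc : ∀ (μ : Fin k → Fin n) (i : Fin n),
      tupleGen (Fin.snoc (α := fun _ => Fin n) μ i) = tupleGen μ * gen i := fun μ i => by
    have : List.ofFn (Fin.snoc (α := fun _ => Fin n) μ i) = List.ofFn μ ++ [i] := by
      rw [List.ofFn_succ']
      simp
    rw [tupleGen, this, wordGen_append, wordGen_cons, wordGen_nil, mul_one, tupleGen]
  have e : tupleGen μ * star (tupleGen ν) =
      ∑ i, tupleGen (Fin.snoc (α := fun _ => Fin n) μ i) *
        star (tupleGen (Fin.snoc (α := fun _ => Fin n) ν i)) := by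
    have e1 : ∀ i : Fin n, tupleGen (Fin.snoc (α := fun _ => Fin n) μ i) *
        star (tupleGen (Fin.snoc (α := fun _ => Fin n) ν i)) =
          tupleGen μ * (gen i * star (gen i)) * star (tupleGen ν) := fun i => by
      rw [hsnoc, hsnoc, star_mul]
      simp only [mul_assoc]
    simp_rw [e1]
    rw [← Finset.sum_mul, ← Finset.mul_sum, isCuntzFamily_gen.sum_range, mul_one]
  change tupleGen μ * star (tupleGen ν) ∈ matrixLevel n (k + 1)
  rw [e]
  exact sum_mem fun i _ => matrixUnit_mem_matrixLevel _ _

theorem fixedAlgebra_subset_closure_matrixLevel :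
    (fixedAlgebra n : Set (CuntzAlgebra n)) ⊆
      closure (⨆ k, matrixLevel n k : Submodule ℂ (CuntzAlgebra n)) := fun f hf => by
  have hcl : IsClosed ((⨆ k, matrixLevel n k : Submodule ℂ (CuntzAlgebra n)).topologicalClosure :
      Set (CuntzAlgebra n)) := Submodule.isClosed_topologicalClosure _
  exact fixedAlgebra_induction
    (p := fun f => f ∈ (⨆ k, matrixLevel n k : Submodule ℂ (CuntzAlgebra n)).topologicalClosure)
    hcl (fun k μ ν => Submodule.le_topologicalClosure _
      (Submodule.mem_iSup_of_mem k (matrixUnit_mem_matrixLevel μ ν)))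
    (zero_mem _) (fun _ _ => add_mem) (fun c _ => Submodule.smul_mem _ c) hf

theorem finite_spectrum_of_mem_matrixLevel {k : ℕ} {a : CuntzAlgebra n}
    (ha : a ∈ matrixLevel n k) : (spectrum ℂ a).Finite := by
  let A : Subalgebra ℂ (CuntzAlgebra n) :=
    (matrixLevel n k).toSubalgebra (one_mem_matrixLevel k) fun _ _ => mul_mem_matrixLevel
  have : Module.Finite ℂ A :=
    Module.Finite.span_of_finite ℂ (Set.finite_range _)
  obtain ⟨p, hp, hpa⟩ := (Algebra.IsIntegral.isIntegral (R := ℂ) (⟨a, ha⟩ : A)).map A.val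
  change Polynomial.aeval a p = 0 at hpa
  refine (p.rootSet_finite ℂ).subset fun z hz => ?_
  rw [Polynomial.mem_rootSet]
  refine ⟨hp.ne_zero, ?_⟩
  have h := spectrum.subset_polynomial_aeval a p ⟨z, hz, rfl⟩
  rw [hpa] at h
  rcases subsingleton_or_nontrivial (CuntzAlgebra n) with hs | hs
  · simp at h
  · simpa using h

/-- Functional calculus with the indicator functions of the points of the spectrum, which are
continuous on a finite spectrum, gives the spectral decomposition. -/
theorem exists_spectralDecomposition {k : ℕ} {a : CuntzAlgebra n} (ha : a ∈ matrixLevel n k)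
    (ha0 : 0 ≤ a) : Nonempty (SpectralDecomposition a) := by
  classical
  have hsa : IsSelfAdjoint a := ha0.isSelfAdjoint
  have hfin : (spectrum ℝ a).Finite := by
    rw [← spectrum.preimage_algebraMap ℂ]
    exact (finite_spectrum_of_mem_matrixLevel ha).preimage
      (FaithfulSMul.algebraMap_injective ℝ ℂ).injOn
  have hc : ∀ F : ℝ → ℝ, ContinuousOn F (spectrum ℝ a) := fun F => hfin.continuousOn F
  set χ : ℝ → ℝ → ℝ := fun x y => if y = x then 1 else 0 with hχ
  refine ⟨{
    values := hfin.toFinset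
    proj := fun x => cfc (χ x) a
    nonneg := fun x hx => spectrum_nonneg_of_nonneg ha0 (hfin.mem_toFinset.mp hx)
    proj_mem := fun x => cfc_mem_fixedAlgebra (matrixLevel_le_fixedAlgebra ha) hsa (hc _)
    isStarProjection := fun x => ⟨?_, cfc_predicate _ a⟩
    mul_of_ne := fun x y hxy => ?_
    sum_proj := ?_
    sum_smul_proj := ?_ }⟩
  · rw [IsIdempotentElem, ← cfc_mul _ _ a (hc _) (hc _)]
    refine cfc_congr fun y _ => ?_
    simp only [hχ]
    split_ifs <;> simp
  · rw [← cfc_mul _ _ a (hc _) (hc _), ← cfc_zero ℝ a]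
    refine cfc_congr fun z _ => ?_
    simp only [hχ, Pi.zero_apply]
    split_ifs with h1 h2
    · exact absurd (h1.symm.trans h2) hxy
    all_goals simp
  · rw [← cfc_sum _ a _ fun _ _ => hc _, ← cfc_one ℝ a]
    refine cfc_congr fun y hy => ?_
    simp [hχ, hfin.mem_toFinset.mpr hy]
  · have e : ∀ x : ℝ, (x : ℂ) • cfc (χ x) a = cfc (fun y => x * χ x y) a := fun x => by
      rw [Complex.coe_smul, ← cfc_smul x _ a (hc _)]
      rfl
    simp_rw [e]
    rw [← cfc_sum _ a _ fun _ _ => hc _]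
    conv_rhs => rw [← cfc_id ℝ a]
    refine cfc_congr fun y hy => ?_
    simp [hχ, hy]

/-- Positive elements of the fixed-point algebra are limits of positive elements of finite
spectrum: approximate the square root. -/
theorem exists_spectralDecomposition_near {f : CuntzAlgebra n} (hf : f ∈ fixedAlgebra n)
    (hf0 : 0 ≤ f) {U : Set (CuntzAlgebra n)} (hU : U ∈ 𝓝 f) :
    ∃ a ∈ U, a ∈ fixedAlgebra n ∧ 0 ≤ a ∧ Nonempty (SpectralDecomposition a) := by
  have hr := fixedAlgebra_subset_closure_matrixLevel (sqrt_mem_fixedAlgebra hf hf0)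
  have hcont : ContinuousAt (fun b : CuntzAlgebra n => star b * b) (CFC.sqrt f) := by fun_prop
  have hval : star (CFC.sqrt f) * CFC.sqrt f = f := by
    rw [(CFC.sqrt_nonneg f).isSelfAdjoint.star_eq, CFC.sqrt_mul_sqrt_self f hf0]
  obtain ⟨b, hbU, hb⟩ := mem_closure_iff_nhds.mp hr _ (hcont.preimage_mem_nhds (hval ▸ hU))
  obtain ⟨k, hk⟩ := (Submodule.mem_iSup_of_directed _ matrixLevel_mono.directed_le).mp hb
  have hmem := mul_mem_matrixLevel (star_mem_matrixLevel hk) hk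
  exact ⟨star b * b, hbU, matrixLevel_le_fixedAlgebra hmem, star_mul_self_nonneg b,
    exists_spectralDecomposition hmem (star_mul_self_nonneg b)⟩

end FiniteSpectrum

/-! ### Singular values of `π(f) (1 + D²)^{-1/2}` -/

section SingularValueEstimates

variable {n : ℕ} {τ : FaithfulNormalizedTrace n}

/-- The indicator function of `{k | |k| < m}`. -/
noncomputable def cutoff (m : ℕ) (k : ℤ) : ℝ := if k.natAbs < m then 1 else 0

theorem cutoff_nonneg (m : ℕ) (k : ℤ) : 0 ≤ cutoff m k := by
  rw [cutoff]; split_ifs <;> simp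

theorem cutoff_bounded (m : ℕ) : ∃ C, ∀ k, |cutoff m k| ≤ C :=
  ⟨1, fun k => by rw [cutoff]; split_ifs <;> simp⟩

theorem one_sub_cutoff_bounded (m : ℕ) : ∃ C, ∀ k, |1 - cutoff m k| ≤ C :=
  ⟨1, fun k => by rw [cutoff]; split_ifs <;> simp⟩

/-- The set `{k | |k| < m}` has `2 m - 1` elements, also for `m = 0` with truncated subtraction. -/
theorem intSum_cutoff (m : ℕ) : intSum (cutoff m) = ((2 * m - 1 : ℕ) : ℝ≥0∞) := by
  rcases m with - | m
  · simp [intSum, cutoff]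
  · have e : ∀ k : ℕ, ENNReal.ofReal (cutoff (m + 1) (k + 1)) +
        ENNReal.ofReal (cutoff (m + 1) (-(k + 1))) = if k ∈ Finset.range m then 2 else 0 :=
      fun k => by
        have h1 : ((k : ℤ) + 1).natAbs = k + 1 := by omega
        have h2 : (-((k : ℤ) + 1)).natAbs = k + 1 := by omega
        simp only [cutoff, h1, h2, Finset.mem_range, add_lt_add_iff_right]
        split_ifs <;> norm_num
    rw [intSum, tsum_congr e, tsum_eq_sum (s := Finset.range m) fun k hk => if_neg hk,
      Finset.sum_congr rfl fun k hk => if_pos hk]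
    have h3 : 2 * (m + 1) - 1 = 1 + m * 2 := by omega
    rw [h3]
    simp [cutoff]

theorem resolventSymbol_natAbs (s : ℝ) (k : ℤ) :
    resolventSymbol s (k.natAbs : ℤ) = resolventSymbol s k := by
  rcases Int.natAbs_eq k with h | h
  · rw [← h]
  · conv_rhs => rw [h]
    rw [resolventSymbol_neg]

theorem resolventSymbol_mul_one_sub_cutoff_le {m : ℕ} {x c : ℝ} (hx : 0 ≤ x) (hc : 0 ≤ c)
    (hxm : x ≤ c * m) (k : ℤ) : |x * resolventSymbol 1 k * (1 - cutoff m k)| ≤ c := by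
  rw [cutoff]
  split_ifs with h
  · simpa using hc
  · rw [sub_zero, mul_one, abs_of_nonneg (mul_nonneg hx (resolventSymbol_nonneg 1 k))]
    rcases Nat.eq_zero_or_pos k.natAbs with h0 | h0
    · have : m = 0 := by omega
      subst this
      have : x = 0 := le_antisymm (by simpa using hxm) hx
      simpa [this] using hc
    · have hk : (0 : ℝ) < k.natAbs := by exact_mod_cast h0
      have h1 : resolventSymbol 1 k ≤ 1 / (k.natAbs : ℝ) := by
        rw [← resolventSymbol_natAbs]
        simpa using resolventSymbol_le (s := 1) zero_le_one (k := (k.natAbs : ℤ)) (by omega)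
      have h2 : (m : ℝ) ≤ k.natAbs := by exact_mod_cast not_lt.mp h
      calc x * resolventSymbol 1 k ≤ c * k.natAbs * (1 / (k.natAbs : ℝ)) := by
            gcongr
            · exact resolventSymbol_nonneg 1 k
            · exact hxm.trans (by gcongr)
        _ = c := by field_simp

theorem le_mul_resolventSymbol {m : ℕ} {x c : ℝ} (hc : 0 ≤ c) (hxm : c * m ≤ x) {k : ℤ}
    (hk : k.natAbs < m) : c ≤ x * resolventSymbol 1 k := by
  have h1 : 1 / ((k.natAbs : ℝ) + 1) ≤ resolventSymbol 1 k := by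
    rw [← resolventSymbol_natAbs]
    simpa using le_resolventSymbol (s := 1) zero_le_one (k := (k.natAbs : ℤ)) (by omega)
  have h2 : (k.natAbs : ℝ) + 1 ≤ m := by exact_mod_cast hk
  calc c = c * (k.natAbs + 1) * (1 / ((k.natAbs : ℝ) + 1)) := by field_simp
    _ ≤ x * resolventSymbol 1 k := by
      have h3 := (mul_le_mul_of_nonneg_left h2 hc).trans hxm
      gcongr
      exact (by positivity : (0 : ℝ) ≤ _).trans h3

variable (τ) in
/-- The `s`-th singular value of `π(a) (1 + D²)^{-1/2}`. -/
noncomputable def modelSingularValue (a : CuntzAlgebra n) (s : ℝ) : ℝ :=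
  singularValue (algM τ) (tauDelta τ) (rep τ a * diag τ (resolventSymbol 1)) s

/-- Cutting off the degrees `|k| < m`, at the cost of `2 m` in the trace, makes the singular values
depend on `a` with the small Lipschitz constant `1 / m`. -/
theorem modelSingularValue_add_le (a b : CuntzAlgebra n) {m : ℕ} (hm : m ≠ 0) {s : ℝ}
    (hs : 0 ≤ s) : modelSingularValue τ a (s + 2 * m) ≤ modelSingularValue τ b s + ‖a - b‖ / m := by
  rw [← sub_le_iff_le_add]
  refine le_singularValue (tauDelta_zero τ) fun E hE hEp hφ => ?_
  have hm0 : (0 : ℝ) < m := by exact_mod_cast Nat.pos_of_ne_zero hm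
  have hR : ∃ C, ∀ k, |resolventSymbol 1 k| ≤ C := resolventSymbol_bounded zero_le_one
  have hcut := cutoff_bounded m
  have hcut' := one_sub_cutoff_bounded m
  set Q : L2 τ →L[ℂ] L2 τ := diag τ (cutoff m) with hQ
  have hQp : IsStarProjection Q := isStarProjection_diag
  have hQ1 : 1 - Q = diag τ fun k => 1 - cutoff m k := one_sub_diag hcut
  have hcomm : Commute E Q := commute_diag hcut (commute_gaugeProjection_of_mem_algM τ hE)
  have hcomm' : Commute E (1 - Q) := (Commute.one_right E).sub_right hcomm
  have hp : IsStarProjection (E * (1 - Q)) := hEp.mul hQp.one_sub hcomm'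
  have hmem : E * (1 - Q) ∈ algM τ :=
    mul_mem hE (sub_mem (one_mem _) (diag_mem_algM hcut))
  have hφ' : tauDelta τ (1 - E * (1 - Q)) ≤ ENNReal.ofReal (s + 2 * m) := by
    have h1 : 1 - E * (1 - Q) ≤ (1 - E) + Q := by
      have h2 : IsStarProjection ((1 - E) * Q) :=
        hEp.one_sub.mul hQp ((Commute.one_left Q).sub_left hcomm)
      have h3 : (1 - E) + Q - (1 - E * (1 - Q)) = (1 - E) * Q := by noncomm_ring
      rw [← sub_nonneg, h3]
      exact h2.nonneg
    refine (tauDelta_mono τ h1).trans ?_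
    rw [tauDelta_add τ hEp.one_sub.nonneg hQp.nonneg, ENNReal.ofReal_add hs (by positivity)]
    refine add_le_add hφ ?_
    have h4 := tauDelta_rep_mul_diag (τ := τ) (one_mem (fixedAlgebra n)) zero_le_one hcut
      (cutoff_nonneg m)
    rw [map_one, one_mul, kms_one, intSum_cutoff] at h4
    rw [hQ, h4, Complex.one_re, ENNReal.ofReal_one, one_mul, ← ENNReal.ofReal_natCast]
    apply ENNReal.ofReal_le_ofReal
    exact_mod_cast Nat.sub_le _ _
  have hle := singularValue_le (T := rep τ a * diag τ (resolventSymbol 1)) hmem hp hφ'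
  rw [sub_le_iff_le_add]
  refine hle.trans ?_
  have hd : ‖diag τ fun k => resolventSymbol 1 k * (1 - cutoff m k)‖ ≤ 1 / m :=
    norm_diag_le (by positivity) fun k => by
      simpa using resolventSymbol_mul_one_sub_cutoff_le (m := m) (c := 1 / m) zero_le_one
        (by positivity) (by field_simp; rfl) k
  have e : rep τ a * diag τ (resolventSymbol 1) * (E * (1 - Q)) =
      rep τ b * diag τ (resolventSymbol 1) * E * (1 - Q) +
        rep τ (a - b) * (diag τ fun k => resolventSymbol 1 k * (1 - cutoff m k)) * E := by
    rw [← diag_mul_diag hR hcut', ← hQ1, map_sub, mul_assoc (rep τ b * _) E, mul_assoc _ _ E,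
      mul_assoc _ (1 - Q) E, ← hcomm'.eq]
    noncomm_ring
  rw [e]
  refine (norm_add_le _ _).trans (add_le_add ?_ ?_)
  · exact (norm_mul_le _ _).trans
      (mul_le_of_le_one_right (norm_nonneg _) hQp.one_sub.norm_le)
  · calc _ ≤ ‖rep τ (a - b)‖ * ‖diag τ fun k => resolventSymbol 1 k * (1 - cutoff m k)‖ * ‖E‖ :=
          (norm_mul_le _ _).trans (mul_le_mul_of_nonneg_right (norm_mul_le _ _) (norm_nonneg _))
      _ ≤ ‖a - b‖ * (1 / m) * 1 := by
          gcongr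
          · exact norm_rep_le τ _
          · exact hEp.norm_le
      _ = ‖a - b‖ / m := by ring

theorem norm_rep_mul_diag_resolventSymbol_le (a : CuntzAlgebra n) :
    ‖rep τ a * diag τ (resolventSymbol 1)‖ ≤ ‖a‖ := by
  have h : ‖diag τ (resolventSymbol 1)‖ ≤ 1 := norm_diag_le zero_le_one fun k => by
    rw [abs_of_nonneg (resolventSymbol_nonneg 1 k)]
    exact Real.rpow_le_one_of_one_le_of_nonpos (by nlinarith [sq_nonneg (k : ℝ)]) (by norm_num)
  calc _ ≤ ‖rep τ a‖ * ‖diag τ (resolventSymbol 1)‖ := norm_mul_le _ _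
    _ ≤ ‖a‖ * 1 := by gcongr; exact norm_rep_le τ a
    _ = ‖a‖ := mul_one _

theorem modelSingularValue_le (a : CuntzAlgebra n) {s : ℝ} (hs : 0 ≤ s) :
    modelSingularValue τ a s ≤ 6 * ‖a‖ / (1 + s) := by
  rw [le_div_iff₀ (by linarith)]
  rcases lt_or_ge s 2 with h | h
  · have h1 : modelSingularValue τ a s ≤ ‖a‖ :=
      (singularValue_le_norm (tauDelta_zero τ) s).trans (norm_rep_mul_diag_resolventSymbol_le a)
    nlinarith [norm_nonneg a]
  · set m : ℕ := ⌊s / 2⌋₊ with hm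
    have hm1 : 1 ≤ m := Nat.one_le_floor_iff _ |>.mpr (by linarith)
    have hm2 : (m : ℝ) ≤ s / 2 := Nat.floor_le (by linarith)
    have hm3 : s / 2 < m + 1 := Nat.lt_floor_add_one _
    have hm4 : (1 : ℝ) ≤ m := by exact_mod_cast hm1
    have h0 : modelSingularValue τ 0 0 ≤ 0 := by
      have := singularValue_le_norm (M := algM τ) (T := rep τ 0 * diag τ (resolventSymbol 1))
        (tauDelta_zero τ) 0
      simpa [modelSingularValue] using this
    have h1 := modelSingularValue_add_le (τ := τ) a 0 (by omega : m ≠ 0) le_rfl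
    have h2 : modelSingularValue τ a s ≤ modelSingularValue τ a (0 + 2 * m) :=
      antitone_singularValue (tauDelta_zero τ) (by linarith)
    have h3 : modelSingularValue τ a s ≤ ‖a‖ / m := by
      rw [sub_zero] at h1; linarith
    calc modelSingularValue τ a s * (1 + s) ≤ ‖a‖ / m * (6 * m) := by
          gcongr
          linarith
      _ = 6 * ‖a‖ := by field_simp

end SingularValueEstimates

/-! ### Asymptotics of the singular values -/

namespace SpectralDecomposition

variable {n : ℕ} {τ : FaithfulNormalizedTrace n} {a : CuntzAlgebra n} {g h : ℝ → ℤ → ℝ}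

variable (τ) in
/-- The joint functional calculus `g(a, D) = ∑_x π(p_x) g(x, D)` of the commuting operators `π(a)`
and `D`. -/
noncomputable def block (d : SpectralDecomposition a) (g : ℝ → ℤ → ℝ) : L2 τ →L[ℂ] L2 τ :=
  ∑ x ∈ d.values, rep τ (d.proj x) * diag τ (g x)

theorem block_mul_block (d : SpectralDecomposition a) (hg : ∀ x, ∃ C, ∀ k, |g x k| ≤ C)
    (hh : ∀ x, ∃ C, ∀ k, |h x k| ≤ C) :
    d.block τ g * d.block τ h = d.block τ fun x k => g x k * h x k := by
  rw [block, block, Finset.sum_mul_sum, block]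
  refine Finset.sum_congr rfl fun x hx => ?_
  rw [Finset.sum_eq_single x]
  · rw [rep_mul_diag_mul_rep_mul_diag (d.proj_mem x) (hg x) (hh x),
      (d.isStarProjection x).isIdempotentElem.eq]
  · intro y _ hy
    rw [rep_mul_diag_mul_rep_mul_diag (d.proj_mem y) (hg x) (hh y), d.mul_of_ne x y hy.symm,
      map_zero, zero_mul]
  · exact fun hn => absurd hx hn

theorem star_block (d : SpectralDecomposition a) (hg : ∀ x, ∃ C, ∀ k, |g x k| ≤ C) :
    star (d.block τ g) = d.block τ g := by
  rw [block, star_sum]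
  refine Finset.sum_congr rfl fun x _ => ?_
  rw [star_rep_mul_diag (d.proj_mem x) (hg x), (d.isStarProjection x).isSelfAdjoint.star_eq]

theorem one_sub_block (d : SpectralDecomposition a) (hg : ∀ x, ∃ C, ∀ k, |g x k| ≤ C) :
    1 - d.block τ g = d.block τ fun x k => 1 - g x k := by
  have h1 : (1 : L2 τ →L[ℂ] L2 τ) = ∑ x ∈ d.values, rep τ (d.proj x) := by
    rw [← map_sum, d.sum_proj, map_one]
  rw [block, block, h1, ← Finset.sum_sub_distrib]
  refine Finset.sum_congr rfl fun x _ => ?_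
  rw [← one_sub_diag (hg x), mul_sub, mul_one]

theorem norm_block_le (d : SpectralDecomposition a) {C : ℝ} (hC : 0 ≤ C)
    (hg : ∀ x, ∃ C, ∀ k, |g x k| ≤ C) (hgC : ∀ x ∈ d.values, ∀ k, |g x k| ≤ C) :
    ‖d.block τ g‖ ≤ C := by
  refine norm_sum_mul_le_of_commute _ _ _ hC (fun x _ => (d.isStarProjection x).map (rep τ))
    (fun x _ y _ hxy => ?_) (fun x _ => commute_rep_diag (d.proj_mem x) (hg x))
    fun x hx => norm_diag_le hC (hgC x hx)
  rw [← map_mul, d.mul_of_ne x y hxy, map_zero]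

theorem block_mem_algM (d : SpectralDecomposition a) (hg : ∀ x, ∃ C, ∀ k, |g x k| ≤ C) :
    d.block τ g ∈ algM τ :=
  sum_mem fun x _ => rep_mul_diag_mem_algM (d.proj_mem x) (hg x)

theorem tauDelta_block (d : SpectralDecomposition a) (hg : ∀ x, ∃ C, ∀ k, |g x k| ≤ C)
    (h0 : ∀ x k, 0 ≤ g x k) :
    tauDelta τ (d.block τ g) =
      ∑ x ∈ d.values, ENNReal.ofReal (τ.kms (d.proj x)).re * intSum (g x) := by
  rw [block, tauDelta_sum τ _ _ fun x _ =>
    rep_mul_diag_nonneg (d.proj_mem x) (d.isStarProjection x).nonneg (hg x) (h0 x)]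
  exact Finset.sum_congr rfl fun x _ =>
    tauDelta_rep_mul_diag (d.proj_mem x) (d.isStarProjection x).nonneg (hg x) (h0 x)

theorem rep_mul_diag_eq_block (d : SpectralDecomposition a) {f : ℤ → ℝ} (hf : ∃ C, ∀ k, |f k| ≤ C) :
    rep τ a * diag τ f = d.block τ fun x k => x * f k := by
  conv_lhs => rw [← d.sum_smul_proj]
  rw [map_sum, Finset.sum_mul, block]
  refine Finset.sum_congr rfl fun x _ => ?_
  rw [← smul_diag x hf, map_smul, smul_mul_assoc, mul_smul_comm]

theorem isStarProjection_block_cutoff (d : SpectralDecomposition a) (m : ℝ → ℕ) :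
    IsStarProjection (d.block τ fun x => cutoff (m x)) := by
  refine ⟨?_, d.star_block fun x => cutoff_bounded _⟩
  rw [IsIdempotentElem, d.block_mul_block (fun x => cutoff_bounded _) fun x => cutoff_bounded _]
  congr 1
  ext x k
  rw [cutoff]
  split_ifs <;> simp

variable (τ) in
theorem sum_re_kms_proj (d : SpectralDecomposition a) :
    ∑ x ∈ d.values, (τ.kms (d.proj x)).re = 1 := by
  rw [← Complex.re_sum, ← map_sum, d.sum_proj, kms_one, Complex.one_re]

variable (τ) in
theorem sum_mul_re_kms_proj (d : SpectralDecomposition a) :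
    ∑ x ∈ d.values, x * (τ.kms (d.proj x)).re = (τ.kms a).re := by
  conv_rhs => rw [← d.sum_smul_proj]
  rw [map_sum, Complex.re_sum]
  refine Finset.sum_congr rfl fun x _ => ?_
  rw [map_smul, smul_eq_mul, Complex.re_ofReal_mul]

theorem tauDelta_block_cutoff (d : SpectralDecomposition a) (m : ℝ → ℕ) :
    tauDelta τ (d.block τ fun x => cutoff (m x)) =
    ENNReal.ofReal (∑ x ∈ d.values, (τ.kms (d.proj x)).re * ((2 * m x - 1 : ℕ) : ℝ)) := by
  rw [d.tauDelta_block (fun x => cutoff_bounded _) fun x => cutoff_nonneg _,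
    ENNReal.ofReal_sum_of_nonneg fun x _ => mul_nonneg
      (re_kms_nonneg τ (d.isStarProjection x).nonneg) (Nat.cast_nonneg _)]
  refine Finset.sum_congr rfl fun x _ => ?_
  rw [intSum_cutoff, ENNReal.ofReal_mul (re_kms_nonneg τ (d.isStarProjection x).nonneg),
    ENNReal.ofReal_natCast]

/-- On the complement of the spectral region `|k| < ⌈x / c⌉` the joint symbol `x (1 + k²)^{-1/2}` is
at most `c`. -/
theorem modelSingularValue_le (d : SpectralDecomposition a) {c s : ℝ} (hc : 0 < c)
    (hs : 2 * (τ.kms a).re ≤ c * (s - 1)) :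
    modelSingularValue τ a s ≤ c := by
  set m : ℝ → ℕ := fun x => ⌈x / c⌉₊ with hm
  have hcut : ∀ x, ∃ C, ∀ k, |cutoff (m x) k| ≤ C := fun x => cutoff_bounded _
  have hcut' : ∀ x, ∃ C, ∀ k, |1 - cutoff (m x) k| ≤ C := fun x => one_sub_cutoff_bounded _
  have hR : ∃ C, ∀ k, |resolventSymbol 1 k| ≤ C := resolventSymbol_bounded zero_le_one
  have hxR : ∀ x : ℝ, ∃ C, ∀ k, |x * resolventSymbol 1 k| ≤ C := fun x =>
    bounded_mul ⟨|x|, fun _ => le_rfl⟩ hR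
  have hφ : tauDelta τ (1 - (1 - d.block τ fun x => cutoff (m x))) ≤ ENNReal.ofReal s := by
    rw [_root_.sub_sub_cancel, d.tauDelta_block_cutoff]
    refine ENNReal.ofReal_le_ofReal ?_
    calc _ ≤ ∑ x ∈ d.values, (τ.kms (d.proj x)).re * (2 * (x / c) + 1) := by
          refine Finset.sum_le_sum fun x hx => mul_le_mul_of_nonneg_left ?_
            (re_kms_nonneg τ (d.isStarProjection x).nonneg)
          have hx0 : 0 ≤ x / c := div_nonneg (d.nonneg x hx) hc.le
          have h1 := Nat.ceil_lt_add_one hx0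
          have h2 : ((2 * m x - 1 : ℕ) : ℝ) ≤ 2 * (m x : ℝ) - 1 ∨ m x = 0 := by
            rcases Nat.eq_zero_or_pos (m x) with h | h
            · exact Or.inr h
            · left
              rw [Nat.cast_sub (by omega)]
              push_cast
              rfl
          rcases h2 with h2 | h2
          · linarith
          · rw [h2]; norm_num; linarith
      _ = 2 / c * ∑ x ∈ d.values, x * (τ.kms (d.proj x)).re +
            ∑ x ∈ d.values, (τ.kms (d.proj x)).re := by
          rw [Finset.mul_sum, ← Finset.sum_add_distrib]
          exact Finset.sum_congr rfl fun x _ => by field_simp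
      _ ≤ s := by
          rw [d.sum_re_kms_proj τ, d.sum_mul_re_kms_proj τ, div_mul_eq_mul_div, ← le_sub_iff_add_le,
            div_le_iff₀ hc, mul_comm _ c]
          exact hs
  refine (singularValue_le (sub_mem (one_mem _) (d.block_mem_algM hcut))
    (d.isStarProjection_block_cutoff m).one_sub hφ).trans ?_
  rw [d.one_sub_block hcut, d.rep_mul_diag_eq_block hR, d.block_mul_block hxR hcut']
  exact d.norm_block_le hc.le (fun x => bounded_mul (hxR x) (hcut' x)) fun x hx =>
    resolventSymbol_mul_one_sub_cutoff_le (d.nonneg x hx) hc.le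
      (by rw [mul_comm, ← div_le_iff₀ hc]; exact Nat.le_ceil _)

/-- On the spectral region `|k| < ⌊x / c⌋` the joint symbol `x (1 + k²)^{-1/2}` is at least `c`, so
a projection `E` with `‖π(a) (1 + D²)^{-1/2} E‖ < c` has a complement at least as large, by the
trace property. -/
theorem le_modelSingularValue (d : SpectralDecomposition a) {c s : ℝ} (hc : 0 < c) (hs0 : 0 ≤ s)
    (hs : c * (s + 3) < 2 * (τ.kms a).re) : c ≤ modelSingularValue τ a s := by
  refine le_singularValue (tauDelta_zero τ) fun E hE hEp hφ => ?_
  by_contra! hlt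
  set m : ℝ → ℕ := fun x => ⌊x / c⌋₊ with hm
  have hcut : ∀ x, ∃ C, ∀ k, |cutoff (m x) k| ≤ C := fun x => cutoff_bounded _
  have hR : ∃ C, ∀ k, |resolventSymbol 1 k| ≤ C := resolventSymbol_bounded zero_le_one
  have hxR : ∀ x : ℝ, ∃ C, ∀ k, |x * resolventSymbol 1 k| ≤ C := fun x =>
    bounded_mul ⟨|x|, fun _ => le_rfl⟩ hR
  have hle : ∀ x k, k.natAbs < m x → c ≤ x * resolventSymbol 1 k := fun x k hk => by
    have hx : 0 ≤ x / c := by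
      by_contra! hneg
      simp [hm, Nat.floor_of_nonpos hneg.le] at hk
    refine le_mul_resolventSymbol hc.le ?_ hk
    rw [mul_comm, ← le_div_iff₀ hc]
    exact Nat.floor_le hx
  -- the inverse of the joint symbol on the spectral region
  set S : L2 τ →L[ℂ] L2 τ :=
    d.block τ fun x k => cutoff (m x) k * (x * resolventSymbol 1 k)⁻¹ with hS
  have hSC : ∀ x k, |cutoff (m x) k * (x * resolventSymbol 1 k)⁻¹| ≤ c⁻¹ := fun x k => by
    rw [cutoff]
    split_ifs with hk
    · have h1 := hle x k hk
      rw [one_mul, abs_of_nonneg (inv_nonneg.mpr (hc.le.trans h1))]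
      exact inv_anti₀ hc h1
    · simpa using hc.le
  have hSn : ‖S‖ ≤ c⁻¹ :=
    d.norm_block_le (inv_nonneg.mpr hc.le) (fun x => ⟨_, hSC x⟩) fun x _ => hSC x
  have hQ : S * (rep τ a * diag τ (resolventSymbol 1)) = d.block τ fun x => cutoff (m x) := by
    rw [d.rep_mul_diag_eq_block hR, hS, d.block_mul_block (fun x => ⟨_, hSC x⟩) hxR]
    congr 1
    ext x k
    by_cases hk : k.natAbs < m x
    · rw [mul_assoc, inv_mul_cancel₀ (hc.trans_le (hle x k hk)).ne', mul_one]
    · simp [cutoff, hk]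
  have hQE : ‖(d.block τ fun x => cutoff (m x)) * E‖ < 1 := by
    rw [← hQ, mul_assoc]
    calc _ ≤ ‖S‖ * ‖rep τ a * diag τ (resolventSymbol 1) * E‖ := norm_mul_le _ _
      _ ≤ c⁻¹ * ‖rep τ a * diag τ (resolventSymbol 1) * E‖ := by gcongr
      _ < c⁻¹ * c := by gcongr
      _ = 1 := inv_mul_cancel₀ hc.ne'
  have htr := trace_le_trace_one_sub (algM τ) (tauDelta τ) (fun _ _ => tauDelta_mono τ)
    (fun _ => tauDelta_star_mul_self τ) (d.block_mem_algM hcut) hE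
    (d.isStarProjection_block_cutoff m) hEp hQE
  rw [d.tauDelta_block_cutoff] at htr
  have h1 := (ENNReal.ofReal_le_ofReal_iff hs0).mp (htr.trans hφ)
  have h2 : 2 / c * (τ.kms a).re - 3 ≤
      ∑ x ∈ d.values, (τ.kms (d.proj x)).re * ((2 * m x - 1 : ℕ) : ℝ) := by
    calc _ = 2 / c * ∑ x ∈ d.values, x * (τ.kms (d.proj x)).re -
            3 * ∑ x ∈ d.values, (τ.kms (d.proj x)).re := by
          rw [d.sum_re_kms_proj τ, d.sum_mul_re_kms_proj τ, mul_one]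
      _ = ∑ x ∈ d.values, (τ.kms (d.proj x)).re * (2 * (x / c) - 3) := by
          rw [Finset.mul_sum, Finset.mul_sum, ← Finset.sum_sub_distrib]
          exact Finset.sum_congr rfl fun x _ => by field_simp
      _ ≤ _ := by
          refine Finset.sum_le_sum fun x _ => mul_le_mul_of_nonneg_left ?_
            (re_kms_nonneg τ (d.isStarProjection x).nonneg)
          have h3 := Nat.lt_floor_add_one (x / c)
          have h4 : 2 * (m x : ℝ) ≤ ((2 * m x - 1 : ℕ) : ℝ) + 1 := by
            exact_mod_cast (by omega : 2 * m x ≤ 2 * m x - 1 + 1)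
          linarith
  have h3 : s + 3 < 2 / c * (τ.kms a).re := by
    rw [div_mul_eq_mul_div, lt_div_iff₀ hc, mul_comm _ c]
    exact hs
  linarith

end SpectralDecomposition

section Asymptotics

variable {n : ℕ} {τ : FaithfulNormalizedTrace n}

/-- Comparison of `f` with a nearby element `a` of finite spectrum: a cutoff at `m ≈ η s / 2` costs
the fraction `η` of the argument `s` and the error `η² / m ≈ 2 η / s`. -/
theorem eventually_modelSingularValue_bounds {f : CuntzAlgebra n} (hf : f ∈ fixedAlgebra n)
    (hf0 : 0 ≤ f) {η : ℝ} (hη : 0 < η) (hη1 : η < 1) : ∀ᶠ s in atTop,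
      (2 * (τ.kms f).re - 4 * η) / (1 + η) - 4 * η ≤ s * modelSingularValue τ f s ∧
      s * modelSingularValue τ f s ≤ (2 * (τ.kms f).re + 3 * η) / (1 - η) + 4 * η := by
  set t := (τ.kms f).re with ht
  have hcont : Continuous fun a => (τ.kms a).re := Complex.continuous_re.comp (continuous_kms τ)
  have hU : {a | ‖f - a‖ < η ^ 2} ∩ {a | |(τ.kms a).re - t| < η} ∈ 𝓝 f := by
    refine inter_mem ?_ ?_
    · exact (isOpen_lt (by fun_prop) continuous_const).mem_nhds (by simpa using by positivity)
    · exact (isOpen_lt (hcont.sub continuous_const).abs continuous_const).mem_nhds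
        (by simpa [ht] using hη)
  obtain ⟨a, ⟨ha1, ha2⟩, -, -, ⟨d⟩⟩ := exists_spectralDecomposition_near hf hf0 hU
  obtain ⟨ha3, ha4⟩ := abs_lt.mp (show |(τ.kms a).re - t| < η from ha2)
  have ht0 : 0 ≤ t := re_kms_nonneg τ hf0
  have hanti : Antitone (modelSingularValue τ f) := antitone_singularValue (tauDelta_zero τ)
  have hanti' : Antitone (modelSingularValue τ a) := antitone_singularValue (tauDelta_zero τ)
  have e1 : 0 < 1 - η := by linarith
  filter_upwards [eventually_ge_atTop (4 / η), eventually_ge_atTop ((2 * t + 3 * η) / (1 - η) / η),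
    eventually_gt_atTop (3 * (2 * t) / (2 * η))] with s hs1 hs2 hs3
  have hs4 : 4 ≤ s * η := (div_le_iff₀ hη).mp hs1
  have hs : 0 < s := by nlinarith
  set m : ℕ := ⌊s * η / 2⌋₊ with hm
  have hm1 : (m : ℝ) ≤ s * η / 2 := Nat.floor_le (by positivity)
  have hm2 : s * η / 2 < m + 1 := Nat.lt_floor_add_one _
  have hm3 : s * η / 4 ≤ m := by linarith
  have hm4 : (0 : ℝ) < m := by linarith
  have hm0 : m ≠ 0 := by exact_mod_cast hm4.ne'
  have herr : ‖f - a‖ / m ≤ 4 * η / s := by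
    rw [div_le_div_iff₀ hm4 hs]
    have : ‖f - a‖ ≤ η ^ 2 := le_of_lt ha1
    nlinarith
  have herr' : ‖a - f‖ / m ≤ 4 * η / s := by rwa [norm_sub_rev]
  have hmul : s * (4 * η / s) = 4 * η := by field_simp
  constructor
  · have h1 := modelSingularValue_add_le (τ := τ) a f hm0 hs.le
    have h2 : modelSingularValue τ a ((1 + η) * s) ≤ modelSingularValue τ a (s + 2 * m) :=
      hanti' (by linarith)
    have h3 : (2 * t - 4 * η) / (1 + η) ≤ s * modelSingularValue τ a ((1 + η) * s) := by
      rcases le_or_gt (2 * t - 4 * η) 0 with hneg | hpos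
      · exact (div_nonpos_of_nonpos_of_nonneg hneg (by positivity)).trans
          (mul_nonneg hs.le (singularValue_nonneg _))
      · have hc : 0 < (2 * t - 4 * η) / ((1 + η) * s) := by positivity
        have h4 := d.le_modelSingularValue (τ := τ) hc (s := (1 + η) * s) (by positivity) (by
          have h5 : (2 * t - 4 * η) / ((1 + η) * s) * ((1 + η) * s) = 2 * t - 4 * η := by field_simp
          have h6 : (2 * t - 4 * η) / ((1 + η) * s) ≤ 2 * t / s := by
            gcongr
            · linarith
            · nlinarith
          have h7 : 3 * (2 * t / s) < 2 * η := by
            rw [div_lt_iff₀ (by positivity)] at hs3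
            rw [← mul_div_assoc, div_lt_iff₀ hs]
            linarith
          rw [mul_add, h5]
          linarith)
        calc (2 * t - 4 * η) / (1 + η) = s * ((2 * t - 4 * η) / ((1 + η) * s)) := by field_simp
          _ ≤ _ := by gcongr
    have h8 := mul_le_mul_of_nonneg_left (h2.trans (h1.trans (add_le_add_right herr' _))) hs.le
    rw [mul_add, hmul] at h8
    linarith
  · have h1 := modelSingularValue_add_le (τ := τ) f a hm0 (s := (1 - η) * s) (by positivity)
    have h2 : modelSingularValue τ f s ≤ modelSingularValue τ f ((1 - η) * s + 2 * m) :=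
      hanti (by linarith)
    have h3 : modelSingularValue τ a ((1 - η) * s) ≤ (2 * t + 3 * η) / (1 - η) / s := by
      refine d.modelSingularValue_le (by positivity) ?_
      have h4 : (2 * t + 3 * η) / (1 - η) / s ≤ η := by
        rw [div_le_iff₀ hs, ← div_le_iff₀' hη]
        exact hs2
      have h5 : (2 * t + 3 * η) / (1 - η) / s * ((1 - η) * s) = 2 * t + 3 * η := by field_simp
      rw [mul_sub, h5]
      linarith
    have h6 := mul_le_mul_of_nonneg_left (h2.trans (h1.trans (add_le_add h3 herr))) hs.le
    rw [mul_add, hmul, mul_div_cancel₀ _ hs.ne'] at h6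
    exact h6

theorem tendsto_mul_modelSingularValue {f : CuntzAlgebra n} (hf : f ∈ fixedAlgebra n)
    (hf0 : 0 ≤ f) :
    Tendsto (fun s => s * modelSingularValue τ f s) atTop (𝓝 (2 * (τ.kms f).re)) := by
  set t := (τ.kms f).re with ht
  have hL : Tendsto (fun η : ℝ => (2 * t - 4 * η) / (1 + η) - 4 * η) (𝓝[>] 0) (𝓝 (2 * t)) := by
    have : ContinuousAt (fun η : ℝ => (2 * t - 4 * η) / (1 + η) - 4 * η) 0 := by
      fun_prop (disch := norm_num)
    simpa using this.tendsto.mono_left nhdsWithin_le_nhds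
  have hU : Tendsto (fun η : ℝ => (2 * t + 3 * η) / (1 - η) + 4 * η) (𝓝[>] 0) (𝓝 (2 * t)) := by
    have : ContinuousAt (fun η : ℝ => (2 * t + 3 * η) / (1 - η) + 4 * η) 0 := by
      fun_prop (disch := norm_num)
    simpa using this.tendsto.mono_left nhdsWithin_le_nhds
  have hη : ∀ᶠ η : ℝ in 𝓝[>] 0, η ∈ Set.Ioo (0 : ℝ) 1 := Ioo_mem_nhdsGT one_pos
  refine tendsto_order.mpr ⟨fun l hl => ?_, fun u hu => ?_⟩
  · obtain ⟨η, h1, h2⟩ := ((hL.eventually (lt_mem_nhds hl)).and hη).exists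
    filter_upwards [eventually_modelSingularValue_bounds (τ := τ) hf hf0 h2.1 h2.2] with s hs
    exact h1.trans_le hs.1
  · obtain ⟨η, h1, h2⟩ := ((hU.eventually (gt_mem_nhds hu)).and hη).exists
    filter_upwards [eventually_modelSingularValue_bounds (τ := τ) hf hf0 h2.1 h2.2] with s hs
    exact hs.2.trans_lt h1

theorem rep_mul_diag_mem_weakTraceIdeal {f : CuntzAlgebra n} (hf : f ∈ fixedAlgebra n) :
    rep τ f * diag τ (resolventSymbol 1) ∈ weakTraceIdeal (algM τ) (tauDelta τ) := by
  refine ⟨rep_mul_diag_mem_algM hf (resolventSymbol_bounded zero_le_one), 6 * ‖f‖, ?_⟩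
  rintro _ ⟨t, ht, rfl⟩
  exact logMean_le (tauDelta_zero τ) (fun s => modelSingularValue_le f) ht

theorem dixmierTrace_rep_mul_diag (ω : DixmierState) {f : CuntzAlgebra n}
    (hf : f ∈ fixedAlgebra n) :
    dixmierTrace ω (algM τ) (tauDelta τ) (rep τ f * diag τ (resolventSymbol 1)) =
      2 * τ.kms f := by
  rw [dixmierTrace, linearExtension_rep_mul_diag (c := 2) (resolventSymbol_bounded zero_le_one)
    (resolventSymbol_nonneg 1) (fun a ha ha0 => ?_) hf]
  · norm_num
  · have hK : ∀ s, 0 ≤ s → singularValue (algM τ) (tauDelta τ)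
        (rep τ a * diag τ (resolventSymbol 1)) s ≤ 6 * ‖a‖ / (1 + s) :=
      fun s => modelSingularValue_le a
    exact ω.eval_eq_of_tendsto (memLp_logMean (tauDelta_zero τ) hK)
      (tendsto_logMean (tauDelta_zero τ) hK (tendsto_mul_modelSingularValue ha ha0))

end Asymptotics

end ModularCuntz

theorem proposition3p12 {n : ℕ} (hn : 2 ≤ n) (τ : FaithfulNormalizedTrace n) :
    resolventPower τ 1 ∈ weakTraceIdeal (algM τ) (tauDelta τ) ∧
    (∀ s : ℝ, 1 < s →
      0 ≤ resolventPower τ s ∧ resolventPower τ s ∈ algM τ ∧ tauDelta τ (resolventPower τ s) < ∞) ∧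
    ∀ f : fixedAlgebra n,
      (∀ s : ℝ, 1 < s →
        rep τ f * resolventPower τ s ∈ traceIdeal (algM τ) (tauDelta τ)) ∧
      Tendsto (fun s : ℝ => ((s : ℂ) - 1) *
          traceValue (tauDelta τ) (rep τ f * resolventPower τ s))
        (𝓝[>] 1) (𝓝 (2 * τ f)) ∧
      IsMeasurableOperator (algM τ) (tauDelta τ) (rep τ f * resolventPower τ 1) := by
  refine ⟨?_, fun s hs => ?_, fun f => ⟨fun s hs => ?_, ?_, ?_⟩⟩
  · have h := rep_mul_diag_mem_weakTraceIdeal (τ := τ) (one_mem (fixedAlgebra n))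
    rwa [map_one, one_mul, ← resolventPower_eq_diag zero_le_one] at h
  · have hb := resolventSymbol_bounded (zero_le_one.trans hs.le)
    rw [resolventPower_eq_diag (zero_le_one.trans hs.le)]
    refine ⟨diag_nonneg hb (resolventSymbol_nonneg s), diag_mem_algM hb, ?_⟩
    have h := tauDelta_rep_mul_resolventSymbol_lt_top (τ := τ) (one_mem (fixedAlgebra n))
      zero_le_one hs
    rwa [map_one, one_mul] at h
  · have hb := resolventSymbol_bounded (zero_le_one.trans hs.le)
    rw [resolventPower_eq_diag (zero_le_one.trans hs.le)]
    refine ⟨rep_mul_diag_mem_algM f.2 hb, ?_⟩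
    rw [abs_rep_mul_diag f.2 hb (resolventSymbol_nonneg s)]
    exact tauDelta_rep_mul_resolventSymbol_lt_top (abs_mem_fixedAlgebra f.2) (CFC.abs_nonneg _) hs
  · have h := ((Complex.continuous_ofReal.tendsto 2).comp tendsto_sub_one_mul_intSum).mul_const
      (τ f)
    rw [Complex.ofReal_ofNat] at h
    refine h.congr' ?_
    filter_upwards [self_mem_nhdsWithin] with s hs
    rw [resolventPower_eq_diag (zero_le_one.trans (Set.mem_Ioi.mp hs).le),
      traceValue_rep_mul_resolventSymbol f.2 hs, kms_coe]
    simp only [Function.comp_apply]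
    push_cast
    ring
  · rw [resolventPower_eq_diag zero_le_one]
    exact ⟨rep_mul_diag_mem_weakTraceIdeal f.2, 2 * τ.kms f,
      fun ω => dixmierTrace_rep_mul_diag ω f.2⟩
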